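/- Let $\lambda,\varepsilon,d>0$, $-\pi/2<\theta<\pi/2$ and $\kappa=2\pi/\lambda$. Put $\mathbb R^2_+=\{x_2>0\}$, $\Gamma_0=\{x_2=0\}$, $\Gamma_\varepsilon^+=(0,\varepsilon)\times\{0\}$, $D_\varepsilon=(0,\varepsilon)\times(-d,0)$, $\phi_0=1/\sqrt{\varepsilon}$, and $$u^{\rm inc}(x)=e^{i\kappa(x_1\sin\theta-x_2\cos\theta)},\qquad u^{\rm ref}(x)=e^{i\kappa(x_1\sin\theta+x_2\cos\theta)}.$$ For a function $v$ write $v_0^+=\int_0^\varepsilon v(x_1,0)\,\overline{\phi_0}\,dx_1$, where $v(\cdot,0)$ is the trace on $\Gamma_\varepsilon^+$ from above, and $$v_0^-=\frac{2v_0^+}{e^{i\kappa d}+e^{-i\kappa d}},\qquad \mathscr B_0[v]=i\kappa\,\frac{e^{i\kappa d}-e^{-i\kappa d}}{e^{i\kappa d}+e^{-i\kappa d}}\,v_0^+\phi_0 .$$ Let $v_\varepsilon$ be a solution of the approximate PEC-PEC cavity model: in $\mathbb R^2_+$ it is a solution, with $v_\varepsilon\in H^1(\mathbb R^2_+\cap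 B_R)$ for every ball $B_R$ of radius $R$ centred at the origin, of $$\begin{cases}\Delta v_\varepsilon+\kappa^2v_\varepsilon=0 & \text{in }\mathbb R^2_+,\\ \partial_\nu v_\varepsilon=0 & \text{on }\Gamma_0\setminus\Gamma_\varepsilon^+,\\ \partial_{x_2}v_\varepsilon=\mathscr B_0[v_\varepsilon] & \text{on }\Gamma_\varepsilon^+,\\ \sqrt r\,(\partial_r v_\varepsilon^{\rm sc}-i\kappa v_\varepsilon^{\rm sc})\to0 & \text{as } r=|x|\to\infty\text{ in }\mathbb R^2_+,\text{ uniformly in the direction,}\end{cases}\qquad v_\varepsilon^{\rm sc}=v_\varepsilon-(u^{\rm inc}+u^{\rm ref}),$$ where the boundary conditions on $\Gamma_0$ are understood in the weak (variational) sense; and inside the cavity $$v_\varepsilon(x)=\bigl(\tilde\alpha_0^+e^{-i\kappa x_2}+\tilde\alpha_0^-e^{i\kappa(x_2+d)}\bigr)\phi_0,\quad x\in D_\varepsilon,\qquad \tilde\alpha_0^\pm=\frac{e^{i\kappa d}v_{\varepsilon,0}^\mp-v_{\varepsilon,0}^\pm}{e^{2i\kappa d}-1},$$ with $v_{\varepsilon,0}^{\pm}$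 the numbers $v_0^{\pm}$ for $v=v_\varepsilon$. Then, in the regime $\varepsilon\ll d\ll\lambda$, the norm of $v_\varepsilon$ on $D_\varepsilon$ is of order $\sqrt{\varepsilon d}$. Precisely, there are positive constants $C_3,C_4,\delta$, independent of $\lambda,\varepsilon,d$ (and $\theta$), such that whenever $\varepsilon\le\delta d$ and $d\le\delta\lambda$, every such $v_\varepsilon$ satisfies $$C_3\sqrt{\varepsilon d}\le\|v_\varepsilon\|_{L^2(D_\varepsilon)}\le C_4\sqrt{\varepsilon d}.$$ -/

import Mathlib

open MeasureTheory Filter Topology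
open scoped InnerProductSpace Laplacian ContDiff

noncomputable section

namespace OpenCavity

/-- The Euclidean plane, with points `x = (x 0, x 1)`; the second coordinate is the vertical one. -/
abbrev Plane : Type := EuclideanSpace ℝ (Fin 2)

/-- The open upper half-plane. -/
def upperHalf : Set Plane := {x | 0 < x 1}

/-- The rectangular cavity `(0, ε) × (-d, 0)`. -/
def cavity (ε d : ℝ) : Set Plane := {x | 0 < x 0 ∧ x 0 < ε ∧ -d < x 1 ∧ x 1 < 0}

/-- The partial derivative `∂ᵢ f (x)`. -/
def partialD (i : Fin 2) (f : Plane → ℂ) (x : Plane) : ℂ :=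
  fderiv ℝ f x (EuclideanSpace.single i 1)

/-- The wavenumber `κ = 2π / λ` that belongs to the wavelength `lam`. -/
def wavenumber (lam : ℝ) : ℝ := 2 * Real.pi / lam

/-- The incident plane wave `exp(iκ x·(sin θ, -cos θ))`. -/
def uInc (κ θ : ℝ) (x : Plane) : ℂ :=
  Complex.exp (Complex.I * κ * ((x 0 * Real.sin θ - x 1 * Real.cos θ : ℝ) : ℂ))

/-- The wave reflected by the plane `x₂ = 0`, i.e. `exp(iκ x·(sin θ, cos θ))`. -/
def uRef (κ θ : ℝ) (x : Plane) : ℂ :=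
  Complex.exp (Complex.I * κ * ((x 0 * Real.sin θ + x 1 * Real.cos θ : ℝ) : ℂ))

/-- The scattered part of a total field in the upper half-plane. -/
def scattered (κ θ : ℝ) (v : Plane → ℂ) (x : Plane) : ℂ :=
  v x - (uInc κ θ x + uRef κ θ x)

/-- The radial derivative `∂ᵣ f (x)`, `r = |x|`. -/
def radialD (f : Plane → ℂ) (x : Plane) : ℂ := fderiv ℝ f x (‖x‖⁻¹ • x)

/-- The Sommerfeld radiation condition in the upper half-plane: `√r (∂ᵣ w - iκ w) → 0` as `r → ∞`,
uniformly in the direction. -/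
def Radiating (κ : ℝ) (w : Plane → ℂ) : Prop :=
  Tendsto (fun x : Plane => (Real.sqrt ‖x‖ : ℂ) * (radialD w x - Complex.I * κ * w x))
    (Bornology.cobounded Plane ⊓ 𝓟 upperHalf) (𝓝 0)

/-- The zeroth waveguide mode `φ₀ = 1/√ε` on `(0, ε)`. -/
def phi0 (ε : ℝ) (_t : ℝ) : ℂ := ((1 / Real.sqrt ε : ℝ) : ℂ)

/-- The zeroth Fourier coefficient `⟨f, φ₀⟩` of a function on the aperture. -/
def coeff0 (ε : ℝ) (f : ℝ → ℂ) : ℂ :=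
  ∫ t in (0 : ℝ)..ε, f t * (starRingEnd ℂ) (phi0 ε t)

/-- The coefficient `v₀⁺` of the values of `v` on the aperture `(0, ε) × {0}`. -/
def v0plus (ε : ℝ) (v : Plane → ℂ) : ℂ := coeff0 ε (fun t => v !₂[t, 0])

/-- The coefficient `v₀⁻ = 2 v₀⁺ / (e^{iκd} + e^{-iκd})` on the bottom of the cavity. -/
def v0minus (κ ε d : ℝ) (v : Plane → ℂ) : ℂ :=
  2 * v0plus ε v / (Complex.exp (Complex.I * κ * d) + Complex.exp (-(Complex.I * κ * d)))

/-- The one-mode Dirichlet-to-Neumann map of the PEC-PEC cavity,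
`iκ (e^{iκd} - e^{-iκd}) / (e^{iκd} + e^{-iκd}) v₀⁺ φ₀`, as a function on the aperture. -/
def dtn0 (κ ε d : ℝ) (v : Plane → ℂ) (t : ℝ) : ℂ :=
  Complex.I * κ
    * ((Complex.exp (Complex.I * κ * d) - Complex.exp (-(Complex.I * κ * d)))
      / (Complex.exp (Complex.I * κ * d) + Complex.exp (-(Complex.I * κ * d))))
    * v0plus ε v * phi0 ε t

/-- The amplitude `α₀⁺ = (e^{iκd} v₀⁻ - v₀⁺) / (e^{2iκd} - 1)`. -/
def alphaPlus (κ ε d : ℝ) (v : Plane → ℂ) : ℂ :=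
  (Complex.exp (Complex.I * κ * d) * v0minus κ ε d v - v0plus ε v)
    / (Complex.exp (2 * (Complex.I * κ * d)) - 1)

/-- The amplitude `α₀⁻ = (e^{iκd} v₀⁺ - v₀⁻) / (e^{2iκd} - 1)`. -/
def alphaMinus (κ ε d : ℝ) (v : Plane → ℂ) : ℂ :=
  (Complex.exp (Complex.I * κ * d) * v0plus ε v - v0minus κ ε d v)
    / (Complex.exp (2 * (Complex.I * κ * d)) - 1)

/-- The single-mode field
`(α₀⁺ e^{-iκx₂} + α₀⁻ e^{iκ(x₂ + d)}) φ₀(x₁)`, `x ∈ D_ε`, that continues `v` into the cavity. -/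
def cavityField (κ ε d : ℝ) (v : Plane → ℂ) (x : Plane) : ℂ :=
  (alphaPlus κ ε d v * Complex.exp (-(Complex.I * κ * (x 1 : ℂ)))
    + alphaMinus κ ε d v * Complex.exp (Complex.I * κ * ((x 1 : ℂ) + d))) * phi0 ε (x 0)

/-- `v` solves the approximate PEC-PEC cavity problem with wavenumber `κ`, angle of incidence `θ`,
width `ε` and depth `d`: above the plane it is a (variational) solution of
`Δv + κ²v = 0` in the half-plane, `∂₂v = 0` on `{x₂ = 0}` off the aperture,
`∂₂v = dtn0 v` on the aperture, with radiating scattered part; in the cavity it is the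
single-mode field. -/
structure IsApproxSolution (κ θ ε d : ℝ) (v : Plane → ℂ) : Prop where
  smooth : ContDiffOn ℝ 2 v upperHalf
  helmholtz : ∀ x ∈ upperHalf, (Δ v) x + (κ : ℂ) ^ 2 * v x = 0
  /-- `v` is in `H¹` of every bounded part of the half-plane. -/
  sq_integrable : ∀ R : ℝ, IntegrableOn (fun x => ‖v x‖ ^ 2) (upperHalf ∩ Metric.ball 0 R)
  energy : ∀ R : ℝ, IntegrableOn (fun x => ‖fderiv ℝ v x‖ ^ 2) (upperHalf ∩ Metric.ball 0 R)
  /-- The values of `v` on the aperture are its trace from above. For an `H¹` function that is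
  smooth in the open half-plane, the trace is the limit along almost every vertical line. -/
  trace : ∀ᵐ t ∂(volume.restrict (Set.Ioo 0 ε)),
    Tendsto (fun s : ℝ => v !₂[t, s]) (𝓝[>] 0) (𝓝 (v !₂[t, 0]))
  /-- Both boundary conditions in weak form. Note that `-∂₂` is the outward normal derivative. -/
  boundary : ∀ φ : Plane → ℂ, ContDiff ℝ ∞ φ → HasCompactSupport φ →
    ∫ x in upperHalf, (partialD 0 v x * partialD 0 φ x + partialD 1 v x * partialD 1 φ x
        - (κ : ℂ) ^ 2 * v x * φ x)
      = -∫ t in (0 : ℝ)..ε, dtn0 κ ε d v t * φ !₂[t, 0]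
  radiation : Radiating κ (scattered κ θ v)
  inside : ∀ x ∈ cavity ε d, v x = cavityField κ ε d v x

end OpenCavity

end

/-! The narrow, shallow cavity hardly disturbs the field at its mouth. Over a closed plane the total
field on the aperture is `u^inc + u^ref = 2 + O(κε)`, so `v₀⁺` should be close to `2√ε`; once
`|v₀⁺|` is known to be comparable to `√ε`, the theorem follows. Indeed the single-mode field
simplifies to `v₀⁺ cos(κ(x₂ + d)) / (√ε cos κd)` (`cavityField_eq`), which for `κd ≤ 1` is pointwise
comparable to `|v₀⁺|/√ε`, hence to 1, and the cavity has area `εd`.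

To control `v₀⁺`, consider the scattered field `w`. It radiates, and its Neumann data are a constant
`c` on the aperture and zero elsewhere, with `|c| ≤ 2κ|v₀⁺|/√ε` (`norm_dtn0_le`). Green's second
identity with the Neumann function of the half-plane expresses `w` above the aperture as an integral
of that function against `c` (`ApertureField.representation`). The Neumann function is bounded by a
multiple of `(κ|t - s|)^(-1/2)`. This is cruder than the logarithm near the pole, but it holds at
all distances and is integrable, so `|w| ≤ C|c|√ε/√κ ≤ C'√κ|v₀⁺|` (`ApertureField.norm_le`).
Averaging the trace gives `|v₀⁺ - 2√ε| ≤ (2κε + C'√κ|v₀⁺|)√ε`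
(`IsApproxSolution.norm_v0plus_sub_le`), and for small `κε` the last term is absorbed on the left.
Existence and uniqueness for the scattering problem play no role.

The analytic input is built by hand. The outgoing radial solution is `e^{ir}` times a Laplace
integral, from which its decay, its radiation defect and its singularity can be read off. Boundary
integrals over circles are replaced by integrals against gradients of smooth radial cutoffs, so
every flux is a weighted average of a Wronskian over an annulus. Small annuli around the pole yield
the point value (`tendsto_wronskian_pole`), large ones yield nothing
(`tendsto_integral_wronskian_atTop`). For the latter no `L²` bound on `w` at infinity is needed:
integrating the radiation condition along rays gives `w = o(√r)` in the mean, and the radiation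
defect of the Neumann function, of order `r^(-3/2)`, makes up for it. -/

noncomputable section

namespace OpenCavity

/-! ### The outgoing radial solution of the Helmholtz equation in the plane -/

/-- The factor `(1 - 2i/s)^{-1/2}`. -/
def hankelWeight (s : ℝ) : ℂ := (1 - 2 * Complex.I / s) ^ (-(1 / 2) : ℂ)

/-- The density `(s² - 2is)^{-1/2}` whose Laplace transform is `e^{-ir} H₀⁽¹⁾(r)`, up to a constant
factor. -/
def hankelDensity (s : ℝ) : ℂ := hankelWeight s / s

lemma hankelWeight_base_re {s : ℝ} : (1 - 2 * Complex.I / (s : ℂ)).re = 1 := by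
  simp [Complex.div_re]

lemma hankelWeight_base_mem {s : ℝ} : (1 - 2 * Complex.I / (s : ℂ)) ∈ Complex.slitPlane := by
  left; rw [hankelWeight_base_re]; exact one_pos

lemma norm_hankelWeight (s : ℝ) :
    ‖hankelWeight s‖ = ‖(1 - 2 * Complex.I / (s : ℂ))‖ ^ (-(1 / 2) : ℝ) := by
  rw [hankelWeight, ← Complex.norm_cpow_real]
  norm_num

/-- The base of the power has real part 1, hence modulus at least 1. This is the bound used for
domination and at large `s`; the next one serves near zero. -/
lemma norm_hankelWeight_le_one (s : ℝ) : ‖hankelWeight s‖ ≤ 1 := by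
  rw [norm_hankelWeight]
  apply Real.rpow_le_one_of_one_le_of_nonpos _ (by norm_num)
  calc (1 : ℝ) = |(1 - 2 * Complex.I / (s : ℂ)).re| := by rw [hankelWeight_base_re]; simp
    _ ≤ _ := Complex.abs_re_le_norm _

lemma norm_hankelWeight_le {s : ℝ} (hs : 0 < s) : ‖hankelWeight s‖ ≤ s ^ (1 / 2 : ℝ) := by
  have h1 : 1 / s ≤ ‖(1 - 2 * Complex.I / (s : ℂ))‖ := by
    calc 1 / s ≤ 2 / s := by gcongr; norm_num
      _ = |(1 - 2 * Complex.I / (s : ℂ)).im| := by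
        have : (1 - 2 * Complex.I / (s : ℂ)).im = -(2 / s) := by
          simp [Complex.div_im, Complex.normSq_apply]; field_simp
        rw [this, abs_neg, abs_of_pos (by positivity)]
      _ ≤ _ := Complex.abs_im_le_norm _
  rw [norm_hankelWeight]
  calc _ ≤ (1 / s) ^ (-(1 / 2) : ℝ) :=
        Real.rpow_le_rpow_of_nonpos (by positivity) h1 (by norm_num)
    _ = s ^ (1 / 2 : ℝ) := by
        rw [one_div, Real.inv_rpow hs.le, Real.rpow_neg hs.le, inv_inv]

/-- A single power for all `s > 0`, although the density is of size `1/s` at infinity. Its Laplace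
transform is a Gamma integral, so the radial solution gets the global bound `r^(-1/2)` without
separating small and large `r`. -/
lemma norm_hankelDensity_le {s : ℝ} (hs : 0 < s) : ‖hankelDensity s‖ ≤ s ^ (-(1 / 2) : ℝ) := by
  rw [hankelDensity, norm_div, Complex.norm_real, Real.norm_of_nonneg hs.le, div_le_iff₀ hs]
  calc _ ≤ s ^ (1 / 2 : ℝ) := norm_hankelWeight_le hs
    _ = s ^ (-(1 / 2) : ℝ) * s := by
      nth_rw 3 [← Real.rpow_one s]
      rw [← Real.rpow_add hs]; norm_num

lemma hasDerivAt_hankelWeight {s : ℝ} (hs : 0 < s) :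
    HasDerivAt hankelWeight (-Complex.I * hankelWeight s / (s * (s - 2 * Complex.I))) s := by
  have hs' : (s : ℂ) ≠ 0 := by exact_mod_cast hs.ne'
  have h2 : (s : ℂ) - 2 * Complex.I ≠ 0 := by
    intro h; have := congrArg Complex.re h; simp at this; exact hs.ne' this
  have h1 : HasDerivAt (fun z : ℂ => 1 - 2 * Complex.I / z)
      (2 * Complex.I / (s : ℂ) ^ 2) (s : ℂ) := by
    have := ((hasDerivAt_inv hs').const_mul (2 * Complex.I)).const_sub 1
    refine this.congr_deriv ?_
    ring
  have h3 := (h1.cpow_const (c := (-(1 / 2) : ℂ)) hankelWeight_base_mem).comp_ofReal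
  have hb : (1 - 2 * Complex.I / (s : ℂ)) ≠ 0 := Complex.slitPlane_ne_zero hankelWeight_base_mem
  refine HasDerivAt.congr_deriv (f := hankelWeight) h3 ?_
  rw [Complex.cpow_sub _ _ hb, Complex.cpow_one, hankelWeight]
  have : (1 - 2 * Complex.I / (s : ℂ)) = (s - 2 * Complex.I) / s := by field_simp
  rw [this]
  field_simp

lemma continuousOn_hankelDensity : ContinuousOn hankelDensity (Set.Ioi 0) := by
  have h : ContinuousOn hankelWeight (Set.Ioi 0) :=
    fun s hs => (hasDerivAt_hankelWeight hs).continuousAt.continuousWithinAt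
  exact h.div Complex.continuous_ofReal.continuousOn fun s hs => by
    exact_mod_cast (ne_of_gt hs)

/-- The function `(s² - 2is)^{1/2}`. -/
def hankelRoot (s : ℝ) : ℂ := ((s : ℂ) ^ 2 - 2 * Complex.I * s) * hankelDensity s

lemma hasDerivAt_hankelRoot {s : ℝ} (hs : 0 < s) :
    HasDerivAt hankelRoot ((s - Complex.I) * hankelDensity s) s := by
  have hs' : (s : ℂ) ≠ 0 := by exact_mod_cast hs.ne'
  have h2 : (s : ℂ) - 2 * Complex.I ≠ 0 := by
    intro h; have := congrArg Complex.re h; simp at this; exact hs.ne' this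
  have h1 : HasDerivAt (fun t : ℝ => ((t : ℂ) - 2 * Complex.I) * hankelWeight t)
      (1 * hankelWeight s + ((s : ℂ) - 2 * Complex.I) *
        (-Complex.I * hankelWeight s / (s * (s - 2 * Complex.I)))) s :=
    ((hasDerivAt_id s).ofReal_comp.sub_const _).mul (hasDerivAt_hankelWeight hs)
  have h3 : hankelRoot =ᶠ[𝓝 s] fun t : ℝ => ((t : ℂ) - 2 * Complex.I) * hankelWeight t := by
    filter_upwards [lt_mem_nhds hs] with t ht
    have : (t : ℂ) ≠ 0 := by exact_mod_cast ht.ne'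
    rw [hankelRoot, hankelDensity]; field_simp
  refine (h1.congr_of_eventuallyEq h3).congr_deriv ?_
  rw [hankelDensity]; field_simp; ring

/-- The moments `∫₀^∞ sⁿ (s² - 2is)^{-1/2} e^{-rs} ds`. -/
def hankelMoment (n : ℕ) (r : ℝ) : ℂ :=
  ∫ s in Set.Ioi (0 : ℝ), (s : ℂ) ^ n * hankelDensity s * (Real.exp (-(r * s)) : ℂ)

lemma integrableOn_rpow_mul_exp {a r : ℝ} (ha : -1 < a) (hr : 0 < r) :
    IntegrableOn (fun s : ℝ => s ^ a * Real.exp (-(r * s))) (Set.Ioi 0) := by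
  have := integrableOn_rpow_mul_exp_neg_mul_rpow ha one_pos hr
  simpa using this

lemma norm_hankelMoment_integrand_le (n : ℕ) (r : ℝ) {s : ℝ} (hs : 0 < s) :
    ‖(s : ℂ) ^ n * hankelDensity s * (Real.exp (-(r * s)) : ℂ)‖
      ≤ s ^ (n - 1 / 2 : ℝ) * Real.exp (-(r * s)) := by
  rw [norm_mul, norm_mul, norm_pow, Complex.norm_real, Complex.norm_real,
    Real.norm_of_nonneg hs.le, Real.norm_of_nonneg (Real.exp_pos _).le]
  gcongr
  calc s ^ n * ‖hankelDensity s‖ ≤ s ^ n * s ^ (-(1 / 2) : ℝ) := by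
        gcongr; exact norm_hankelDensity_le hs
    _ = _ := by rw [← Real.rpow_natCast, ← Real.rpow_add hs, sub_eq_add_neg]

lemma aestronglyMeasurable_hankelMoment (n : ℕ) (r : ℝ) :
    AEStronglyMeasurable (fun s : ℝ => (s : ℂ) ^ n * hankelDensity s * (Real.exp (-(r * s)) : ℂ))
      (volume.restrict (Set.Ioi 0)) := by
  refine ContinuousOn.aestronglyMeasurable ?_ measurableSet_Ioi
  refine ContinuousOn.mul (ContinuousOn.mul ?_ continuousOn_hankelDensity) ?_
  · fun_prop
  · fun_prop

lemma neg_one_lt_natCast_sub (n : ℕ) : (-1 : ℝ) < n - 1 / 2 := by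
  have : (0 : ℝ) ≤ n := n.cast_nonneg
  linarith

lemma integrableOn_hankelMoment (n : ℕ) {r : ℝ} (hr : 0 < r) :
    IntegrableOn (fun s : ℝ => (s : ℂ) ^ n * hankelDensity s * (Real.exp (-(r * s)) : ℂ))
      (Set.Ioi 0) := by
  refine (integrableOn_rpow_mul_exp (neg_one_lt_natCast_sub n) hr).mono'
    (aestronglyMeasurable_hankelMoment n r) ?_
  filter_upwards [ae_restrict_mem measurableSet_Ioi] with s hs
  exact norm_hankelMoment_integrand_le n r hs

lemma norm_hankelMoment_le (n : ℕ) {r : ℝ} (hr : 0 < r) :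
    ‖hankelMoment n r‖ ≤ Real.Gamma (n + 1 / 2) * r ^ (-(n + 1 / 2) : ℝ) := by
  have h := Real.integral_rpow_mul_exp_neg_mul_Ioi (a := n + 1 / 2) (r := r) (by positivity) hr
  calc ‖hankelMoment n r‖
      ≤ ∫ s in Set.Ioi (0 : ℝ), s ^ (n - 1 / 2 : ℝ) * Real.exp (-(r * s)) := by
        refine norm_integral_le_of_norm_le
          (integrableOn_rpow_mul_exp (neg_one_lt_natCast_sub n) hr) ?_
        filter_upwards [ae_restrict_mem measurableSet_Ioi] with s hs
        exact norm_hankelMoment_integrand_le n r hs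
    _ = ∫ s in Set.Ioi (0 : ℝ), s ^ ((n + 1 / 2 : ℝ) - 1) * Real.exp (-(r * s)) := by
        congr 1; ext s; congr 2; ring
    _ = _ := by
        rw [h, mul_comm, one_div r, Real.inv_rpow hr.le, ← Real.rpow_neg hr.le]

lemma hasDerivAt_hankelMoment (n : ℕ) {r : ℝ} (hr : 0 < r) :
    HasDerivAt (hankelMoment n) (-hankelMoment (n + 1) r) r := by
  have h := hasDerivAt_integral_of_dominated_loc_of_deriv_le
    -- The exponential decreases in `r`, so its value at `r / 2` dominates on a neighbourhood of
    -- `r`.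
    (μ := volume.restrict (Set.Ioi (0 : ℝ))) (x₀ := r) (s := Set.Ioi (r / 2))
    (F := fun r s => (s : ℂ) ^ n * hankelDensity s * (Real.exp (-(r * s)) : ℂ))
    (F' := fun r s => -((s : ℂ) ^ (n + 1) * hankelDensity s * (Real.exp (-(r * s)) : ℂ)))
    (bound := fun s => s ^ ((n + 1 : ℕ) - 1 / 2 : ℝ) * Real.exp (-(r / 2 * s)))
    (Ioi_mem_nhds (by linarith))
    (Eventually.of_forall fun r => aestronglyMeasurable_hankelMoment n r)
    (integrableOn_hankelMoment n hr)
    (aestronglyMeasurable_hankelMoment (n + 1) r).neg ?_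
    (integrableOn_rpow_mul_exp (neg_one_lt_natCast_sub _) (by positivity)) ?_
  · refine HasDerivAt.congr_deriv (f := hankelMoment n) h.2 ?_
    rw [integral_neg]; rfl
  · filter_upwards [ae_restrict_mem measurableSet_Ioi] with s hs x hx
    have hs : 0 < s := hs
    rw [norm_neg]
    refine (norm_hankelMoment_integrand_le (n + 1) x hs).trans ?_
    have : r / 2 ≤ x := le_of_lt hx
    gcongr
  · refine Eventually.of_forall fun s x _ => ?_
    have h1 : HasDerivAt (fun x : ℝ => Real.exp (-(x * s))) (Real.exp (-(x * s)) * -(1 * s)) x :=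
      ((hasDerivAt_id x).mul_const s).neg.exp
    refine (h1.ofReal_comp.const_mul ((s : ℂ) ^ n * hankelDensity s)).congr_deriv ?_
    push_cast; ring

lemma norm_hankelRoot_le {s : ℝ} (hs : 0 < s) : ‖hankelRoot s‖ ≤ s + 2 := by
  have hs' : (s : ℂ) ≠ 0 := by exact_mod_cast hs.ne'
  have : hankelRoot s = ((s : ℂ) - 2 * Complex.I) * hankelWeight s := by
    rw [hankelRoot, hankelDensity]; field_simp
  rw [this, norm_mul]
  calc _ ≤ (‖(s : ℂ)‖ + ‖2 * Complex.I‖) * 1 := by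
        gcongr
        · exact norm_sub_le _ _
        · exact norm_hankelWeight_le_one s
    _ = s + 2 := by simp [abs_of_pos hs]

lemma continuousWithinAt_hankelRoot_zero : ContinuousWithinAt hankelRoot (Set.Ici 0) 0 := by
  have h0 : hankelRoot 0 = 0 := by simp [hankelRoot]
  rw [ContinuousWithinAt, h0]
  refine squeeze_zero_norm' (a := fun s : ℝ => (s + 2) * s ^ (1 / 2 : ℝ)) ?_ ?_
  · filter_upwards [self_mem_nhdsWithin] with s hs
    rcases eq_or_lt_of_le (show (0 : ℝ) ≤ s from hs) with h | h
    · subst h; simp [hankelRoot]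
    · have hs' : (s : ℂ) ≠ 0 := by exact_mod_cast h.ne'
      have : hankelRoot s = ((s : ℂ) - 2 * Complex.I) * hankelWeight s := by
        rw [hankelRoot, hankelDensity]; field_simp
      rw [this, norm_mul]
      gcongr
      · refine (norm_sub_le _ _).trans ?_
        simp [abs_of_pos h]
      · exact norm_hankelWeight_le h
  · have : ContinuousAt (fun s : ℝ => (s + 2) * s ^ (1 / 2 : ℝ)) 0 :=
      (by fun_prop : ContinuousAt (fun s : ℝ => s + 2) 0).mul
        (Real.continuousAt_rpow_const _ _ (Or.inr (by norm_num)))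
    have h2 := this.tendsto
    simp only [one_div, ne_eq, inv_eq_zero, OfNat.ofNat_ne_zero, not_false_eq_true,
      Real.zero_rpow, mul_zero] at h2
    simpa using h2.mono_left nhdsWithin_le_nhds

/-- The moments satisfy the relation that expresses Bessel's equation. -/
lemma hankelMoment_relation {r : ℝ} (hr : 0 < r) :
    (r : ℂ) * (hankelMoment 2 r - 2 * Complex.I * hankelMoment 1 r)
      + Complex.I * hankelMoment 0 r - hankelMoment 1 r = 0 := by
  have i0 := integrableOn_hankelMoment 0 hr
  have i1 := integrableOn_hankelMoment 1 hr
  have i2 := integrableOn_hankelMoment 2 hr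
  let E : ℝ → ℂ := fun s => (Real.exp (-(r * s)) : ℂ)
  have hint : IntegrableOn (fun s : ℝ => (r : ℂ) * ((s : ℂ) ^ 2 * hankelDensity s * E s
      - 2 * Complex.I * ((s : ℂ) ^ 1 * hankelDensity s * E s))
      + Complex.I * ((s : ℂ) ^ 0 * hankelDensity s * E s) - (s : ℂ) ^ 1 * hankelDensity s * E s)
      (Set.Ioi 0) :=
    (((i2.sub (i1.const_mul _)).const_mul _).add (i0.const_mul _)).sub i1
  -- The combined integrand is the exact derivative of `-(s² - 2is)^{1/2} e^{-rs}`, whose boundary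
  -- values at 0 and at infinity both vanish.
  have key := integral_Ioi_of_hasDerivAt_of_tendsto (a := (0 : ℝ)) (m := 0)
    (f := fun s : ℝ => -(hankelRoot s * E s)) ?_ ?_ hint ?_
  · have h0 : hankelRoot 0 = 0 := by simp [hankelRoot]
    rw [h0] at key
    simp only [zero_mul, neg_zero, sub_zero] at key
    have e1 := integral_sub i2 (i1.const_mul (2 * Complex.I))
    have e2 := integral_add ((i2.sub (i1.const_mul (2 * Complex.I))).const_mul (r : ℂ))
      (i0.const_mul Complex.I)
    have e3 := integral_sub (((i2.sub (i1.const_mul (2 * Complex.I))).const_mul (r : ℂ)).add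
      (i0.const_mul Complex.I)) i1
    simp only [Pi.sub_apply, Pi.add_apply, integral_const_mul] at e1 e2 e3
    rw [e2, e1] at e3
    exact e3.symm.trans key
  · refine (continuousWithinAt_hankelRoot_zero.mul ?_).neg
    exact Continuous.continuousWithinAt (by fun_prop)
  · intro s hs
    have h1 : HasDerivAt (fun s : ℝ => Real.exp (-(r * s))) (Real.exp (-(r * s)) * -(r * 1)) s :=
      ((hasDerivAt_id s).const_mul r).neg.exp
    refine ((hasDerivAt_hankelRoot hs).mul h1.ofReal_comp).neg.congr_deriv ?_
    simp only [E, hankelRoot]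
    push_cast; ring
  · rw [← neg_zero]
    refine Tendsto.neg (squeeze_zero_norm' (a := fun s : ℝ => (s + 2) * Real.exp (-r * s)) ?_ ?_)
    · filter_upwards [eventually_gt_atTop 0] with s hs
      rw [norm_mul]
      have : ‖E s‖ = Real.exp (-r * s) := by
        simp only [E, Complex.norm_real, Real.norm_of_nonneg (Real.exp_pos _).le, neg_mul]
      rw [this]
      gcongr
      exact norm_hankelRoot_le hs
    · have h1 := tendsto_rpow_mul_exp_neg_mul_atTop_nhds_zero 1 r hr
      have h2 := tendsto_rpow_mul_exp_neg_mul_atTop_nhds_zero 0 r hr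
      have := h1.add (h2.const_mul 2)
      simp only [Real.rpow_one, Real.rpow_zero, one_mul, mul_zero, add_zero] at this
      refine this.congr fun s => ?_
      ring

lemma tendsto_hankelWeight_atTop : Tendsto hankelWeight atTop (𝓝 1) := by
  have h1 : Tendsto (fun s : ℝ => 1 - 2 * Complex.I / (s : ℂ)) atTop (𝓝 1) := by
    have : Tendsto (fun s : ℝ => ((s⁻¹ : ℝ) : ℂ)) atTop (𝓝 ((0 : ℝ) : ℂ)) :=
      (Complex.continuous_ofReal.tendsto 0).comp tendsto_inv_atTop_zero
    have := (this.const_mul (2 * Complex.I)).const_sub 1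
    simpa [div_eq_mul_inv] using this
  have h2 : ContinuousAt (fun z : ℂ => z ^ (-(1 / 2) : ℂ)) 1 :=
    continuousAt_cpow_const (by simp)
  have := h2.tendsto.comp h1
  rw [Complex.one_cpow] at this
  exact this

/-- Substituting `u = rs` turns the left side into `∫ hankelWeight (u / r) e^{-u} du`, and the
weight tends to 1 as `r → 0`. This fixes the coefficient of the logarithmic singularity. -/
lemma tendsto_mul_hankelMoment_one :
    Tendsto (fun r : ℝ => (r : ℂ) * hankelMoment 1 r) (𝓝[>] 0) (𝓝 1) := by
  have h1 : ∀ r : ℝ, 0 < r → (r : ℂ) * hankelMoment 1 r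
      = ∫ u in Set.Ioi (0 : ℝ), hankelWeight (r⁻¹ * u) * (Real.exp (-u) : ℂ) := by
    intro r hr
    have h := integral_comp_mul_left_Ioi
      (fun s : ℝ => hankelWeight (r⁻¹ * s) * (Real.exp (-s) : ℂ)) 0 hr
    rw [mul_zero] at h
    have hr' : (r : ℂ) ≠ 0 := by exact_mod_cast hr.ne'
    have h3 : hankelMoment 1 r = ∫ x in Set.Ioi (0 : ℝ),
        hankelWeight (r⁻¹ * (r * x)) * (Real.exp (-(r * x)) : ℂ) := by
      refine setIntegral_congr_fun measurableSet_Ioi fun s hs => ?_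
      have hs' : (s : ℂ) ≠ 0 := by exact_mod_cast (ne_of_gt hs)
      simp only [inv_mul_cancel_left₀ hr.ne', hankelDensity, pow_one]
      field_simp
    rw [h3, h, Complex.real_smul]
    push_cast
    field_simp
  have h2 : Tendsto (fun r : ℝ => ∫ u in Set.Ioi (0 : ℝ),
      hankelWeight (r⁻¹ * u) * (Real.exp (-u) : ℂ)) (𝓝[>] 0)
      (𝓝 (∫ u in Set.Ioi (0 : ℝ), (1 : ℂ) * (Real.exp (-u) : ℂ))) := by
    refine tendsto_integral_filter_of_dominated_convergence (fun u => Real.exp (-u)) ?_ ?_ ?_ ?_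
    · filter_upwards [self_mem_nhdsWithin] with r hr
      refine ContinuousOn.aestronglyMeasurable (ContinuousOn.mul ?_ (by fun_prop))
        measurableSet_Ioi
      intro u hu
      have : 0 < r⁻¹ * u := mul_pos (inv_pos.2 hr) hu
      exact ((hasDerivAt_hankelWeight this).continuousAt.comp
        (f := fun u => r⁻¹ * u) (by fun_prop)).continuousWithinAt
    · refine Eventually.of_forall fun r => Eventually.of_forall fun u => ?_
      rw [norm_mul, Complex.norm_real, Real.norm_of_nonneg (Real.exp_pos _).le]
      exact mul_le_of_le_one_left (Real.exp_pos _).le (norm_hankelWeight_le_one _)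
    · exact integrableOn_exp_neg_Ioi 0
    · filter_upwards [ae_restrict_mem measurableSet_Ioi] with u hu
      refine Tendsto.mul_const _ (tendsto_hankelWeight_atTop.comp ?_)
      exact tendsto_inv_nhdsGT_zero.atTop_mul_const hu
  have h3 : ∫ u in Set.Ioi (0 : ℝ), (1 : ℂ) * (Real.exp (-u) : ℂ) = 1 := by
    simp only [one_mul]
    have := integral_ofReal (𝕜 := ℂ) (μ := volume.restrict (Set.Ioi (0 : ℝ)))
      (f := fun u => Real.exp (-u))
    rw [integral_exp_neg_Ioi] at this
    simpa using this
  rw [h3] at h2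
  refine h2.congr' ?_
  filter_upwards [self_mem_nhdsWithin] with r hr
  rw [h1 r hr]

/-- The outgoing radial solution of `g'' + g'/r + g = 0`, with its logarithmic singularity. -/
theorem exists_outgoing_profile : ∃ (g g1 : ℝ → ℂ) (A : ℝ), 0 < A ∧
    (∀ r, 0 < r → HasDerivAt g (g1 r) r) ∧
    (∀ r, 0 < r → HasDerivAt g1 (-g r - g1 r / r) r) ∧
    (∀ r, 0 < r → ‖g r‖ ≤ A * r ^ (-(1 / 2) : ℝ)) ∧
    (∀ r, 0 < r → ‖g1 r - Complex.I * g r‖ ≤ A * r ^ (-(3 / 2) : ℝ)) ∧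
    Tendsto (fun r : ℝ => (r : ℂ) * g1 r) (𝓝[>] 0) (𝓝 (-1)) := by
  have hE : ∀ r : ℝ, HasDerivAt (fun r : ℝ => Complex.exp (Complex.I * r))
      (Complex.I * Complex.exp (Complex.I * r)) r := by
    intro r
    have := ((hasDerivAt_id r).ofReal_comp.const_mul Complex.I).cexp
    refine this.congr_deriv ?_
    simp [mul_comm]
  have hEn : ∀ r : ℝ, ‖Complex.exp (Complex.I * r)‖ = 1 := by
    intro r; rw [mul_comm, Complex.norm_exp_ofReal_mul_I]
  have b0 : ∀ r : ℝ, 0 < r → ‖hankelMoment 0 r‖ ≤ Real.Gamma (1 / 2) * r ^ (-(1 / 2) : ℝ) := by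
    intro r hr
    have := norm_hankelMoment_le 0 hr
    norm_num at this ⊢
    exact this
  have b1 : ∀ r : ℝ, 0 < r → ‖hankelMoment 1 r‖ ≤ Real.Gamma (3 / 2) * r ^ (-(3 / 2) : ℝ) := by
    intro r hr
    have := norm_hankelMoment_le 1 hr
    norm_num at this ⊢
    exact this
  have p0 : 0 < Real.Gamma (1 / 2) := Real.Gamma_pos_of_pos (by norm_num)
  have p1 : 0 < Real.Gamma (3 / 2) := Real.Gamma_pos_of_pos (by norm_num)
  -- Differentiation raises the index of a moment by one, so in `g' - ig` only the first moment
  -- survives. It decays like `r^(-3/2)`, one order faster than `g`.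
  refine ⟨fun r => Complex.exp (Complex.I * r) * hankelMoment 0 r,
    fun r => Complex.exp (Complex.I * r) * (Complex.I * hankelMoment 0 r - hankelMoment 1 r),
    Real.Gamma (1 / 2) + Real.Gamma (3 / 2), by positivity, ?_, ?_, ?_, ?_, ?_⟩
  · intro r hr
    refine ((hE r).mul (hasDerivAt_hankelMoment 0 hr)).congr_deriv ?_
    ring
  · intro r hr
    have hr' : (r : ℂ) ≠ 0 := by exact_mod_cast hr.ne'
    refine ((hE r).mul (((hasDerivAt_hankelMoment 0 hr).const_mul Complex.I).sub
      (hasDerivAt_hankelMoment 1 hr))).congr_deriv ?_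
    have h := hankelMoment_relation hr
    simp only [zero_add, Nat.reduceAdd, Pi.sub_apply]
    field_simp
    linear_combination h + r * hankelMoment 0 r * Complex.I_sq
  · intro r hr
    rw [norm_mul, hEn, one_mul]
    refine (b0 r hr).trans ?_
    gcongr; linarith
  · intro r hr
    have : Complex.exp (Complex.I * r) * (Complex.I * hankelMoment 0 r - hankelMoment 1 r)
        - Complex.I * (Complex.exp (Complex.I * r) * hankelMoment 0 r)
        = -(Complex.exp (Complex.I * r) * hankelMoment 1 r) := by ring
    rw [this, norm_neg, norm_mul, hEn, one_mul]
    refine (b1 r hr).trans ?_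
    gcongr; linarith
  · have h1 : Tendsto (fun r : ℝ => (r : ℂ) * hankelMoment 0 r) (𝓝[>] 0) (𝓝 0) := by
      refine squeeze_zero_norm' (a := fun r : ℝ => Real.Gamma (1 / 2) * r ^ (1 / 2 : ℝ)) ?_ ?_
      · filter_upwards [self_mem_nhdsWithin] with r hr
        have hr : 0 < r := hr
        rw [norm_mul, Complex.norm_real, Real.norm_of_nonneg hr.le]
        calc _ ≤ r * (Real.Gamma (1 / 2) * r ^ (-(1 / 2) : ℝ)) := by gcongr; exact b0 r hr
          _ = Real.Gamma (1 / 2) * (r ^ (1 : ℝ) * r ^ (-(1 / 2) : ℝ)) := by rw [Real.rpow_one]; ring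
          _ = _ := by rw [← Real.rpow_add hr]; norm_num
      · have : ContinuousAt (fun s : ℝ => Real.Gamma (1 / 2) * s ^ (1 / 2 : ℝ)) 0 :=
          continuousAt_const.mul (Real.continuousAt_rpow_const _ _ (Or.inr (by norm_num)))
        have h2 := this.tendsto.mono_left (nhdsWithin_le_nhds (s := Set.Ioi 0))
        simpa using h2
    have h2 : Tendsto (fun r : ℝ => Complex.exp (Complex.I * r)) (𝓝[>] 0) (𝓝 1) := by
      have := (hE 0).continuousAt.tendsto.mono_left (nhdsWithin_le_nhds (s := Set.Ioi 0))
      simpa using this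
    have := h2.mul ((h1.const_mul Complex.I).sub tendsto_mul_hankelMoment_one)
    simp only [mul_zero, zero_sub, one_mul] at this
    refine this.congr fun r => ?_
    ring

/-! ### Radial profiles in the squared distance and point sources -/

/-- `γ(|x|²)` is an outgoing radial solution of the Helmholtz equation with wavenumber `κ`, singular
at the origin; `γ₁` is the derivative of `γ`. -/
structure OutgoingProfile (κ A : ℝ) (γ γ₁ : ℝ → ℂ) : Prop where
  hasDerivAt : ∀ q, 0 < q → HasDerivAt γ (γ₁ q) q
  hasDerivAt_deriv : ∀ q, 0 < q →
    HasDerivAt γ₁ (-((κ : ℂ) ^ 2 * γ q + 4 * γ₁ q) / (4 * q)) q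
  norm_le : ∀ ρ, 0 < ρ → ‖γ (ρ ^ 2)‖ ≤ A * (κ * ρ) ^ (-(1 / 2) : ℝ)
  norm_sub_le : ∀ ρ, 0 < ρ →
    ‖2 * ρ * γ₁ (ρ ^ 2) - Complex.I * κ * γ (ρ ^ 2)‖ ≤ κ * A * (κ * ρ) ^ (-(3 / 2) : ℝ)
  tendsto : Tendsto (fun q : ℝ => (q : ℂ) * γ₁ q) (𝓝[>] 0) (𝓝 (-1 / 2))

/-- The solution for `κ = 1` is rescaled, so `A` does not depend on `κ`; the final constants owe
their uniformity to this. The variable `q = |x|²` makes the profile a function of a polynomial in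
the coordinates. -/
theorem exists_outgoingProfile : ∃ A : ℝ, 0 < A ∧ ∀ κ : ℝ, 0 < κ →
    ∃ γ γ₁ : ℝ → ℂ, OutgoingProfile κ A γ γ₁ := by
  obtain ⟨g, g1, A, hA, h1, h2, h3, h4, h5⟩ := exists_outgoing_profile
  refine ⟨A, hA, fun κ hκ => ⟨fun q => g (κ * √q), fun q => g1 (κ * √q) * (κ / (2 * √q)), ?_⟩⟩
  have hr : ∀ q, 0 < q → HasDerivAt (fun q => κ * √q) (κ / (2 * √q)) q := by
    intro q hq
    refine ((Real.hasDerivAt_sqrt hq.ne').const_mul κ).congr_deriv ?_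
    ring
  refine ⟨?_, ?_, ?_, ?_, ?_⟩
  · intro q hq
    have hs : 0 < κ * √q := mul_pos hκ (Real.sqrt_pos.2 hq)
    refine ((h1 _ hs).scomp q (hr q hq)).congr_deriv ?_
    rw [Complex.real_smul]; push_cast; ring
  · intro q hq
    have hsq := Real.sqrt_pos.2 hq
    have hs : 0 < κ * √q := mul_pos hκ hsq
    have hd : HasDerivAt (fun q => κ / (2 * √q)) (-(κ / (4 * q * √q))) q := by
      have := (((Real.hasDerivAt_sqrt hq.ne').const_mul 2).inv (by positivity)).const_mul κ
      refine HasDerivAt.congr_deriv (f := fun q => κ / (2 * √q)) this ?_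
      have : √q ^ 2 = q := Real.sq_sqrt hq.le
      field_simp
      rw [this]; ring
    have hmain := ((h2 _ hs).scomp q (hr q hq)).mul hd.ofReal_comp
    refine HasDerivAt.congr_deriv (f := fun q : ℝ => g1 (κ * √q) * (κ / (2 * √q)))
      (hmain.congr_of_eventuallyEq ?_) ?_
    · refine Eventually.of_forall fun t => ?_
      simp
    · simp only [Function.comp_apply, Complex.real_smul]
      have hq' : (√q : ℂ) ^ 2 = q := by exact_mod_cast Real.sq_sqrt hq.le
      have hκ' : (κ : ℂ) ≠ 0 := by exact_mod_cast hκ.ne'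
      have hs' : (√q : ℂ) ≠ 0 := by exact_mod_cast hsq.ne'
      push_cast
      rw [← hq']
      field_simp
      ring
  · intro ρ hρ
    simp only [Real.sqrt_sq hρ.le]
    exact h3 _ (by positivity)
  · intro ρ hρ
    simp only [Real.sqrt_sq hρ.le]
    have hρ' : (ρ : ℂ) ≠ 0 := by exact_mod_cast hρ.ne'
    have : 2 * (ρ : ℂ) * (g1 (κ * ρ) * (κ / (2 * ρ))) - Complex.I * κ * g (κ * ρ)
        = κ * (g1 (κ * ρ) - Complex.I * g (κ * ρ)) := by field_simp
    rw [this, norm_mul, Complex.norm_real, Real.norm_of_nonneg hκ.le, mul_assoc]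
    gcongr
    exact h4 _ (by positivity)
  · have ht : Tendsto (fun q => κ * √q) (𝓝[>] 0) (𝓝[>] 0) := by
      refine tendsto_nhdsWithin_iff.2 ⟨?_, ?_⟩
      · have : ContinuousAt (fun q => κ * √q) 0 := by fun_prop
        have := this.tendsto.mono_left (nhdsWithin_le_nhds (s := Set.Ioi 0))
        simpa using this
      · filter_upwards [self_mem_nhdsWithin] with q hq
        exact mul_pos hκ (Real.sqrt_pos.2 hq)
    have := (h5.comp ht).mul_const (1 / 2 : ℂ)
    rw [show (-1 : ℂ) * (1 / 2) = -1 / 2 by ring] at this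
    refine this.congr' ?_
    filter_upwards [self_mem_nhdsWithin] with q hq
    have hq' : (√q : ℂ) ^ 2 = q := by exact_mod_cast Real.sq_sqrt (le_of_lt hq)
    have hs' : (√q : ℂ) ≠ 0 := by exact_mod_cast (Real.sqrt_pos.2 hq).ne'
    simp only [Function.comp_apply]
    rw [← hq']
    push_cast
    field_simp

namespace OutgoingProfile

variable {κ A : ℝ} {γ γ₁ : ℝ → ℂ}

/-- Bootstrapping: the differential equation expresses the derivatives of `γ` and `γ₁` through the
same pair, so the pair gains one order of smoothness at a time. -/
lemma contDiffOn (h : OutgoingProfile κ A γ γ₁) : ContDiffOn ℝ ∞ γ (Set.Ioi 0) := by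
  have key : ∀ n : ℕ, ContDiffOn ℝ n γ (Set.Ioi 0) ∧ ContDiffOn ℝ n γ₁ (Set.Ioi 0) := by
    intro n
    induction n with
    | zero =>
      simp only [CharP.cast_eq_zero, contDiffOn_zero]
      exact ⟨fun q hq => (h.hasDerivAt q hq).continuousAt.continuousWithinAt,
        fun q hq => (h.hasDerivAt_deriv q hq).continuousAt.continuousWithinAt⟩
    | succ n ih =>
      constructor
      · push_cast
        rw [contDiffOn_succ_iff_deriv_of_isOpen isOpen_Ioi]
        refine ⟨fun q hq => (h.hasDerivAt q hq).differentiableAt.differentiableWithinAt,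
          by simp, ih.2.congr fun q hq => (h.hasDerivAt q hq).deriv⟩
      · push_cast
        rw [contDiffOn_succ_iff_deriv_of_isOpen isOpen_Ioi]
        refine ⟨fun q hq => (h.hasDerivAt_deriv q hq).differentiableAt.differentiableWithinAt,
          by simp, ContDiffOn.congr ?_ fun q hq => (h.hasDerivAt_deriv q hq).deriv⟩
        have hne : ∀ q ∈ Set.Ioi (0 : ℝ), (4 * (q : ℂ)) ≠ 0 := by
          intro q hq
          have : (q : ℂ) ≠ 0 := by exact_mod_cast (ne_of_gt hq)
          simpa using this
        have hden : ContDiffOn ℝ n (fun q : ℝ => 4 * (q : ℂ)) (Set.Ioi 0) :=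
          contDiffOn_const.mul Complex.ofRealCLM.contDiff.contDiffOn
        exact ((contDiffOn_const.mul ih.1).add (contDiffOn_const.mul ih.2)).neg.mul
          (hden.inv hne)
  exact contDiffOn_infty.2 fun n => (key n).1

end OutgoingProfile

/-- The field of a point source at `p` with radial profile `γ`. -/
def source (γ : ℝ → ℂ) (p x : Plane) : ℂ := γ (‖x - p‖ ^ 2)

section source
variable {κ A : ℝ} {γ γ₁ : ℝ → ℂ}

lemma norm_sub_sq_pos {p x : Plane} (hx : x ≠ p) : 0 < ‖x - p‖ ^ 2 := by
  have : 0 < ‖x - p‖ := norm_pos_iff.2 (sub_ne_zero.2 hx)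
  positivity

lemma contDiffOn_source (h : OutgoingProfile κ A γ γ₁) (p : Plane) :
    ContDiffOn ℝ ∞ (source γ p) {p}ᶜ := by
  refine h.contDiffOn.comp (t := Set.Ioi 0) (f := fun x : Plane => ‖x - p‖ ^ 2) ?_
    fun x hx => norm_sub_sq_pos hx
  exact ((contDiff_id.sub contDiff_const).norm_sq ℝ).contDiffOn

lemma hasFDerivAt_norm_sub_sq (p x : Plane) :
    HasFDerivAt (fun x : Plane => ‖x - p‖ ^ 2) (2 • innerSL ℝ (x - p)) x := by
  simpa using ((hasFDerivAt_id x).sub_const p).norm_sq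

lemma hasFDerivAt_source (h : OutgoingProfile κ A γ γ₁) {p x : Plane} (hx : x ≠ p) :
    HasFDerivAt (source γ p) ((2 • innerSL ℝ (x - p)).smulRight (γ₁ (‖x - p‖ ^ 2))) x := by
  have h1 := (h.hasDerivAt _ (norm_sub_sq_pos hx)).hasFDerivAt.comp x (hasFDerivAt_norm_sub_sq p x)
  refine h1.congr_fderiv ?_
  ext v
  simp
  ring

lemma fderiv_source_apply (h : OutgoingProfile κ A γ γ₁) {p x : Plane} (hx : x ≠ p) (v : Plane) :
    fderiv ℝ (source γ p) x v = 2 * inner ℝ (x - p) v * γ₁ (‖x - p‖ ^ 2) := by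
  rw [(hasFDerivAt_source h hx).fderiv]
  simp [inner_sub_left]

lemma inner_single_one (x : Plane) (i : Fin 2) :
    inner ℝ x (EuclideanSpace.single i (1 : ℝ)) = x i := by
  simp [EuclideanSpace.inner_single_right]

lemma partialD_source (h : OutgoingProfile κ A γ γ₁) {p x : Plane} (hx : x ≠ p) (i : Fin 2) :
    partialD i (source γ p) x = 2 * ((x i - p i : ℝ) : ℂ) * γ₁ (‖x - p‖ ^ 2) := by
  rw [partialD, fderiv_source_apply h hx, inner_single_one]
  simp

lemma partialD_partialD_source (h : OutgoingProfile κ A γ γ₁) {p x : Plane} (hx : x ≠ p)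
    (i : Fin 2) : partialD i (partialD i (source γ p)) x
      = 2 * γ₁ (‖x - p‖ ^ 2) + 4 * ((x i - p i : ℝ) : ℂ) ^ 2 *
        (-((κ : ℂ) ^ 2 * γ (‖x - p‖ ^ 2) + 4 * γ₁ (‖x - p‖ ^ 2)) / (4 * (‖x - p‖ ^ 2 : ℝ))) := by
  have he : partialD i (source γ p) =ᶠ[𝓝 x]
      fun x => 2 * ((x i - p i : ℝ) : ℂ) * γ₁ (‖x - p‖ ^ 2) := by
    filter_upwards [isOpen_compl_singleton.mem_nhds (show x ∈ ({p}ᶜ : Set Plane) from hx)] with y hy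
    exact partialD_source h hy i
  have h1 := (h.hasDerivAt_deriv _ (norm_sub_sq_pos hx)).hasFDerivAt.comp x
    (hasFDerivAt_norm_sub_sq p x)
  have h2 : HasFDerivAt (fun x : Plane => x i - p i)
      (EuclideanSpace.proj i : Plane →L[ℝ] ℝ) x :=
    (EuclideanSpace.proj i : Plane →L[ℝ] ℝ).hasFDerivAt.sub_const _
  have h3 := ((Complex.ofRealCLM.hasFDerivAt.comp x h2).const_mul 2).mul h1
  rw [partialD, he.fderiv_eq, HasFDerivAt.fderiv
    (f := fun x : Plane => 2 * ((x i - p i : ℝ) : ℂ) * γ₁ (‖x - p‖ ^ 2)) h3]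
  simp [inner_single_one]
  ring

lemma norm_sq_eq (x : Plane) : ‖x‖ ^ 2 = x 0 ^ 2 + x 1 ^ 2 := by
  rw [EuclideanSpace.norm_sq_eq]
  simp [Fin.sum_univ_two]

/-- The squared offsets add up to `q = |x - p|²`, so the Laplacian is `4γ₁ + 4qγ₁'`, and the
equation for `γ₁'` leaves `-κ²γ`. -/
lemma helmholtz_source (h : OutgoingProfile κ A γ γ₁) {p x : Plane} (hx : x ≠ p) :
    partialD 0 (partialD 0 (source γ p)) x + partialD 1 (partialD 1 (source γ p)) x
      = -(κ : ℂ) ^ 2 * source γ p x := by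
  rw [partialD_partialD_source h hx, partialD_partialD_source h hx]
  have h0 : ((‖x - p‖ ^ 2 : ℝ) : ℂ) ≠ 0 := by exact_mod_cast (norm_sub_sq_pos hx).ne'
  have h1 : ((‖x - p‖ ^ 2 : ℝ) : ℂ) = ((x 0 - p 0 : ℝ) : ℂ) ^ 2 + ((x 1 - p 1 : ℝ) : ℂ) ^ 2 := by
    rw [norm_sq_eq]; simp
  rw [source]
  field_simp
  rw [h1]
  ring

end source

/-! ### Green's formula in the half-plane -/

lemma isOpen_upperHalf : IsOpen upperHalf :=
  isOpen_lt continuous_const (EuclideanSpace.proj (1 : Fin 2) : Plane →L[ℝ] ℝ).continuous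

lemma measurableSet_upperHalf : MeasurableSet upperHalf := isOpen_upperHalf.measurableSet

lemma contDiff_partialD {f : Plane → ℂ} {m n : WithTop ℕ∞} (hf : ContDiff ℝ n f) (hmn : m + 1 ≤ n)
    (i : Fin 2) : ContDiff ℝ m (partialD i f) :=
  (hf.fderiv_right hmn).clm_apply contDiff_const

lemma contDiffOn_partialD {f : Plane → ℂ} {U : Set Plane} {m n : WithTop ℕ∞}
    (hf : ContDiffOn ℝ n f U) (hU : IsOpen U) (hmn : m + 1 ≤ n) (i : Fin 2) :
    ContDiffOn ℝ m (partialD i f) U :=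
  (hf.fderiv_of_isOpen hU hmn).clm_apply contDiffOn_const

lemma hasCompactSupport_partialD {f : Plane → ℂ} (hf : HasCompactSupport f) (i : Fin 2) :
    HasCompactSupport (partialD i f) :=
  hf.fderiv_apply ℝ _

lemma partialD_mul {f g : Plane → ℂ} {x : Plane} (hf : DifferentiableAt ℝ f x)
    (hg : DifferentiableAt ℝ g x) (i : Fin 2) :
    partialD i (fun x => f x * g x) x = partialD i f x * g x + f x * partialD i g x := by
  simp only [partialD]
  rw [fderiv_fun_mul hf hg]
  simp; ring

lemma partialD_add {f g : Plane → ℂ} {x : Plane} (hf : DifferentiableAt ℝ f x)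
    (hg : DifferentiableAt ℝ g x) (i : Fin 2) :
    partialD i (fun x => f x + g x) x = partialD i f x + partialD i g x := by
  simp only [partialD]
  rw [fderiv_fun_add hf hg]
  simp

lemma partialD_sub {f g : Plane → ℂ} {x : Plane} (hf : DifferentiableAt ℝ f x)
    (hg : DifferentiableAt ℝ g x) (i : Fin 2) :
    partialD i (fun x => f x - g x) x = partialD i f x - partialD i g x := by
  simp only [partialD]
  rw [fderiv_fun_sub hf hg]
  simp

lemma partialD_congr {f g : Plane → ℂ} {x : Plane} (h : f =ᶠ[𝓝 x] g) (i : Fin 2) :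
    partialD i f x = partialD i g x := by
  simp only [partialD, h.fderiv_eq]

lemma partialD_eq_zero_of_eventually {f : Plane → ℂ} {x : Plane} (h : ∀ᶠ y in 𝓝 x, f y = 0)
    (i : Fin 2) : partialD i f x = 0 := by
  have : f =ᶠ[𝓝 x] fun _ => 0 := h
  rw [partialD_congr this]
  simp [partialD]

lemma integral_partialD_eq_zero {F : Plane → ℂ} (hF : ContDiff ℝ 1 F) (hc : HasCompactSupport F)
    (i : Fin 2) : ∫ x, partialD i F x = 0 := by
  have h1 : Integrable (partialD i F) :=
    (contDiff_partialD hF (m := 0) le_rfl i).continuous.integrable_of_hasCompactSupport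
      (hasCompactSupport_partialD hc i)
  have h2 : Integrable F := hF.continuous.integrable_of_hasCompactSupport hc
  have := integral_mul_fderiv_eq_neg_fderiv_mul_of_integrable (μ := (volume : Measure Plane))
    (f := fun _ => (1 : ℂ)) (g := F) (v := EuclideanSpace.single i (1 : ℝ))
    (by simp) (by simp only [one_mul]; exact h1) (by simpa using h2) (fun x _ => by fun_prop)
    (fun x _ => (hF.differentiable one_ne_zero) x)
  simpa [partialD] using this

lemma exists_bound_deriv_smoothTransition :
    ∃ S : ℝ, 0 < S ∧ ∀ t, |deriv Real.smoothTransition t| ≤ S := by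
  have hc : Continuous (deriv Real.smoothTransition) :=
    (Real.smoothTransition.contDiff (n := 1)).continuous_deriv le_rfl
  obtain ⟨S, hS⟩ := (isCompact_Icc (a := (0 : ℝ)) (b := 1)).exists_bound_of_continuousOn
    hc.continuousOn
  refine ⟨max S 1, by positivity, fun t => ?_⟩
  by_cases ht : t ∈ Set.Icc (0 : ℝ) 1
  · exact (hS t ht).trans (le_max_left _ _)
  · have : deriv Real.smoothTransition t = 0 := by
      rw [Set.mem_Icc, not_and_or, not_le, not_le] at ht
      rcases ht with ht | ht
      · have : Real.smoothTransition =ᶠ[𝓝 t] fun _ => 0 := by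
          filter_upwards [gt_mem_nhds ht] with s hs
          exact Real.smoothTransition.zero_of_nonpos hs.le
        rw [this.deriv_eq]; simp
      · have : Real.smoothTransition =ᶠ[𝓝 t] fun _ => 1 := by
          filter_upwards [lt_mem_nhds ht] with s hs
          exact Real.smoothTransition.one_of_one_le hs.le
        rw [this.deriv_eq]; simp
    rw [this]; simp

lemma deriv_smoothTransition_of_one_lt {t : ℝ} (ht : 1 < t) :
    deriv Real.smoothTransition t = 0 := by
  have : Real.smoothTransition =ᶠ[𝓝 t] fun _ => 1 := by
    filter_upwards [lt_mem_nhds ht] with s hs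
    exact Real.smoothTransition.one_of_one_le hs.le
  rw [this.deriv_eq]; simp

lemma deriv_smoothTransition_of_neg {t : ℝ} (ht : t < 0) :
    deriv Real.smoothTransition t = 0 := by
  have : Real.smoothTransition =ᶠ[𝓝 t] fun _ => 0 := by
    filter_upwards [gt_mem_nhds ht] with s hs
    exact Real.smoothTransition.zero_of_nonpos hs.le
  rw [this.deriv_eq]; simp

/-- Products with a compactly supported continuous function are integrable on the half-plane. -/
lemma integrableOn_upperHalf_mul {f b : Plane → ℂ}
    (hf : ∀ R : ℝ, IntegrableOn f (upperHalf ∩ Metric.ball 0 R)) (hb : Continuous b)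
    (hc : HasCompactSupport b) : IntegrableOn (fun x => f x * b x) upperHalf := by
  obtain ⟨R, hR⟩ := hc.isCompact.isBounded.subset_ball (0 : Plane)
  obtain ⟨C, hC⟩ := hb.bounded_above_of_compact_support hc
  have h1 : IntegrableOn (fun x => f x * b x) (upperHalf ∩ Metric.ball 0 R) :=
    (hf R).mul_bdd (c := C) hb.aestronglyMeasurable (Eventually.of_forall hC)
  refine h1.of_forall_sdiff_eq_zero measurableSet_upperHalf fun x hx => ?_
  have : x ∉ tsupport b := fun h => hx.2 ⟨hx.1, hR h⟩
  rw [image_eq_zero_of_notMem_tsupport this, mul_zero]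

/-- The smooth cutoff that vanishes for `x₂ ≤ 1/n` and equals one for `x₂ ≥ 2/n`. -/
def stripCutoff (n : ℕ) (x : Plane) : ℂ := (Real.smoothTransition (n * x 1 - 1) : ℂ)

lemma contDiff_stripCutoff (n : ℕ) : ContDiff ℝ 1 (stripCutoff n) := by
  refine Complex.ofRealCLM.contDiff.comp
    ((Real.smoothTransition.contDiff (n := 1)).comp
      (f := fun x : Plane => n * x 1 - 1) ?_)
  exact (contDiff_const.mul (EuclideanSpace.proj (1 : Fin 2) : Plane →L[ℝ] ℝ).contDiff).sub
    contDiff_const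

lemma hasFDerivAt_stripCutoff (n : ℕ) (x : Plane) :
    HasFDerivAt (stripCutoff n)
      (Complex.ofRealCLM.comp ((deriv Real.smoothTransition (n * x 1 - 1)) •
        ((n : ℝ) • (EuclideanSpace.proj (1 : Fin 2) : Plane →L[ℝ] ℝ)))) x := by
  have h1 : HasFDerivAt (fun x : Plane => n * x 1 - 1)
      ((n : ℝ) • (EuclideanSpace.proj (1 : Fin 2) : Plane →L[ℝ] ℝ)) x :=
    ((EuclideanSpace.proj (1 : Fin 2) : Plane →L[ℝ] ℝ).hasFDerivAt.const_mul (n : ℝ)).sub_const 1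
  have h2 : HasDerivAt Real.smoothTransition (deriv Real.smoothTransition (n * x 1 - 1))
      (n * x 1 - 1) :=
    ((Real.smoothTransition.contDiff (n := 1)).differentiable (by simp) _).hasDerivAt
  have h3 := HasDerivAt.comp_hasFDerivAt (f := fun x : Plane => n * x 1 - 1) x h2 h1
  exact Complex.ofRealCLM.hasFDerivAt.comp x h3

lemma partialD_zero_stripCutoff (n : ℕ) (x : Plane) : partialD 0 (stripCutoff n) x = 0 := by
  rw [partialD, (hasFDerivAt_stripCutoff n x).fderiv]
  simp

lemma partialD_one_stripCutoff (n : ℕ) (x : Plane) :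
    partialD 1 (stripCutoff n) x = (deriv Real.smoothTransition (n * x 1 - 1) * n : ℝ) := by
  rw [partialD, (hasFDerivAt_stripCutoff n x).fderiv]
  simp

lemma eventually_stripCutoff_eq_zero (n : ℕ) {x : Plane} (hx : x ∉ upperHalf) :
    ∀ᶠ y in 𝓝 x, stripCutoff n y = 0 := by
  have hc : Continuous fun y : Plane => n * y 1 - 1 :=
    (continuous_const.mul (EuclideanSpace.proj (1 : Fin 2) : Plane →L[ℝ] ℝ).continuous).sub
      continuous_const
  have hx' : x 1 ≤ 0 := not_lt.1 hx
  have : n * x 1 - 1 < 0 := by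
    have := mul_nonpos_of_nonneg_of_nonpos (n.cast_nonneg (α := ℝ)) hx'
    linarith
  filter_upwards [hc.continuousAt.eventually (gt_mem_nhds this)] with y hy
  rw [stripCutoff, Real.smoothTransition.zero_of_nonpos hy.le, Complex.ofReal_zero]

lemma contDiff_stripCutoff_mul {f : Plane → ℂ} (n : ℕ) (hf : ContDiffOn ℝ 1 f upperHalf) :
    ContDiff ℝ 1 (fun x => stripCutoff n x * f x) := by
  rw [contDiff_iff_contDiffAt]
  intro x
  by_cases hx : x ∈ upperHalf
  · exact (contDiff_stripCutoff n).contDiffAt.mul (hf.contDiffAt (isOpen_upperHalf.mem_nhds hx))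
  · refine (contDiffAt_const (c := (0 : ℂ))).congr_of_eventuallyEq ?_
    filter_upwards [eventually_stripCutoff_eq_zero n hx] with y hy
    rw [hy, zero_mul]

/-- **Green's formula** for a vector field without normal component on the boundary of the
half-plane and a function that is only `W¹¹` up to the boundary. -/
theorem green_upperHalf {f B₀ B₁ : Plane → ℂ} (hf : ContDiffOn ℝ 1 f upperHalf)
    (hfi : ∀ R : ℝ, IntegrableOn f (upperHalf ∩ Metric.ball 0 R))
    (hdf : ∀ i, ∀ R : ℝ, IntegrableOn (partialD i f) (upperHalf ∩ Metric.ball 0 R))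
    (hB₀ : ContDiff ℝ 1 B₀) (hB₁ : ContDiff ℝ 1 B₁)
    (hc₀ : HasCompactSupport B₀) (hc₁ : HasCompactSupport B₁)
    (hN : ∀ x : Plane, x 1 = 0 → B₁ x = 0) :
    ∫ x in upperHalf, (partialD 0 f x * B₀ x + partialD 1 f x * B₁ x
      + f x * (partialD 0 B₀ x + partialD 1 B₁ x)) = 0 := by
  set D : Plane → ℂ := fun x => partialD 0 f x * B₀ x + partialD 1 f x * B₁ x
      + f x * (partialD 0 B₀ x + partialD 1 B₁ x) with hD
  have cB : Continuous fun x => partialD 0 B₀ x + partialD 1 B₁ x :=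
    (contDiff_partialD hB₀ (m := 0) le_rfl 0).continuous.add
      (contDiff_partialD hB₁ (m := 0) le_rfl 1).continuous
  have sB : HasCompactSupport fun x => partialD 0 B₀ x + partialD 1 B₁ x :=
    (hasCompactSupport_partialD hc₀ 0).add (hasCompactSupport_partialD hc₁ 1)
  have iD : IntegrableOn D upperHalf :=
    ((integrableOn_upperHalf_mul (hdf 0) hB₀.continuous hc₀).add
      (integrableOn_upperHalf_mul (hdf 1) hB₁.continuous hc₁)).add
      (integrableOn_upperHalf_mul hfi cB sB)
  have cD : ContinuousOn D upperHalf :=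
    (((contDiffOn_partialD hf isOpen_upperHalf (m := 0) le_rfl 0).continuousOn.mul
      hB₀.continuous.continuousOn).add
      ((contDiffOn_partialD hf isOpen_upperHalf (m := 0) le_rfl 1).continuousOn.mul
      hB₁.continuous.continuousOn)).add (hf.continuousOn.mul cB.continuousOn)
  obtain ⟨S, hS0, hS⟩ := exists_bound_deriv_smoothTransition
  -- Since `B₁` is Lipschitz and vanishes on the boundary, it is at most `K * x 1`. In the strip
  -- where the cutoff varies `x 1 ≤ 2/n`, which compensates the factor `n` from its derivative; no
  -- trace of `f` is needed.
  obtain ⟨K, hK⟩ := hB₁.lipschitzWith_of_hasCompactSupport hc₁ one_ne_zero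
  have hB1K : ∀ x ∈ upperHalf, ‖B₁ x‖ ≤ K * x 1 := by
    intro x hx
    have h1 := hK.dist_le_mul x !₂[x 0, 0]
    rw [hN !₂[x 0, 0] (by simp), dist_zero_right] at h1
    refine h1.trans (le_of_eq ?_)
    congr 1
    have : x - !₂[x 0, 0] = EuclideanSpace.single 1 (x 1) := by
      ext i; fin_cases i <;> simp
    rw [dist_eq_norm, this]
    have hx1 : 0 < x 1 := hx
    simpa using (abs_of_pos hx1)
  -- The divergence of `stripCutoff n * f * B`, split into the part that converges to `D` and the
  -- commutator with the cutoff. The product is `C¹` with compact support, so its divergence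
  -- integrates to zero.
  let H : ℕ → Plane → ℂ := fun n x => stripCutoff n x * D x
    + (deriv Real.smoothTransition (n * x 1 - 1) * n : ℝ) * (f x * B₁ x)
  have hH0 : ∀ n, ∫ x in upperHalf, H n x = 0 := by
    intro n
    have hF : ∀ {B : Plane → ℂ}, ContDiff ℝ 1 B → HasCompactSupport B → ∀ i,
        Integrable (partialD i (fun x => (stripCutoff n x * f x) * B x)) ∧
        ∫ x, partialD i (fun x => (stripCutoff n x * f x) * B x) x = 0 := by
      intro B hB hc i
      have h1 : ContDiff ℝ 1 (fun x => (stripCutoff n x * f x) * B x) :=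
        (contDiff_stripCutoff_mul n hf).mul hB
      have h2 : HasCompactSupport (fun x => (stripCutoff n x * f x) * B x) := hc.mul_left
      exact ⟨(contDiff_partialD h1 (m := 0) le_rfl i).continuous.integrable_of_hasCompactSupport
        (hasCompactSupport_partialD h2 i), integral_partialD_eq_zero h1 h2 i⟩
    have key : ∫ x, (partialD 0 (fun x => (stripCutoff n x * f x) * B₀ x) x
        + partialD 1 (fun x => (stripCutoff n x * f x) * B₁ x) x) = 0 := by
      rw [integral_add (hF hB₀ hc₀ 0).1 (hF hB₁ hc₁ 1).1, (hF hB₀ hc₀ 0).2, (hF hB₁ hc₁ 1).2,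
        add_zero]
    rw [← setIntegral_eq_integral_of_forall_compl_eq_zero (s := upperHalf)] at key
    · rw [← key]
      refine setIntegral_congr_fun measurableSet_upperHalf fun x hx => ?_
      have dz : DifferentiableAt ℝ (stripCutoff n) x :=
        (hasFDerivAt_stripCutoff n x).differentiableAt
      have df : DifferentiableAt ℝ f x :=
        (hf.contDiffAt (isOpen_upperHalf.mem_nhds hx)).differentiableAt one_ne_zero
      have d0 : DifferentiableAt ℝ B₀ x := hB₀.differentiable one_ne_zero x
      have d1 : DifferentiableAt ℝ B₁ x := hB₁.differentiable one_ne_zero x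
      simp only [H, hD]
      rw [partialD_mul (dz.fun_mul df) d0, partialD_mul (dz.fun_mul df) d1, partialD_mul dz df,
        partialD_mul dz df, partialD_zero_stripCutoff, partialD_one_stripCutoff]
      ring
    · intro x hx
      have h0 : ∀ B : Plane → ℂ, ∀ᶠ y in 𝓝 x, (stripCutoff n y * f y) * B y = 0 := by
        intro B
        filter_upwards [eventually_stripCutoff_eq_zero n hx] with y hy
        rw [hy, zero_mul, zero_mul]
      rw [partialD_eq_zero_of_eventually (h0 B₀), partialD_eq_zero_of_eventually (h0 B₁), add_zero]
  have hlim : Tendsto (fun n => ∫ x in upperHalf, H n x) atTop (𝓝 (∫ x in upperHalf, D x)) := by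
    obtain ⟨R, hR⟩ := hc₁.isCompact.isBounded.subset_ball (0 : Plane)
    refine tendsto_integral_of_dominated_convergence
      (fun x => ‖D x‖ + (Metric.ball (0 : Plane) R).indicator (fun x => 2 * S * K * ‖f x‖) x)
      ?_ ?_ ?_ ?_
    · intro n
      refine ContinuousOn.aestronglyMeasurable ?_ measurableSet_upperHalf
      refine ((contDiff_stripCutoff n).continuous.continuousOn.mul cD).add ?_
      refine ContinuousOn.mul ?_ (hf.continuousOn.mul hB₁.continuous.continuousOn)
      refine Continuous.continuousOn ?_
      have hc : Continuous (deriv Real.smoothTransition) :=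
        (Real.smoothTransition.contDiff (n := 1)).continuous_deriv le_rfl
      fun_prop
    · refine iD.norm.add ?_
      rw [← IntegrableOn]
      refine (integrableOn_indicator_iff Metric.isOpen_ball.measurableSet).2 ?_
      rw [Set.inter_comm]
      exact (hfi R).norm.const_mul _
    · intro n
      filter_upwards [ae_restrict_mem measurableSet_upperHalf] with x hx
      refine (norm_add_le _ _).trans (add_le_add ?_ ?_)
      · rw [norm_mul, stripCutoff, Complex.norm_real,
          Real.norm_of_nonneg (Real.smoothTransition.nonneg _)]
        exact mul_le_of_le_one_left (norm_nonneg _) (Real.smoothTransition.le_one _)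
      · by_cases hxR : x ∈ Metric.ball (0 : Plane) R
        · rw [Set.indicator_of_mem hxR, norm_mul, norm_mul, Complex.norm_real, Real.norm_eq_abs,
            abs_mul, Nat.abs_cast]
          have hx1 : 0 < x 1 := hx
          by_cases h1 : 1 < n * x 1 - 1
          · rw [deriv_smoothTransition_of_one_lt h1]
            simp only [abs_zero, zero_mul]
            positivity
          · calc _ ≤ S * n * (‖f x‖ * (K * x 1)) := by
                  gcongr
                  · exact hS _
                  · exact hB1K x hx
              _ = S * K * ‖f x‖ * (n * x 1) := by ring
              _ ≤ S * K * ‖f x‖ * 2 := by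
                  gcongr
                  linarith
              _ = _ := by ring
        · have : x ∉ tsupport B₁ := fun h => hxR (hR h)
          rw [Set.indicator_of_notMem hxR, image_eq_zero_of_notMem_tsupport this]
          simp
    · filter_upwards [ae_restrict_mem measurableSet_upperHalf] with x hx
      have hx1 : 0 < x 1 := hx
      refine tendsto_const_nhds.congr' ?_
      have : Tendsto (fun n : ℕ => (n : ℝ) * x 1) atTop atTop :=
        tendsto_natCast_atTop_atTop.atTop_mul_const hx1
      filter_upwards [this.eventually_gt_atTop 2] with n hn
      simp only [H]
      rw [deriv_smoothTransition_of_one_lt (by linarith), stripCutoff,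
        Real.smoothTransition.one_of_one_le (by linarith)]
      simp
  simp only [hH0] at hlim
  exact (tendsto_nhds_unique hlim tendsto_const_nhds)

/-! ### The scattered field -/

/-- The plane wave `exp(iκ(a x₁ + b x₂))`. -/
def planeWave (κ a b : ℝ) (x : Plane) : ℂ :=
  Complex.exp (Complex.I * κ * ((x 0 * a + x 1 * b : ℝ) : ℂ))

lemma uInc_eq_planeWave (κ θ : ℝ) : uInc κ θ = planeWave κ (Real.sin θ) (-Real.cos θ) := by
  ext x; simp only [uInc, planeWave]; congr 3; ring

lemma uRef_eq_planeWave (κ θ : ℝ) : uRef κ θ = planeWave κ (Real.sin θ) (Real.cos θ) := rfl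

lemma contDiff_planeWave (κ a b : ℝ) {n : WithTop ℕ∞} : ContDiff ℝ n (planeWave κ a b) := by
  have h : ContDiff ℝ n fun x : Plane => x 0 * a + x 1 * b :=
    ((EuclideanSpace.proj (0 : Fin 2) : Plane →L[ℝ] ℝ).contDiff.mul contDiff_const).add
      ((EuclideanSpace.proj (1 : Fin 2) : Plane →L[ℝ] ℝ).contDiff.mul contDiff_const)
  exact (contDiff_const.mul (Complex.ofRealCLM.contDiff.comp h)).cexp

lemma hasFDerivAt_planeWave (κ a b : ℝ) (x : Plane) :
    HasFDerivAt (planeWave κ a b)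
      (planeWave κ a b x • (Complex.I * κ) • Complex.ofRealCLM.comp
        (a • (EuclideanSpace.proj (0 : Fin 2) : Plane →L[ℝ] ℝ)
          + b • (EuclideanSpace.proj (1 : Fin 2) : Plane →L[ℝ] ℝ))) x := by
  have h : HasFDerivAt (fun x : Plane => x 0 * a + x 1 * b)
      (a • (EuclideanSpace.proj (0 : Fin 2) : Plane →L[ℝ] ℝ)
        + b • (EuclideanSpace.proj (1 : Fin 2) : Plane →L[ℝ] ℝ)) x :=
    ((EuclideanSpace.proj (0 : Fin 2) : Plane →L[ℝ] ℝ).hasFDerivAt.mul_const a).add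
      ((EuclideanSpace.proj (1 : Fin 2) : Plane →L[ℝ] ℝ).hasFDerivAt.mul_const b)
  exact ((Complex.ofRealCLM.hasFDerivAt.comp x h).const_mul (Complex.I * κ)).cexp

lemma partialD_zero_planeWave (κ a b : ℝ) (x : Plane) :
    partialD 0 (planeWave κ a b) x = Complex.I * κ * a * planeWave κ a b x := by
  rw [partialD, (hasFDerivAt_planeWave κ a b x).fderiv]
  simp; ring

lemma partialD_one_planeWave (κ a b : ℝ) (x : Plane) :
    partialD 1 (planeWave κ a b) x = Complex.I * κ * b * planeWave κ a b x := by
  rw [partialD, (hasFDerivAt_planeWave κ a b x).fderiv]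
  simp; ring

lemma partialD_const_mul {f : Plane → ℂ} {x : Plane} (hf : DifferentiableAt ℝ f x) (c : ℂ)
    (i : Fin 2) : partialD i (fun x => c * f x) x = c * partialD i f x := by
  rw [partialD_mul (by fun_prop) hf]
  simp [partialD]

/-- The field `u^inc + u^ref` that is present without the cavity. -/
def background (κ θ : ℝ) (x : Plane) : ℂ := uInc κ θ x + uRef κ θ x

lemma contDiff_background (κ θ : ℝ) {n : WithTop ℕ∞} : ContDiff ℝ n (background κ θ) := by
  have h := (contDiff_planeWave κ (Real.sin θ) (-Real.cos θ) (n := n)).add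
    (contDiff_planeWave κ (Real.sin θ) (Real.cos θ))
  rwa [← uInc_eq_planeWave, ← uRef_eq_planeWave] at h

lemma partialD_zero_background (κ θ : ℝ) : partialD 0 (background κ θ)
    = fun x => Complex.I * κ * Real.sin θ * background κ θ x := by
  ext x
  unfold background
  rw [uInc_eq_planeWave, uRef_eq_planeWave, partialD_add
    ((contDiff_planeWave _ _ _ (n := 1)).differentiable one_ne_zero x)
    ((contDiff_planeWave _ _ _ (n := 1)).differentiable one_ne_zero x),
    partialD_zero_planeWave, partialD_zero_planeWave]
  ring

lemma partialD_one_background (κ θ : ℝ) : partialD 1 (background κ θ)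
    = fun x => Complex.I * κ * Real.cos θ * (uRef κ θ x - uInc κ θ x) := by
  ext x
  unfold background
  rw [uInc_eq_planeWave, uRef_eq_planeWave, partialD_add
    ((contDiff_planeWave _ _ _ (n := 1)).differentiable one_ne_zero x)
    ((contDiff_planeWave _ _ _ (n := 1)).differentiable one_ne_zero x),
    partialD_one_planeWave, partialD_one_planeWave]
  push_cast; ring

lemma helmholtz_background (κ θ : ℝ) (x : Plane) :
    partialD 0 (partialD 0 (background κ θ)) x + partialD 1 (partialD 1 (background κ θ)) x
      = -(κ : ℂ) ^ 2 * background κ θ x := by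
  have hd : ∀ a b, DifferentiableAt ℝ (planeWave κ a b) x := fun a b =>
    (contDiff_planeWave _ _ _ (n := 1)).differentiable one_ne_zero x
  have hsc : (Real.sin θ : ℂ) ^ 2 + (Real.cos θ : ℂ) ^ 2 = 1 := by
    exact_mod_cast Real.sin_sq_add_cos_sq θ
  rw [partialD_zero_background, partialD_one_background,
    partialD_const_mul ((contDiff_background κ θ (n := 1)).differentiable one_ne_zero x),
    partialD_zero_background, uInc_eq_planeWave, uRef_eq_planeWave,
    partialD_const_mul ((hd _ _).fun_sub (hd _ _)), partialD_sub (hd _ _) (hd _ _),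
    partialD_one_planeWave, partialD_one_planeWave]
  have hb : background κ θ x = planeWave κ (Real.sin θ) (-Real.cos θ) x
      + planeWave κ (Real.sin θ) (Real.cos θ) x := by
    rw [background, uInc_eq_planeWave, uRef_eq_planeWave]
  beta_reduce
  rw [hb, Complex.ofReal_neg]
  linear_combination (-(κ : ℂ) ^ 2 * (planeWave κ (Real.sin θ) (-Real.cos θ) x
    + planeWave κ (Real.sin θ) (Real.cos θ) x)) * hsc
    + (κ : ℂ) ^ 2 * ((Real.sin θ : ℂ) ^ 2 + (Real.cos θ : ℂ) ^ 2) *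
      (planeWave κ (Real.sin θ) (-Real.cos θ) x
    + planeWave κ (Real.sin θ) (Real.cos θ) x) * Complex.I_sq

lemma partialD_one_background_of_eq_zero (κ θ : ℝ) {x : Plane} (hx : x 1 = 0) :
    partialD 1 (background κ θ) x = 0 := by
  rw [partialD_one_background]
  simp [uRef, uInc, hx]

lemma Continuous.integrableOn_upperHalf_inter_ball {f : Plane → ℂ} (hf : Continuous f) (R : ℝ) :
    IntegrableOn f (upperHalf ∩ Metric.ball 0 R) :=
  (hf.locallyIntegrable.integrableOn_isCompact (isCompact_closedBall 0 R)).mono_set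
    (Set.inter_subset_right.trans Metric.ball_subset_closedBall)

/-- The background field satisfies the weak homogeneous Neumann condition. -/
lemma background_weak (κ θ : ℝ) {φ : Plane → ℂ} (hφ : ContDiff ℝ ∞ φ) (hc : HasCompactSupport φ) :
    ∫ x in upperHalf, (partialD 0 (background κ θ) x * partialD 0 φ x
      + partialD 1 (background κ θ) x * partialD 1 φ x
        - (κ : ℂ) ^ 2 * background κ θ x * φ x) = 0 := by
  have hu : ∀ i, ContDiff ℝ 1 (partialD i (background κ θ)) := fun i =>
    contDiff_partialD (contDiff_background κ θ (n := 2)) (by norm_num) i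
  have hφ1 : ContDiff ℝ 1 φ := hφ.of_le (by exact_mod_cast le_top)
  have h1 : ∀ i, IntegrableOn (partialD i fun _ => (1 : ℂ)) Set.univ := by
    intro i
    have : (partialD i fun _ => (1 : ℂ)) = fun _ => 0 := by ext x; simp [partialD]
    rw [this]; simp
  -- With `f = 1` Green's formula is the divergence theorem for `φ` times the gradient of the
  -- background.
  have key := green_upperHalf (f := fun _ => 1)
    (B₀ := fun x => φ x * partialD 0 (background κ θ) x)
    (B₁ := fun x => φ x * partialD 1 (background κ θ) x) contDiffOn_const
    (fun R => Continuous.integrableOn_upperHalf_inter_ball continuous_const R)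
    (fun i R => (h1 i).mono_set (Set.subset_univ _)) (hφ1.mul (hu 0)) (hφ1.mul (hu 1))
    hc.mul_right hc.mul_right
    (fun x hx => by rw [partialD_one_background_of_eq_zero κ θ hx, mul_zero])
  rw [← key]
  refine setIntegral_congr_fun measurableSet_upperHalf fun x _ => ?_
  have dφ := hφ1.differentiable one_ne_zero x
  rw [partialD_mul dφ ((hu 0).differentiable one_ne_zero x),
    partialD_mul dφ ((hu 1).differentiable one_ne_zero x)]
  have := helmholtz_background κ θ x
  simp only [partialD, fderiv_fun_const, Pi.zero_apply, zero_apply] at this ⊢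
  linear_combination (-φ x) * this

/-- A radiating field in the half-plane whose normal derivative on the boundary is, in the weak
sense, `c` times the indicator of `(0, ε)`. -/
structure ApertureField (κ ε : ℝ) (c : ℂ) (w : Plane → ℂ) : Prop where
  contDiffOn : ContDiffOn ℝ 1 w upperHalf
  integrableOn : ∀ R : ℝ, IntegrableOn w (upperHalf ∩ Metric.ball 0 R)
  integrableOn_partialD : ∀ i, ∀ R : ℝ, IntegrableOn (partialD i w) (upperHalf ∩ Metric.ball 0 R)
  weak : ∀ φ : Plane → ℂ, ContDiff ℝ ∞ φ → HasCompactSupport φ →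
    ∫ x in upperHalf, (partialD 0 w x * partialD 0 φ x + partialD 1 w x * partialD 1 φ x
        - (κ : ℂ) ^ 2 * w x * φ x) = -∫ t in (0 : ℝ)..ε, c * φ !₂[t, 0]
  radiation : Radiating κ w

/-- By `|f| ≤ 1 + |f|²`. This turns the local `H¹` assumption into the local `W¹¹` regularity that
`green_upperHalf` asks for. -/
lemma IntegrableOn.of_norm_sq {E : Type*} [NormedAddCommGroup E] {f : Plane → E} {s : Set Plane}
    (hs : volume s ≠ ⊤)
    (hm : AEStronglyMeasurable f (volume.restrict s)) (h : IntegrableOn (fun x => ‖f x‖ ^ 2) s) :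
    IntegrableOn f s := by
  have h1 : IntegrableOn (fun _ : Plane => (1 : ℝ)) s := integrableOn_const hs
  refine (h1.add h).mono' hm (Eventually.of_forall fun x => ?_)
  simp only [Pi.add_apply]
  nlinarith [sq_nonneg (‖f x‖ - 1), norm_nonneg (f x)]

lemma volume_upperHalf_inter_ball_ne_top (R : ℝ) :
    volume (upperHalf ∩ Metric.ball (0 : Plane) R) ≠ ⊤ :=
  ((measure_mono Set.inter_subset_right).trans_lt measure_ball_lt_top).ne

/-- Integrability of the weak integrand. -/
lemma integrableOn_weak {w φ : Plane → ℂ} (κ : ℝ)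
    (hw : ∀ R : ℝ, IntegrableOn w (upperHalf ∩ Metric.ball 0 R))
    (hdw : ∀ i, ∀ R : ℝ, IntegrableOn (partialD i w) (upperHalf ∩ Metric.ball 0 R))
    (hφ : ContDiff ℝ ∞ φ) (hc : HasCompactSupport φ) :
    IntegrableOn (fun x => partialD 0 w x * partialD 0 φ x + partialD 1 w x * partialD 1 φ x
        - (κ : ℂ) ^ 2 * w x * φ x) upperHalf := by
  have cφ : ∀ i, Continuous (partialD i φ) := fun i =>
    (contDiff_partialD hφ (m := 0) (by simp) i).continuous
  refine ((integrableOn_upperHalf_mul (hdw 0) (cφ 0) (hasCompactSupport_partialD hc 0)).add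
    (integrableOn_upperHalf_mul (hdw 1) (cφ 1) (hasCompactSupport_partialD hc 1))).sub ?_
  exact integrableOn_upperHalf_mul (fun R => (hw R).const_mul _) hφ.continuous hc

/-- Subtracting the background does not change the weak Neumann data, because its own are zero. The
data are constant along the aperture since `phi0` is, hence the evaluation at 0. -/
theorem IsApproxSolution.apertureField {κ θ ε d : ℝ} {v : Plane → ℂ}
    (h : IsApproxSolution κ θ ε d v) :
    ApertureField κ ε (dtn0 κ ε d v 0) (scattered κ θ v) := by
  have hv1 : ContDiffOn ℝ 1 v upperHalf := h.smooth.of_le (by norm_num)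
  have hu1 : ContDiff ℝ 1 (background κ θ) := contDiff_background κ θ
  have hms : ∀ R : ℝ, MeasurableSet (upperHalf ∩ Metric.ball (0 : Plane) R) := fun R =>
    measurableSet_upperHalf.inter Metric.isOpen_ball.measurableSet
  have iv : ∀ R : ℝ, IntegrableOn v (upperHalf ∩ Metric.ball 0 R) := fun R =>
    IntegrableOn.of_norm_sq (volume_upperHalf_inter_ball_ne_top R)
      ((hv1.continuousOn.mono Set.inter_subset_left).aestronglyMeasurable (hms R))
      (h.sq_integrable R)
  have idv : ∀ i, ∀ R : ℝ, IntegrableOn (partialD i v) (upperHalf ∩ Metric.ball 0 R) := by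
    intro i R
    have hc : ContinuousOn (fderiv ℝ v) upperHalf :=
      (hv1.fderiv_of_isOpen isOpen_upperHalf (m := 0) le_rfl).continuousOn
    have := IntegrableOn.of_norm_sq (volume_upperHalf_inter_ball_ne_top R)
      ((hc.mono Set.inter_subset_left).aestronglyMeasurable (hms R)) (h.energy R)
    exact this.apply_continuousLinearMap _
  have idu : ∀ i, ∀ R : ℝ, IntegrableOn (partialD i (background κ θ))
      (upperHalf ∩ Metric.ball 0 R) := fun i R =>
    Continuous.integrableOn_upperHalf_inter_ball
      (contDiff_partialD hu1 (m := 0) le_rfl i).continuous R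
  have hpd : ∀ i, ∀ x ∈ upperHalf, partialD i (scattered κ θ v) x
      = partialD i v x - partialD i (background κ θ) x := fun i x hx =>
    partialD_sub ((hv1.contDiffAt (isOpen_upperHalf.mem_nhds hx)).differentiableAt one_ne_zero)
      (hu1.differentiable one_ne_zero x) i
  refine ⟨hv1.sub hu1.contDiffOn, fun R => (iv R).sub
    (Continuous.integrableOn_upperHalf_inter_ball hu1.continuous R), fun i R => ?_, ?_,
    h.radiation⟩
  · exact ((idv i R).sub (idu i R)).congr_fun (fun x hx => (hpd i x hx.1).symm) (hms R)
  · intro φ hφ hc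
    have h1 := h.boundary φ hφ hc
    have h2 := background_weak κ θ hφ hc
    have i1 := integrableOn_weak κ iv idv hφ hc
    have i2 := integrableOn_weak κ
      (fun R => Continuous.integrableOn_upperHalf_inter_ball hu1.continuous R) idu hφ hc
    have h3 := integral_sub i1 i2
    rw [h1, h2, sub_zero] at h3
    have h4 : ∀ t, dtn0 κ ε d v t = dtn0 κ ε d v 0 := fun t => rfl
    simp only [h4] at h3
    rw [← h3]
    refine setIntegral_congr_fun measurableSet_upperHalf fun x hx => ?_
    rw [hpd 0 x hx, hpd 1 x hx]
    simp only [scattered, background]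
    ring

/-- Near a point outside `U` the product is identically zero. This is how singular sources, cut off
near their poles, become global test functions. -/
lemma contDiff_mul_of_tsupport_subset {ξ f : Plane → ℂ} {U : Set Plane} {n : WithTop ℕ∞}
    (hU : IsOpen U) (hξ : ContDiff ℝ n ξ) (hf : ContDiffOn ℝ n f U) (hs : tsupport ξ ⊆ U) :
    ContDiff ℝ n fun x => ξ x * f x := by
  rw [contDiff_iff_contDiffAt]
  intro x
  by_cases hx : x ∈ U
  · exact hξ.contDiffAt.mul (hf.contDiffAt (hU.mem_nhds hx))
  · refine (contDiffAt_const (c := (0 : ℂ))).congr_of_eventuallyEq ?_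
    filter_upwards [(notMem_tsupport_iff_eventuallyEq.1 fun h => hx (hs h))] with y hy
    rw [hy, Pi.zero_apply, zero_mul]

/-- Green's second identity against a Helmholtz solution `Ψ` with vanishing normal derivative,
localized by a cutoff function `ξ`. -/
theorem ApertureField.green_cutoff {κ ε : ℝ} {c : ℂ} {w Ψ ξ : Plane → ℂ} {U : Set Plane}
    (hw : ApertureField κ ε c w) (hU : IsOpen U) (hΨ : ContDiffOn ℝ ∞ Ψ U)
    (helm : ∀ x ∈ U, partialD 0 (partialD 0 Ψ) x + partialD 1 (partialD 1 Ψ) x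
      = -(κ : ℂ) ^ 2 * Ψ x)
    (hN : ∀ x ∈ U, x 1 = 0 → partialD 1 Ψ x = 0)
    (hξ : ContDiff ℝ ∞ ξ) (hc : HasCompactSupport ξ) (hs : tsupport ξ ⊆ U) :
    ∫ x in upperHalf, (Ψ x * (partialD 0 w x * partialD 0 ξ x + partialD 1 w x * partialD 1 ξ x)
      - w x * (partialD 0 Ψ x * partialD 0 ξ x + partialD 1 Ψ x * partialD 1 ξ x))
      = -∫ t in (0 : ℝ)..ε, c * (ξ !₂[t, 0] * Ψ !₂[t, 0]) := by
  have hφ : ContDiff ℝ ∞ fun x => ξ x * Ψ x := contDiff_mul_of_tsupport_subset hU hξ hΨ hs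
  have hξ1 : ContDiff ℝ 1 ξ := hξ.of_le (by exact_mod_cast le_top)
  have hΨi : ∀ i, ContDiffOn ℝ 1 (partialD i Ψ) U := fun i =>
    contDiffOn_partialD (contDiffOn_infty.1 hΨ 2) hU (by norm_num) i
  have hB : ∀ i, ContDiff ℝ 1 fun x => ξ x * partialD i Ψ x := fun i =>
    contDiff_mul_of_tsupport_subset hU hξ1 (hΨi i) hs
  -- The weak equation tested with `ξΨ`, minus Green's formula for the vector field `ξ∇Ψ`: the terms
  -- `ξ ∇w·∇Ψ` cancel and the Helmholtz equation of `Ψ` removes the terms in `wξΨ`, so only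
  -- gradients of `ξ` are left.
  have hweak := hw.weak _ hφ hc.mul_right
  have i1 := integrableOn_weak κ hw.integrableOn hw.integrableOn_partialD hφ hc.mul_right
  have hgreen := green_upperHalf hw.contDiffOn hw.integrableOn hw.integrableOn_partialD
    (hB 0) (hB 1) hc.mul_right hc.mul_right (fun x hx => by
      by_cases hxU : x ∈ U
      · rw [hN x hxU hx, mul_zero]
      · rw [image_eq_zero_of_notMem_tsupport fun h => hxU (hs h), zero_mul])
  have cB : Continuous fun x => partialD 0 (fun x => ξ x * partialD 0 Ψ x) x
      + partialD 1 (fun x => ξ x * partialD 1 Ψ x) x :=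
    (contDiff_partialD (hB 0) (m := 0) le_rfl 0).continuous.add
      (contDiff_partialD (hB 1) (m := 0) le_rfl 1).continuous
  have sB : HasCompactSupport fun x => partialD 0 (fun x => ξ x * partialD 0 Ψ x) x
      + partialD 1 (fun x => ξ x * partialD 1 Ψ x) x :=
    (hasCompactSupport_partialD hc.mul_right 0).add (hasCompactSupport_partialD hc.mul_right 1)
  have i2 := ((integrableOn_upperHalf_mul (hw.integrableOn_partialD 0) (hB 0).continuous
    hc.mul_right).add (integrableOn_upperHalf_mul (hw.integrableOn_partialD 1) (hB 1).continuous
    hc.mul_right)).add (integrableOn_upperHalf_mul hw.integrableOn cB sB)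
  have h3 := integral_sub i1 i2
  rw [hweak] at h3
  simp only [Pi.add_apply] at h3
  rw [hgreen, sub_zero] at h3
  rw [← h3]
  refine setIntegral_congr_fun measurableSet_upperHalf fun x hx => ?_
  have dξ := hξ1.differentiable one_ne_zero x
  by_cases hxU : x ∈ U
  · have dΨ : DifferentiableAt ℝ Ψ x :=
      (hΨ.contDiffAt (hU.mem_nhds hxU)).differentiableAt (by simp)
    have dΨi : ∀ i, DifferentiableAt ℝ (partialD i Ψ) x := fun i =>
      ((hΨi i).contDiffAt (hU.mem_nhds hxU)).differentiableAt one_ne_zero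
    rw [partialD_mul dξ dΨ, partialD_mul dξ dΨ, partialD_mul dξ (dΨi 0), partialD_mul dξ (dΨi 1)]
    linear_combination w x * ξ x * helm x hxU
  · have h0 : ∀ᶠ y in 𝓝 x, ξ y = 0 :=
      notMem_tsupport_iff_eventuallyEq.1 fun h => hxU (hs h)
    have h0' : ∀ f : Plane → ℂ, ∀ᶠ y in 𝓝 x, ξ y * f y = 0 := fun f => by
      filter_upwards [h0] with y hy
      rw [hy, zero_mul]
    simp only [partialD_eq_zero_of_eventually h0, partialD_eq_zero_of_eventually (h0' _),
      h0.self_of_nhds]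
    ring

/-! ### Radial cutoff functions -/

/-- A smooth radial cutoff function: one for `|x - p| ≤ r` and zero for `|x - p| ≥ 2r`. -/
def discCutoff (p : Plane) (r : ℝ) (x : Plane) : ℂ :=
  (Real.smoothTransition ((4 - ‖x - p‖ ^ 2 / r ^ 2) / 3) : ℂ)

/-- The weight in `∇ discCutoff = -(slope) (x - p)`. -/
def cutoffSlope (p : Plane) (r : ℝ) (x : Plane) : ℝ :=
  2 / (3 * r ^ 2) * deriv Real.smoothTransition ((4 - ‖x - p‖ ^ 2 / r ^ 2) / 3)

lemma contDiff_discCutoff (p : Plane) (r : ℝ) : ContDiff ℝ ∞ (discCutoff p r) := by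
  have h : ContDiff ℝ ∞ fun x : Plane => (4 - ‖x - p‖ ^ 2 / r ^ 2) / 3 :=
    (contDiff_const.sub (((contDiff_id.sub contDiff_const).norm_sq ℝ).div_const _)).div_const _
  exact Complex.ofRealCLM.contDiff.comp (Real.smoothTransition.contDiff.comp h)

lemma continuous_cutoffSlope (p : Plane) (r : ℝ) : Continuous (cutoffSlope p r) := by
  have hc : Continuous (deriv Real.smoothTransition) :=
    (Real.smoothTransition.contDiff (n := 1)).continuous_deriv le_rfl
  unfold cutoffSlope
  fun_prop

lemma discCutoff_eq_one {p x : Plane} {r : ℝ} (hr : 0 < r) (hx : ‖x - p‖ ≤ r) :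
    discCutoff p r x = 1 := by
  rw [discCutoff, Real.smoothTransition.one_of_one_le, Complex.ofReal_one]
  have : ‖x - p‖ ^ 2 / r ^ 2 ≤ 1 := by
    rw [div_le_one (by positivity)]
    exact pow_le_pow_left₀ (norm_nonneg _) hx 2
  linarith

lemma discCutoff_eq_zero {p x : Plane} {r : ℝ} (hr : 0 < r) (hx : 2 * r ≤ ‖x - p‖) :
    discCutoff p r x = 0 := by
  rw [discCutoff, Real.smoothTransition.zero_of_nonpos, Complex.ofReal_zero]
  have : 4 ≤ ‖x - p‖ ^ 2 / r ^ 2 := by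
    rw [le_div_iff₀ (by positivity)]
    calc 4 * r ^ 2 = (2 * r) ^ 2 := by ring
      _ ≤ _ := pow_le_pow_left₀ (by positivity) hx 2
  linarith

lemma hasCompactSupport_discCutoff (p : Plane) {r : ℝ} (hr : 0 < r) :
    HasCompactSupport (discCutoff p r) :=
  HasCompactSupport.of_support_subset_isCompact (isCompact_closedBall p (2 * r)) fun x hx => by
    by_contra h
    rw [Metric.mem_closedBall, dist_eq_norm, not_le] at h
    exact hx (discCutoff_eq_zero hr h.le)

lemma cutoffSlope_nonneg (p : Plane) (r : ℝ) (x : Plane) : 0 ≤ cutoffSlope p r x :=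
  mul_nonneg (by positivity) Real.smoothTransition.monotone.deriv_nonneg

lemma cutoffSlope_eq_zero_of_lt {p x : Plane} {r : ℝ} (hr : 0 < r) (hx : ‖x - p‖ < r) :
    cutoffSlope p r x = 0 := by
  rw [cutoffSlope, deriv_smoothTransition_of_one_lt, mul_zero]
  have : ‖x - p‖ ^ 2 / r ^ 2 < 1 := by
    rw [div_lt_one (by positivity)]
    exact pow_lt_pow_left₀ hx (norm_nonneg _) two_ne_zero
  linarith

lemma cutoffSlope_eq_zero_of_gt {p x : Plane} {r : ℝ} (hr : 0 < r) (hx : 2 * r < ‖x - p‖) :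
    cutoffSlope p r x = 0 := by
  rw [cutoffSlope, deriv_smoothTransition_of_neg, mul_zero]
  have : 4 < ‖x - p‖ ^ 2 / r ^ 2 := by
    rw [lt_div_iff₀ (by positivity)]
    calc 4 * r ^ 2 = (2 * r) ^ 2 := by ring
      _ < _ := pow_lt_pow_left₀ hx (by positivity) two_ne_zero
  linarith

lemma hasCompactSupport_cutoffSlope (p : Plane) {r : ℝ} (hr : 0 < r) :
    HasCompactSupport (cutoffSlope p r) :=
  HasCompactSupport.of_support_subset_isCompact (isCompact_closedBall p (2 * r)) fun x hx => by
    by_contra h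
    rw [Metric.mem_closedBall, dist_eq_norm, not_le] at h
    exact hx (cutoffSlope_eq_zero_of_gt hr h)

lemma integrable_cutoffSlope (p : Plane) {r : ℝ} (hr : 0 < r) : Integrable (cutoffSlope p r) :=
  (continuous_cutoffSlope p r).integrable_of_hasCompactSupport (hasCompactSupport_cutoffSlope p hr)

lemma partialD_discCutoff (p : Plane) (r : ℝ) (x : Plane) (i : Fin 2) :
    partialD i (discCutoff p r) x = -((cutoffSlope p r x * (x i - p i) : ℝ) : ℂ) := by
  have h1 : HasFDerivAt (fun x : Plane => (4 - ‖x - p‖ ^ 2 / r ^ 2) / 3)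
      ((3⁻¹ : ℝ) • -((r ^ 2)⁻¹ • (2 • innerSL ℝ (x - p) : Plane →L[ℝ] ℝ))) x := by
    simpa only [div_eq_mul_inv] using
      (((hasFDerivAt_norm_sub_sq p x).mul_const ((r ^ 2)⁻¹)).const_sub 4).mul_const (3⁻¹ : ℝ)
  have h2 : HasDerivAt Real.smoothTransition
      (deriv Real.smoothTransition ((4 - ‖x - p‖ ^ 2 / r ^ 2) / 3))
      ((4 - ‖x - p‖ ^ 2 / r ^ 2) / 3) :=
    ((Real.smoothTransition.contDiff (n := 1)).differentiable (by simp) _).hasDerivAt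
  have h3 := HasDerivAt.comp_hasFDerivAt
    (f := fun x : Plane => (4 - ‖x - p‖ ^ 2 / r ^ 2) / 3) x h2 h1
  have h4 := Complex.ofRealCLM.hasFDerivAt.comp x h3
  rw [partialD, HasFDerivAt.fderiv (f := discCutoff p r) h4]
  rw [cutoffSlope]
  simp
  by_cases hr : r = 0
  · simp [hr]
  · have : (r : ℂ) ≠ 0 := by exact_mod_cast hr
    field_simp
    rw [inner_single_one, inner_single_one]

/-- The mass of the cutoff weight. -/
def cutoffMass : ℝ := ∫ z, cutoffSlope 0 1 z

/-- The weight scales like an inverse area, so translations and dilations of the plane preserve its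
integral. It therefore acts as an approximate identity of fixed mass as `r → 0`. -/
lemma integral_cutoffSlope (p : Plane) {r : ℝ} (hr : 0 < r) :
    ∫ x, cutoffSlope p r x = cutoffMass := by
  have h1 : ∫ x, cutoffSlope p r x = ∫ x, cutoffSlope 0 r x := by
    rw [← integral_sub_right_eq_self (fun x => cutoffSlope 0 r x) p]
    simp [cutoffSlope]
  have h2 := Measure.integral_comp_smul_of_nonneg (volume : Measure Plane)
    (fun x => cutoffSlope 0 r x) r (hR := hr.le)
  have h3 : ∀ z : Plane, cutoffSlope 0 r (r • z) = (r ^ 2)⁻¹ * cutoffSlope 0 1 z := by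
    intro z
    simp only [cutoffSlope, sub_zero, norm_smul, Real.norm_of_nonneg hr.le, mul_pow]
    have : r ^ 2 * ‖z‖ ^ 2 / r ^ 2 = ‖z‖ ^ 2 / 1 ^ 2 := by field_simp
    rw [this]
    field_simp
  simp only [h3, integral_const_mul, finrank_euclideanSpace_fin, smul_eq_mul] at h2
  rw [h1, cutoffMass]
  have : (r ^ 2)⁻¹ ≠ 0 := by positivity
  exact (mul_left_cancel₀ this h2).symm

lemma cutoffMass_pos : 0 < cutoffMass := by
  rw [cutoffMass, integral_pos_iff_support_of_nonneg (cutoffSlope_nonneg 0 1)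
    (integrable_cutoffSlope 0 one_pos)]
  have ho : IsOpen (Function.support (cutoffSlope 0 1)) :=
    isOpen_ne_fun (continuous_cutoffSlope 0 1) continuous_const
  refine ho.measure_pos _ ?_
  -- If the weight vanished identically, its values at points with squared norm `4 - 3t` would force
  -- `deriv Real.smoothTransition t = 0` on `[0, 1]`, although that function rises from 0 to 1.
  by_contra hne
  rw [Set.not_nonempty_iff_eq_empty, Function.support_eq_empty_iff] at hne
  have hd : ∀ t ∈ Set.Icc (0 : ℝ) 1, deriv Real.smoothTransition t = 0 := by
    intro t ht
    have h := congrFun hne (EuclideanSpace.single 0 (√(4 - 3 * t)))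
    have h4 : (0 : ℝ) ≤ 4 - 3 * t := by linarith [ht.2]
    simp only [cutoffSlope, sub_zero, PiLp.norm_single, Real.norm_eq_abs, sq_abs,
      Real.sq_sqrt h4, one_pow, div_one, Pi.zero_apply] at h
    have h5 : (4 - (4 - 3 * t)) / 3 = t := by ring
    rw [h5] at h
    simpa using h
  obtain ⟨t, ht, h⟩ := exists_deriv_eq_slope Real.smoothTransition one_pos
    Real.smoothTransition.continuous.continuousOn
    ((Real.smoothTransition.contDiff (n := 1)).differentiable (by simp)).differentiableOn
  rw [hd t ⟨ht.1.le, ht.2.le⟩] at h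
  simp at h

/-! ### Behaviour at infinity -/

lemma fderiv_apply_eq_sum {f : Plane → ℂ} (x v : Plane) :
    fderiv ℝ f x v = partialD 0 f x * v 0 + partialD 1 f x * v 1 := by
  have hv : v = v 0 • EuclideanSpace.single 0 (1 : ℝ) + v 1 • EuclideanSpace.single 1 (1 : ℝ) := by
    ext i; fin_cases i <;> simp
  conv_lhs => rw [hv]
  simp only [map_add, map_smul, Complex.real_smul, partialD]
  ring

lemma fderiv_apply_eq_norm_mul_radialD (f : Plane → ℂ) (x : Plane) :
    fderiv ℝ f x x = ‖x‖ * radialD f x := by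
  by_cases hx : x = 0
  · simp [hx]
  · have : (‖x‖ : ℂ) ≠ 0 := by exact_mod_cast norm_ne_zero_iff.2 hx
    rw [radialD, map_smul, Complex.real_smul]
    push_cast
    field_simp

/-- The half-annulus `R ≤ |x| ≤ 2R`. -/
def halfAnnulus (R : ℝ) : Set Plane := {x | x ∈ upperHalf ∧ R ≤ ‖x‖ ∧ ‖x‖ ≤ 2 * R}

lemma measurableSet_halfAnnulus (R : ℝ) : MeasurableSet (halfAnnulus R) :=
  measurableSet_upperHalf.inter ((measurableSet_le measurable_const measurable_norm).inter
    (measurableSet_le measurable_norm measurable_const))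

lemma halfAnnulus_subset {R : ℝ} (hR : 0 < R) :
    halfAnnulus R ⊆ upperHalf ∩ Metric.ball 0 (3 * R) := fun x hx =>
  ⟨hx.1, by rw [mem_ball_zero_iff]; linarith [hx.2.2]⟩

lemma volume_real_halfAnnulus_le {R : ℝ} (hR : 0 < R) :
    volume.real (halfAnnulus R) ≤ R ^ 2 * (9 * volume.real (Metric.ball (0 : Plane) 1)) := by
  calc volume.real (halfAnnulus R) ≤ volume.real (Metric.ball (0 : Plane) (3 * R)) :=
        measureReal_mono ((halfAnnulus_subset hR).trans Set.inter_subset_right)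
          measure_ball_lt_top.ne
    _ = _ := by
        rw [measureReal_def, Measure.addHaar_ball _ _ (by positivity), ENNReal.toReal_mul,
          ENNReal.toReal_ofReal (by positivity), finrank_euclideanSpace_fin, measureReal_def]
        ring

lemma volume_halfAnnulus_ne_top {R : ℝ} (hR : 0 < R) : volume (halfAnnulus R) ≠ ⊤ :=
  ((measure_mono ((halfAnnulus_subset hR).trans Set.inter_subset_right)).trans_lt
    measure_ball_lt_top).ne

open scoped Pointwise in
lemma smul_halfAnnulus {a t : ℝ} (ht : 0 < t) :
    t • halfAnnulus a = halfAnnulus (t * a) := by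
  ext x
  rw [Set.mem_smul_set_iff_inv_smul_mem₀ ht.ne']
  simp only [halfAnnulus, upperHalf, Set.mem_ofPred_eq, PiLp.smul_apply, smul_eq_mul, norm_smul,
    norm_inv, Real.norm_of_nonneg ht.le]
  refine and_congr ?_ (and_congr ?_ ?_)
  · rw [mul_pos_iff_of_pos_left (inv_pos.2 ht)]
  · rw [le_inv_mul_iff₀ ht]
  · rw [inv_mul_le_iff₀ ht]; ring_nf

lemma smul_mem_upperHalf {x : Plane} (hx : x ∈ upperHalf) {t : ℝ} (ht : 0 < t) :
    t • x ∈ upperHalf := by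
  simpa [upperHalf] using mul_pos ht hx

/-- Growth along rays of a field that satisfies the radiation condition approximately. -/
lemma norm_smul_le_of_radiating {κ η a : ℝ} {w : Plane → ℂ} (hw : ContDiffOn ℝ 1 w upperHalf)
    (ha : 0 < a)
    (hrad : ∀ x ∈ upperHalf, a ≤ ‖x‖ → √‖x‖ * ‖radialD w x - Complex.I * κ * w x‖ ≤ η)
    {x : Plane} (hx : x ∈ upperHalf) (hxa : a ≤ ‖x‖) {t : ℝ} (ht : 1 ≤ t) :
    ‖w (t • x)‖ ≤ ‖w x‖ + 2 * η * √(t * ‖x‖) := by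
  have hx0 : 0 < ‖x‖ := ha.trans_le hxa
  have hη : 0 ≤ η := le_trans (by positivity) (hrad x hx hxa)
  -- The phase turns the derivative along the ray into the radiation defect `∂ᵣw - iκw`. With the
  -- parameter `s²` one has `√|s²x| = s√|x|`, so the derivative of `F` is bounded by the constant
  -- `2η√|x|`.
  let F : ℝ → ℂ := fun s => Complex.exp (-(Complex.I * κ * ‖x‖ * (s : ℂ) ^ 2)) * w (s ^ 2 • x)
  have hE : ∀ s : ℝ, ‖Complex.exp (-(Complex.I * κ * ‖x‖ * (s : ℂ) ^ 2))‖ = 1 := by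
    intro s
    have : -(Complex.I * κ * ‖x‖ * (s : ℂ) ^ 2) = ((-(κ * ‖x‖ * s ^ 2) : ℝ) : ℂ) * Complex.I := by
      push_cast; ring
    rw [this, Complex.norm_exp_ofReal_mul_I]
  have hF : ∀ s : ℝ, 1 ≤ s → HasDerivAt F
      (2 * s * ‖x‖ * (Complex.exp (-(Complex.I * κ * ‖x‖ * (s : ℂ) ^ 2)) *
        (radialD w (s ^ 2 • x) - Complex.I * κ * w (s ^ 2 • x)))) s := by
    intro s hs
    have hs0 : 0 < s := by linarith
    have hsx := smul_mem_upperHalf hx (show 0 < s ^ 2 by positivity)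
    have hwd := ((hw.contDiffAt (isOpen_upperHalf.mem_nhds hsx)).differentiableAt
      one_ne_zero).hasFDerivAt
    have h1 : HasDerivAt (fun s : ℝ => s ^ 2 • x) ((2 * s) • x) s := by
      have := (hasDerivAt_pow 2 s).smul_const x
      simpa using this
    have h2 := hwd.comp_hasDerivAt s h1
    have h3 : HasDerivAt (fun s : ℝ => Complex.exp (-(Complex.I * κ * ‖x‖ * (s : ℂ) ^ 2)))
        (Complex.exp (-(Complex.I * κ * ‖x‖ * (s : ℂ) ^ 2)) *
          (-(Complex.I * κ * ‖x‖ * (2 * s)))) s := by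
      have h4 : HasDerivAt (fun s : ℝ => (s : ℂ) ^ 2) (2 * s) s := by
        have := (hasDerivAt_pow 2 s).ofReal_comp
        simpa using this
      exact ((h4.const_mul _).neg).cexp
    refine (h3.mul h2).congr_deriv ?_
    have h5 : fderiv ℝ w (s ^ 2 • x) x = ‖x‖ * radialD w (s ^ 2 • x) := by
      have hx' : (‖x‖ : ℂ) ≠ 0 := by exact_mod_cast hx0.ne'
      rw [radialD, norm_smul, smul_smul, map_smul, Complex.real_smul,
        Real.norm_of_nonneg (by positivity)]
      have : (‖x‖ * ((s ^ 2 * ‖x‖)⁻¹ * s ^ 2) : ℝ) = 1 := by field_simp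
      have h6 : (‖x‖ : ℂ) * (((s ^ 2 * ‖x‖)⁻¹ * s ^ 2 : ℝ) : ℂ) = 1 := by exact_mod_cast this
      rw [← mul_assoc, h6, one_mul]
    simp only [map_smul, Complex.real_smul, Function.comp_apply]
    rw [h5]
    push_cast
    ring
  have h1t : 1 ≤ √t := Real.one_le_sqrt.2 ht
  have hmv := norm_image_sub_le_of_norm_deriv_le_segment' (f := F) (a := 1) (b := √t)
    (C := 2 * η * √‖x‖)
    (fun s hs => (hF s hs.1).hasDerivWithinAt) (fun s hs => ?_) (√t) ⟨h1t, le_rfl⟩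
  · have e1 : F (√t) = Complex.exp (-(Complex.I * κ * ‖x‖ * ((√t : ℝ) : ℂ) ^ 2)) * w (t • x) := by
      simp only [F]; rw [Real.sq_sqrt (by linarith)]
    have e2 : ‖F 1‖ = ‖w x‖ := by
      simp only [F]
      rw [norm_mul, hE 1, one_mul, one_pow, one_smul]
    calc ‖w (t • x)‖ = ‖F (√t)‖ := by rw [e1, norm_mul, hE, one_mul]
      _ ≤ ‖F 1‖ + ‖F (√t) - F 1‖ := norm_le_insert' _ _
      _ ≤ ‖w x‖ + 2 * η * √‖x‖ * (√t - 1) := by rw [e2]; gcongr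
      _ ≤ ‖w x‖ + 2 * η * √‖x‖ * √t := by gcongr; linarith
      _ = _ := by rw [Real.sqrt_mul (by linarith)]; ring
  · have hs1 : 1 ≤ s := hs.1
    have hs0 : 0 < s := by linarith
    have hn : ‖s ^ 2 • x‖ = s ^ 2 * ‖x‖ := by
      rw [norm_smul, Real.norm_of_nonneg (by positivity)]
    have hr := hrad (s ^ 2 • x) (smul_mem_upperHalf hx (by positivity)) (by
      rw [hn]; exact hxa.trans (le_mul_of_one_le_left hx0.le (one_le_pow₀ hs1)))
    rw [hn, Real.sqrt_mul (by positivity), Real.sqrt_sq hs0.le] at hr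
    simp only [norm_mul, Complex.norm_real, Real.norm_of_nonneg hs0.le, norm_norm, hE, one_mul,
      Complex.norm_ofNat]
    calc 2 * s * ‖x‖ * ‖radialD w (s ^ 2 • x) - Complex.I * κ * w (s ^ 2 • x)‖
        = 2 * √‖x‖ * (s * √‖x‖ * ‖radialD w (s ^ 2 • x) - Complex.I * κ * w (s ^ 2 • x)‖) := by
          nth_rw 1 [← Real.mul_self_sqrt hx0.le]; ring
      _ ≤ 2 * √‖x‖ * η := by gcongr
      _ = _ := by ring

/-- The mean growth on half-annuli of a field that satisfies the radiation condition
approximately. -/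
lemma integral_halfAnnulus_le {κ η a : ℝ} {w : Plane → ℂ} (hw : ContDiffOn ℝ 1 w upperHalf)
    (hwi : ∀ R : ℝ, IntegrableOn w (upperHalf ∩ Metric.ball 0 R))
    (ha : 0 < a)
    (hrad : ∀ x ∈ upperHalf, a ≤ ‖x‖ → √‖x‖ * ‖radialD w x - Complex.I * κ * w x‖ ≤ η)
    (hη : 0 ≤ η) {R : ℝ} (hR : a ≤ R) :
    ∫ x in halfAnnulus R, ‖w x‖ ≤ R ^ 2 / a ^ 2 * (∫ x in halfAnnulus a, ‖w x‖)
      + 36 * volume.real (Metric.ball (0 : Plane) 1) * η * (R ^ 2 * √R) := by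
  have hR0 : 0 < R := ha.trans_le hR
  set t := R / a with ht
  have ht1 : 1 ≤ t := by rw [ht, one_le_div ha]; exact hR
  have ht0 : 0 < t := by linarith
  have hta : t * a = R := by rw [ht]; field_simp
  have hwia : IntegrableOn w (halfAnnulus a) := (hwi _).mono_set (halfAnnulus_subset ha)
  -- Dilation by `t` carries the fixed half-annulus of radius `a` onto that of radius `R`, so the
  -- growth estimate along rays is integrated over the fixed one.
  have hscale := Measure.setIntegral_comp_smul_of_pos (volume : Measure Plane)
    (fun x => ‖w x‖) (halfAnnulus a) ht0
  rw [smul_halfAnnulus ht0, hta, finrank_euclideanSpace_fin, smul_eq_mul] at hscale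
  have hconst : IntegrableOn (fun _ : Plane => 4 * η * √R) (halfAnnulus a) :=
    integrableOn_const (volume_halfAnnulus_ne_top ha)
  have hle : ∫ x in halfAnnulus a, ‖w (t • x)‖ ≤
      ∫ x in halfAnnulus a, (‖w x‖ + 4 * η * √R) := by
    refine integral_mono_of_nonneg (Eventually.of_forall fun x => norm_nonneg _)
      (hwia.norm.add hconst) ?_
    filter_upwards [ae_restrict_mem (measurableSet_halfAnnulus a)] with x hx
    refine (norm_smul_le_of_radiating hw ha hrad hx.1 hx.2.1 ht1).trans ?_
    have : √(t * ‖x‖) ≤ 2 * √R := by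
      rw [show (2 : ℝ) = √4 by rw [show (4 : ℝ) = 2 ^ 2 by norm_num]; simp,
        ← Real.sqrt_mul (by norm_num)]
      apply Real.sqrt_le_sqrt
      calc t * ‖x‖ ≤ t * (2 * a) := by gcongr; exact hx.2.2
        _ = 2 * R := by rw [← hta]; ring
        _ ≤ 4 * R := by linarith
    calc ‖w x‖ + 2 * η * √(t * ‖x‖) ≤ ‖w x‖ + 2 * η * (2 * √R) := by gcongr
      _ = _ := by ring
  rw [integral_add hwia.norm hconst, setIntegral_const, smul_eq_mul] at hle
  have hvol := volume_real_halfAnnulus_le ha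
  have ht2 : t ^ 2 * a ^ 2 = R ^ 2 := by rw [← hta]; ring
  calc ∫ x in halfAnnulus R, ‖w x‖ = t ^ 2 * ∫ x in halfAnnulus a, ‖w (t • x)‖ := by
        rw [hscale]; field_simp
    _ ≤ t ^ 2 * ((∫ x in halfAnnulus a, ‖w x‖)
        + a ^ 2 * (9 * volume.real (Metric.ball (0 : Plane) 1)) * (4 * η * √R)) := by
        gcongr
        refine hle.trans ?_
        gcongr
    _ = t ^ 2 * (∫ x in halfAnnulus a, ‖w x‖)
        + 36 * volume.real (Metric.ball (0 : Plane) 1) * η * ((t ^ 2 * a ^ 2) * √R) := by ring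
    _ = _ := by rw [ht2, ht, div_pow]

/-- The commutator of Green's second identity for radial cutoffs centred at `p`. -/
def wronskian (Ψ w : Plane → ℂ) (p x : Plane) : ℂ :=
  Ψ x * fderiv ℝ w x (x - p) - w x * fderiv ℝ Ψ x (x - p)

/-- Two radiating fields have no flux through infinity. -/
theorem tendsto_integral_wronskian_atTop {κ C R₀ : ℝ} {w Ψ : Plane → ℂ}
    (hw : ContDiffOn ℝ 1 w upperHalf)
    (hwi : ∀ R : ℝ, IntegrableOn w (upperHalf ∩ Metric.ball 0 R))
    (hrad : Radiating κ w) (hC : 0 ≤ C)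
    (hΨ : ∀ x : Plane, R₀ ≤ ‖x‖ → ‖Ψ x‖ ≤ C / √‖x‖)
    (hdΨ : ∀ x : Plane, R₀ ≤ ‖x‖ →
      ‖radialD Ψ x - Complex.I * κ * Ψ x‖ ≤ C / (‖x‖ * √‖x‖)) :
    Tendsto (fun R : ℝ => ∫ x in upperHalf, (cutoffSlope 0 R x : ℂ) * wronskian Ψ w 0 x)
      atTop (𝓝 0) := by
  obtain ⟨S, hS0, hS⟩ := exists_bound_deriv_smoothTransition
  set V := volume.real (Metric.ball (0 : Plane) 1) with hV
  have hV0 : 0 ≤ V := measureReal_nonneg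
  -- For a tolerance `η` in the radiation condition, the contribution of `w` on a fixed half-annulus
  -- decays like `1/√R` and the remainder is proportional to `η`. The factor 45 is 9 from the volume
  -- of the half-annulus plus 36 from `integral_halfAnnulus_le`.
  have hbound : ∀ η : ℝ, 0 < η → ∃ J : ℝ, 0 ≤ J ∧ ∀ᶠ R : ℝ in atTop,
      ‖∫ x in upperHalf, (cutoffSlope 0 R x : ℂ) * wronskian Ψ w 0 x‖
        ≤ S * C * (J / √R) + S * C * 45 * V * η := by
    intro η hη
    have hev : ∀ᶠ x in Bornology.cobounded Plane ⊓ 𝓟 upperHalf,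
        √‖x‖ * ‖radialD w x - Complex.I * κ * w x‖ ≤ η := by
      have := (tendsto_zero_iff_norm_tendsto_zero.1 hrad).eventually (gt_mem_nhds hη)
      filter_upwards [this] with x hx
      rw [norm_mul, Complex.norm_real, Real.norm_of_nonneg (Real.sqrt_nonneg _)] at hx
      exact hx.le
    rw [eventually_inf_principal, ← comap_norm_atTop, eventually_comap] at hev
    obtain ⟨a₀, ha₀⟩ := eventually_atTop.1 hev
    set a := max a₀ 1 with ha
    have ha1 : 0 < a := lt_of_lt_of_le one_pos (le_max_right _ _)
    have hrad' : ∀ x ∈ upperHalf, a ≤ ‖x‖ →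
        √‖x‖ * ‖radialD w x - Complex.I * κ * w x‖ ≤ η := fun x hx hxa =>
      ha₀ ‖x‖ ((le_max_left _ _).trans hxa) x rfl hx
    refine ⟨(∫ x in halfAnnulus a, ‖w x‖) / a ^ 2, by positivity, ?_⟩
    filter_upwards [eventually_ge_atTop a, eventually_ge_atTop R₀] with R hRa hRR
    have hR0 : 0 < R := ha1.trans_le hRa
    have hsR : 0 < √R := Real.sqrt_pos.2 hR0
    have hgrow := integral_halfAnnulus_le hw hwi ha1 hrad' hη.le hRa
    have hwiR : IntegrableOn w (halfAnnulus R) := (hwi _).mono_set (halfAnnulus_subset hR0)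
    have hzero : ∫ x in upperHalf, (cutoffSlope 0 R x : ℂ) * wronskian Ψ w 0 x
        = ∫ x in halfAnnulus R, (cutoffSlope 0 R x : ℂ) * wronskian Ψ w 0 x := by
      refine (setIntegral_eq_of_subset_of_forall_sdiff_eq_zero measurableSet_upperHalf
        (fun x hx => hx.1) fun x hx => ?_)
      have : cutoffSlope 0 R x = 0 := by
        by_cases h1 : ‖x‖ < R
        · exact cutoffSlope_eq_zero_of_lt hR0 (by simpa using h1)
        · by_cases h2 : 2 * R < ‖x‖
          · exact cutoffSlope_eq_zero_of_gt hR0 (by simpa using h2)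
          · exact absurd ⟨hx.1, not_lt.1 h1, not_lt.1 h2⟩ hx.2
      rw [this]; simp
    have hpt : ∀ x ∈ halfAnnulus R, ‖(cutoffSlope 0 R x : ℂ) * wronskian Ψ w 0 x‖
        ≤ S / R ^ 2 * (C * η + C / √R * ‖w x‖) := by
      intro x hx
      have hx0 : 0 < ‖x‖ := hR0.trans_le hx.2.1
      have hsx : 0 < √‖x‖ := Real.sqrt_pos.2 hx0
      have h1 : |cutoffSlope 0 R x| ≤ S / R ^ 2 := by
        rw [cutoffSlope, abs_mul, abs_of_nonneg (by positivity)]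
        calc _ ≤ 2 / (3 * R ^ 2) * S := by gcongr; exact hS _
          _ = (2 / 3) * (S / R ^ 2) := by field_simp
          _ ≤ 1 * (S / R ^ 2) := by gcongr; norm_num
          _ = _ := one_mul _
      -- The terms `iκΨw` cancel, so both radial derivatives may be replaced by radiation defects.
      have h2 : wronskian Ψ w 0 x = ‖x‖ * (Ψ x * (radialD w x - Complex.I * κ * w x)
          - w x * (radialD Ψ x - Complex.I * κ * Ψ x)) := by
        rw [wronskian, sub_zero, fderiv_apply_eq_norm_mul_radialD,
          fderiv_apply_eq_norm_mul_radialD]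
        ring
      have hb1 := hΨ x (hRR.trans hx.2.1)
      have hb2 := hdΨ x (hRR.trans hx.2.1)
      have hb3 : ‖radialD w x - Complex.I * κ * w x‖ ≤ η / √‖x‖ := by
        rw [le_div_iff₀ hsx, mul_comm]
        exact hrad' x hx.1 (hRa.trans hx.2.1)
      have hsq : √‖x‖ * √‖x‖ = ‖x‖ := Real.mul_self_sqrt hx0.le
      rw [norm_mul, Complex.norm_real, Real.norm_eq_abs]
      refine mul_le_mul h1 ?_ (norm_nonneg _) (by positivity)
      rw [h2, norm_mul, Complex.norm_real, norm_norm]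
      calc ‖x‖ * ‖Ψ x * (radialD w x - Complex.I * κ * w x)
            - w x * (radialD Ψ x - Complex.I * κ * Ψ x)‖
          ≤ ‖x‖ * (C / √‖x‖ * (η / √‖x‖) + ‖w x‖ * (C / (‖x‖ * √‖x‖))) := by
            gcongr
            refine (norm_sub_le _ _).trans ?_
            rw [norm_mul, norm_mul]
            gcongr
        _ = C * η * (‖x‖ / (√‖x‖ * √‖x‖)) + C / √‖x‖ * ‖w x‖ := by field_simp
        _ = C * η + C / √‖x‖ * ‖w x‖ := by rw [hsq, div_self hx0.ne', mul_one]
        _ ≤ _ := by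
            gcongr
            exact hx.2.1
    have hconst : IntegrableOn (fun _ : Plane => C * η) (halfAnnulus R) :=
      integrableOn_const (volume_halfAnnulus_ne_top hR0)
    rw [hzero]
    calc _ ≤ ∫ x in halfAnnulus R, S / R ^ 2 * (C * η + C / √R * ‖w x‖) := by
          refine norm_integral_le_of_norm_le
            ((hconst.add (hwiR.norm.const_mul (C / √R))).const_mul _) ?_
          filter_upwards [ae_restrict_mem (measurableSet_halfAnnulus R)] with x hx
          exact hpt x hx
      _ = S / R ^ 2 * (volume.real (halfAnnulus R) * (C * η)
          + C / √R * ∫ x in halfAnnulus R, ‖w x‖) := by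
          rw [integral_const_mul, integral_add hconst (hwiR.norm.const_mul _),
            integral_const_mul (C / √R), setIntegral_const, smul_eq_mul]
      _ ≤ S / R ^ 2 * (R ^ 2 * (9 * V) * (C * η)
          + C / √R * (R ^ 2 / a ^ 2 * (∫ x in halfAnnulus a, ‖w x‖)
            + 36 * V * η * (R ^ 2 * √R))) := by
          gcongr
          exact volume_real_halfAnnulus_le hR0
      _ = _ := by field_simp; ring
  rw [Metric.tendsto_nhds]
  intro e he
  set K := S * C * 45 * V with hK
  have hK0 : 0 ≤ K := by positivity
  obtain ⟨J, hJ0, hJ⟩ := hbound (e / (2 * (K + 1))) (by positivity)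
  have hlim : Tendsto (fun R : ℝ => S * C * (J / √R)) atTop (𝓝 0) := by
    have := (tendsto_const_nhds (x := J)).div_atTop Real.tendsto_sqrt_atTop
    simpa using this.const_mul (S * C)
  filter_upwards [hJ, hlim.eventually (gt_mem_nhds (half_pos he))] with R h1 h2
  rw [dist_zero_right]
  refine h1.trans_lt ?_
  have h3 : K * (e / (2 * (K + 1))) ≤ e / 2 := by
    rw [mul_div_assoc', div_le_div_iff₀ (by positivity) (by norm_num)]
    nlinarith
  linarith

/-! ### Far field of a point source away from the origin -/

section farField
variable {κ A : ℝ} {γ γ₁ : ℝ → ℂ}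

lemma norm_source_le (h : OutgoingProfile κ A γ γ₁) (hκ : 0 < κ) {p x : Plane} (hx : x ≠ p) :
    ‖source γ p x‖ ≤ A / √(κ * ‖x - p‖) := by
  have hρ : 0 < ‖x - p‖ := norm_pos_iff.2 (sub_ne_zero.2 hx)
  refine (h.norm_le _ hρ).trans (le_of_eq ?_)
  rw [Real.rpow_neg (by positivity), ← Real.sqrt_eq_rpow, div_eq_mul_inv]

lemma half_norm_le_norm_sub {p x : Plane} (hx : 2 * ‖p‖ ≤ ‖x‖) : ‖x‖ / 2 ≤ ‖x - p‖ := by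
  have := norm_sub_norm_le x p
  linarith

/-- A point source at `p` is an outgoing field with respect to the origin. -/
lemma exists_farField_source (h : OutgoingProfile κ A γ γ₁) (hκ : 0 < κ) (hA : 0 < A) (p : Plane) :
    ∃ C : ℝ, 0 ≤ C ∧ ∀ x : Plane, 2 * ‖p‖ + 1 ≤ ‖x‖ → ‖source γ p x‖ ≤ C / √‖x‖ ∧
      ‖radialD (source γ p) x - Complex.I * κ * source γ p x‖ ≤ C / (‖x‖ * √‖x‖) := by
  set B := A / √(κ / 2) with hB
  have hB0 : 0 < B := by positivity
  have hκ2 : 0 < √(κ / 2) := by positivity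
  refine ⟨B + (2 * B + 2 * ‖p‖ * κ * B), by positivity, fun x hx => ?_⟩
  have hp0 := norm_nonneg p
  have hx0 : 0 < ‖x‖ := by linarith
  have hsx : 0 < √‖x‖ := Real.sqrt_pos.2 hx0
  have hhalf := half_norm_le_norm_sub (p := p) (x := x) (by linarith)
  have hρ : 0 < ‖x - p‖ := lt_of_lt_of_le (by positivity) hhalf
  have hxp : x ≠ p := fun h => by rw [h, sub_self, norm_zero] at hρ; exact hρ.false
  have hs : √(κ / 2) * √‖x‖ ≤ √(κ * ‖x - p‖) := by
    rw [← Real.sqrt_mul (by positivity)]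
    apply Real.sqrt_le_sqrt
    calc κ / 2 * ‖x‖ = κ * (‖x‖ / 2) := by ring
      _ ≤ _ := by gcongr
  have h1 : ‖source γ p x‖ ≤ B / √‖x‖ := by
    refine (norm_source_le h hκ hxp).trans ?_
    rw [hB, div_div]
    gcongr
  refine ⟨h1.trans (by gcongr; linarith [show 0 ≤ 2 * B + 2 * ‖p‖ * κ * B by positivity]), ?_⟩
  set ρ := ‖x - p‖ with hρd
  -- The cosine of the angle between `x - p` and `x`. The radial derivative about the origin is `q`
  -- times the one about `p`, and `1 - q = O(|p|/|x|)` supplies the extra power of decay.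
  set q : ℝ := inner ℝ (x - p) x / (ρ * ‖x‖) with hq
  have hrad : radialD (source γ p) x - Complex.I * κ * source γ p x
      = q * (2 * ρ * γ₁ (ρ ^ 2) - Complex.I * κ * γ (ρ ^ 2))
        - ((1 - q : ℝ) : ℂ) * (Complex.I * κ * source γ p x) := by
    have hx' : (‖x‖ : ℂ) ≠ 0 := by exact_mod_cast hx0.ne'
    have hρ' : (ρ : ℂ) ≠ 0 := by exact_mod_cast hρ.ne'
    rw [radialD, fderiv_source_apply h hxp, inner_smul_right, source, ← hρd, hq]
    push_cast
    field_simp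
    ring
  have hq1 : |q| ≤ 1 := by
    rw [hq, abs_div, abs_of_pos (by positivity : 0 < ρ * ‖x‖), div_le_one (by positivity)]
    exact abs_real_inner_le_norm _ _
  have hq2 : |1 - q| ≤ 2 * ‖p‖ / ‖x‖ := by
    rw [abs_of_nonneg (by linarith [le_abs_self q]), hq]
    have e1 : inner ℝ (x - p) x = ρ ^ 2 + inner ℝ (x - p) p := by
      rw [hρd, ← real_inner_self_eq_norm_sq, ← inner_add_right, sub_add_cancel]
    have e2 : -(ρ * ‖p‖) ≤ inner ℝ (x - p) p := by
      have := abs_le.1 (abs_real_inner_le_norm (x - p) p)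
      exact this.1
    have e3 : ‖x‖ ≤ ρ + ‖p‖ := by
      calc ‖x‖ = ‖(x - p) + p‖ := by rw [sub_add_cancel]
        _ ≤ _ := norm_add_le _ _
    have e4 : (ρ - ‖p‖) / ‖x‖ ≤ inner ℝ (x - p) x / (ρ * ‖x‖) := by
      rw [div_le_div_iff₀ hx0 (by positivity), e1]
      have : (ρ - ‖p‖) * ρ ≤ ρ ^ 2 + inner ℝ (x - p) p := by nlinarith
      calc (ρ - ‖p‖) * (ρ * ‖x‖) = (ρ - ‖p‖) * ρ * ‖x‖ := by ring
        _ ≤ _ := by gcongr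
    have e5 : 1 - (ρ - ‖p‖) / ‖x‖ ≤ 2 * ‖p‖ / ‖x‖ := by
      rw [one_sub_div hx0.ne']
      gcongr
      linarith
    linarith
  have h2 : ‖2 * (ρ : ℂ) * γ₁ (ρ ^ 2) - Complex.I * κ * γ (ρ ^ 2)‖
      ≤ 2 * B / (‖x‖ * √‖x‖) := by
    refine (h.norm_sub_le ρ hρ).trans ?_
    have : (κ * ρ) ^ (-(3 / 2) : ℝ) = (κ * ρ * √(κ * ρ))⁻¹ := by
      rw [Real.rpow_neg (by positivity), Real.sqrt_eq_rpow]
      congr 1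
      nth_rw 2 [← Real.rpow_one (κ * ρ)]
      rw [← Real.rpow_add (by positivity)]; norm_num
    rw [this, ← div_eq_mul_inv, mul_assoc κ ρ, mul_div_mul_left _ _ hκ.ne']
    calc A / (ρ * √(κ * ρ)) ≤ A / (‖x‖ / 2 * (√(κ / 2) * √‖x‖)) := by gcongr
      _ = _ := by rw [hB]; field_simp
  rw [hrad]
  calc _ ≤ ‖(q : ℂ) * (2 * ρ * γ₁ (ρ ^ 2) - Complex.I * κ * γ (ρ ^ 2))‖
        + ‖((1 - q : ℝ) : ℂ) * (Complex.I * κ * source γ p x)‖ := norm_sub_le _ _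
    _ ≤ 1 * (2 * B / (‖x‖ * √‖x‖)) + 2 * ‖p‖ / ‖x‖ * (κ * (B / √‖x‖)) := by
        simp only [norm_mul, Complex.norm_real, Complex.norm_I, one_mul, Real.norm_eq_abs,
          abs_of_pos hκ]
        gcongr
        exact (mul_le_of_le_one_left (norm_nonneg _) hq1).trans h2
    _ = (2 * B + 2 * ‖p‖ * κ * B) / (‖x‖ * √‖x‖) := by field_simp
    _ ≤ _ := div_le_div_of_nonneg_right (by linarith) (by positivity)

end farField

/-! ### Behaviour at the pole -/

/-- The wronskian of a smooth function with the sum of a point source at `p` and a smooth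
function tends to the value at `p`. -/
lemma tendsto_wronskian_pole {κ A : ℝ} {γ γ₁ : ℝ → ℂ} (h : OutgoingProfile κ A γ γ₁) (hκ : 0 < κ)
    {p : Plane} {w Φ : Plane → ℂ} (hw : ContDiffAt ℝ 1 w p) (hΦ : ContDiffAt ℝ 1 Φ p) :
    Tendsto (wronskian (fun x => Φ x + source γ p x) w p) (𝓝[≠] p) (𝓝 (w p)) := by
  have hsub : Tendsto (fun x : Plane => ‖x - p‖) (𝓝[≠] p) (𝓝[>] 0) := by
    refine tendsto_nhdsWithin_iff.2 ⟨?_, ?_⟩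
    · have : ContinuousAt (fun x : Plane => ‖x - p‖) p := by fun_prop
      have := this.tendsto.mono_left (nhdsWithin_le_nhds (s := {p}ᶜ))
      simpa using this
    · filter_upwards [self_mem_nhdsWithin] with x hx
      exact norm_pos_iff.2 (sub_ne_zero.2 hx)
  have hsub0 : Tendsto (fun x : Plane => ‖x - p‖) (𝓝[≠] p) (𝓝 0) :=
    hsub.mono_right nhdsWithin_le_nhds
  have hvec : Tendsto (fun x : Plane => x - p) (𝓝[≠] p) (𝓝 0) :=
    tendsto_zero_iff_norm_tendsto_zero.2 hsub0
  have cfd : ∀ {f : Plane → ℂ}, ContDiffAt ℝ 1 f p →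
      Tendsto (fun x => fderiv ℝ f x) (𝓝[≠] p) (𝓝 (fderiv ℝ f p)) := fun hf =>
    ((hf.fderiv_right (m := 0) le_rfl).continuousAt.tendsto).mono_left nhdsWithin_le_nhds
  have efd : ∀ {f : Plane → ℂ}, ContDiffAt ℝ 1 f p →
      Tendsto (fun x => fderiv ℝ f x (x - p)) (𝓝[≠] p) (𝓝 0) := fun hf => by
    have := (isBoundedBilinearMap_apply (𝕜 := ℝ) (E := Plane) (F := ℂ)).continuous.tendsto
      (fderiv ℝ _ p, 0) |>.comp ((cfd hf).prodMk_nhds hvec)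
    simpa [Function.comp_def] using this
  have hwp : Tendsto w (𝓝[≠] p) (𝓝 (w p)) :=
    hw.continuousAt.tendsto.mono_left nhdsWithin_le_nhds
  have hΦp : Tendsto Φ (𝓝[≠] p) (𝓝 (Φ p)) :=
    hΦ.continuousAt.tendsto.mono_left nhdsWithin_le_nhds
  -- The source is at most of order `|x - p|^(-1/2)`, which the factor `x - p` outweighs.
  have hpole : Tendsto (fun x => source γ p x * fderiv ℝ w x (x - p)) (𝓝[≠] p) (𝓝 0) := by
    have hA : Tendsto (fun x : Plane => A / √κ * √‖x - p‖ * ‖fderiv ℝ w x‖) (𝓝[≠] p) (𝓝 0) := by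
      have h1 : Tendsto (fun x : Plane => √‖x - p‖) (𝓝[≠] p) (𝓝 0) := by
        have := (Real.continuous_sqrt.tendsto 0).comp hsub0
        simpa [Function.comp_def] using this
      simpa using (h1.const_mul (A / √κ)).mul (cfd hw).norm
    refine squeeze_zero_norm' ?_ hA
    filter_upwards [self_mem_nhdsWithin] with x hx
    have hρ : 0 < ‖x - p‖ := norm_pos_iff.2 (sub_ne_zero.2 hx)
    have hsρ := Real.sqrt_pos.2 hρ
    have hsκ := Real.sqrt_pos.2 hκ
    rw [norm_mul]
    calc _ ≤ A / √(κ * ‖x - p‖) * (‖fderiv ℝ w x‖ * ‖x - p‖) :=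
          mul_le_mul (norm_source_le h hκ hx) ((fderiv ℝ w x).le_opNorm _) (norm_nonneg _)
            ((norm_nonneg _).trans (norm_source_le h hκ hx))
      _ = A / √κ * (‖x - p‖ / √‖x - p‖) * ‖fderiv ℝ w x‖ := by
          rw [Real.sqrt_mul hκ.le]; field_simp
      _ = _ := by rw [Real.div_sqrt]
  -- This derivative is `2qγ₁(q)` with `q = |x - p|²`, so its limit is the coefficient of the
  -- logarithm. It is the only term of the Wronskian that survives.
  have hflux : Tendsto (fun x => fderiv ℝ (source γ p) x (x - p)) (𝓝[≠] p) (𝓝 (-1)) := by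
    have hq : Tendsto (fun x : Plane => ‖x - p‖ ^ 2) (𝓝[≠] p) (𝓝[>] 0) := by
      refine tendsto_nhdsWithin_iff.2 ⟨by simpa using hsub0.pow 2, ?_⟩
      filter_upwards [self_mem_nhdsWithin] with x hx
      exact norm_sub_sq_pos hx
    have := (h.tendsto.comp hq).const_mul 2
    rw [show (2 : ℂ) * (-1 / 2) = -1 by ring] at this
    refine this.congr' ?_
    filter_upwards [self_mem_nhdsWithin] with x hx
    rw [fderiv_source_apply h hx, real_inner_self_eq_norm_sq, Function.comp_apply]
    push_cast; ring
  have hmain := ((hΦp.mul (efd hw)).add hpole).sub (hwp.mul ((efd hΦ).add hflux))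
  simp only [mul_zero, add_zero, zero_add, zero_sub, mul_neg, mul_one, neg_neg] at hmain
  refine hmain.congr' ?_
  have hΦd : ∀ᶠ x in 𝓝[≠] p, DifferentiableAt ℝ Φ x := by
    refine eventually_nhdsWithin_of_eventually_nhds ?_
    filter_upwards [hΦ.eventually (by simp)] with x hx
    exact hx.differentiableAt one_ne_zero
  filter_upwards [hΦd, self_mem_nhdsWithin] with x hx hxp
  have hd := (hasFDerivAt_source h hxp).differentiableAt
  rw [wronskian, fderiv_fun_add hx hd]
  simp only [add_apply]
  ring

/-- Averages with the shrinking weights `cutoffSlope p δ` converge to the value at `p`. -/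
lemma tendsto_integral_cutoffSlope {p : Plane} {F : Plane → ℂ} {a : ℂ}
    (hp : p ∈ upperHalf) (hF : Tendsto F (𝓝[≠] p) (𝓝 a)) :
    ∀ e, 0 < e → ∀ᶠ δ in 𝓝[>] (0 : ℝ),
      (IntegrableOn (fun x => (cutoffSlope p δ x : ℂ) * F x) upperHalf) →
      ‖(∫ x in upperHalf, (cutoffSlope p δ x : ℂ) * F x) - cutoffMass * a‖ ≤ e * cutoffMass := by
  intro e he
  have h1 : ∀ᶠ x in 𝓝[≠] p, ‖F x - a‖ < e := by
    have := Metric.tendsto_nhds.1 hF e he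
    simpa [dist_eq_norm] using this
  rw [eventually_nhdsWithin_iff, Metric.eventually_nhds_iff_ball] at h1
  obtain ⟨r, hr, h1⟩ := h1
  obtain ⟨s, hs, h2⟩ := Metric.isOpen_iff.1 isOpen_upperHalf p hp
  have hsmall : ∀ᶠ δ in 𝓝[>] (0 : ℝ), 2 * δ < min r s := by
    refine eventually_nhdsWithin_of_eventually_nhds ?_
    have : ContinuousAt (fun δ : ℝ => 2 * δ) 0 := by fun_prop
    exact this.eventually (gt_mem_nhds (by simp [hr, hs]))
  filter_upwards [hsmall, self_mem_nhdsWithin] with δ hδ hδ0 hint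
  have hδ0 : 0 < δ := hδ0
  have hz : ∀ x, x ∉ upperHalf → cutoffSlope p δ x = 0 := by
    intro x hx
    refine cutoffSlope_eq_zero_of_gt hδ0 ?_
    by_contra hle
    refine hx (h2 ?_)
    rw [Metric.mem_ball, dist_eq_norm]
    linarith [min_le_right r s]
  have hmass : ∫ x in upperHalf, (cutoffSlope p δ x : ℂ) * a = cutoffMass * a := by
    rw [setIntegral_eq_integral_of_forall_compl_eq_zero (fun x hx => by simp [hz x hx]),
      integral_mul_const, integral_complex_ofReal, integral_cutoffSlope p hδ0]
  have hi : IntegrableOn (fun x => (cutoffSlope p δ x : ℂ) * a) upperHalf :=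
    ((integrable_cutoffSlope p hδ0).ofReal.mul_const a).integrableOn
  rw [← hmass, ← integral_sub hint hi]
  calc _ ≤ ∫ x in upperHalf, e * cutoffSlope p δ x := by
        refine norm_integral_le_of_norm_le
          ((integrable_cutoffSlope p hδ0).const_mul e).integrableOn
          (Eventually.of_forall fun x => ?_)
        rw [← mul_sub, norm_mul, Complex.norm_real, Real.norm_of_nonneg (cutoffSlope_nonneg _ _ _),
          mul_comm]
        by_cases hx1 : ‖x - p‖ < δ
        · rw [cutoffSlope_eq_zero_of_lt hδ0 hx1]; simp
        · by_cases hx2 : 2 * δ < ‖x - p‖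
          · rw [cutoffSlope_eq_zero_of_gt hδ0 hx2]; simp
          · gcongr
            · exact cutoffSlope_nonneg _ _ _
            · refine (h1 x ?_ ?_).le
              · rw [Metric.mem_ball, dist_eq_norm]
                linarith [min_le_left r s]
              · rintro rfl
                simp at hx1
                linarith
    _ = e * cutoffMass := by
        rw [setIntegral_eq_integral_of_forall_compl_eq_zero (fun x hx => by simp [hz x hx]),
          integral_const_mul, integral_cutoffSlope p hδ0]

/-! ### The representation formula and the estimate on the aperture -/

/-- The Neumann Green's function of the half-plane with pole `(s, b)`, up to a constant factor. -/
def halfPlaneSource (γ : ℝ → ℂ) (s b : ℝ) (x : Plane) : ℂ :=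
  source γ !₂[s, -b] x + source γ !₂[s, b] x

section halfPlaneSource
variable {κ A : ℝ} {γ γ₁ : ℝ → ℂ} {s b : ℝ}

lemma isOpen_compl_poles (s b : ℝ) : IsOpen ({!₂[s, -b], !₂[s, b]}ᶜ : Set Plane) :=
  (Set.toFinite _).isClosed.isOpen_compl

lemma contDiffOn_halfPlaneSource (h : OutgoingProfile κ A γ γ₁) :
    ContDiffOn ℝ ∞ (halfPlaneSource γ s b) {!₂[s, -b], !₂[s, b]}ᶜ :=
  ((contDiffOn_source h _).mono (by intro x hx; simp_all)).add
    ((contDiffOn_source h _).mono (by intro x hx; simp_all))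

lemma partialD_halfPlaneSource (h : OutgoingProfile κ A γ γ₁) {x : Plane}
    (hx : x ∈ ({!₂[s, -b], !₂[s, b]}ᶜ : Set Plane)) (i : Fin 2) :
    partialD i (halfPlaneSource γ s b) x
      = partialD i (source γ !₂[s, -b]) x + partialD i (source γ !₂[s, b]) x := by
  simp only [Set.mem_compl_iff, Set.mem_insert_iff, Set.mem_singleton_iff, not_or] at hx
  exact partialD_add (hasFDerivAt_source h hx.1).differentiableAt
    (hasFDerivAt_source h hx.2).differentiableAt i

lemma helmholtz_halfPlaneSource (h : OutgoingProfile κ A γ γ₁) {x : Plane}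
    (hx : x ∈ ({!₂[s, -b], !₂[s, b]}ᶜ : Set Plane)) :
    partialD 0 (partialD 0 (halfPlaneSource γ s b)) x
      + partialD 1 (partialD 1 (halfPlaneSource γ s b)) x
      = -(κ : ℂ) ^ 2 * halfPlaneSource γ s b x := by
  have he : ∀ i, partialD i (halfPlaneSource γ s b) =ᶠ[𝓝 x] fun x =>
      partialD i (source γ !₂[s, -b]) x + partialD i (source γ !₂[s, b]) x := fun i => by
    filter_upwards [(isOpen_compl_poles s b).mem_nhds hx] with y hy
    exact partialD_halfPlaneSource h hy i
  have hx' := hx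
  simp only [Set.mem_compl_iff, Set.mem_insert_iff, Set.mem_singleton_iff, not_or] at hx'
  have hd : ∀ (i : Fin 2) (p : Plane), x ≠ p → DifferentiableAt ℝ (partialD i (source γ p)) x :=
    fun i p hp => ((contDiffOn_partialD (contDiffOn_infty.1 (contDiffOn_source h p) 2)
      isOpen_compl_singleton (m := 1) (by norm_num) i).contDiffAt
      (isOpen_compl_singleton.mem_nhds hp)).differentiableAt one_ne_zero
  rw [partialD_congr (he 0), partialD_congr (he 1), partialD_add (hd 0 _ hx'.1) (hd 0 _ hx'.2),
    partialD_add (hd 1 _ hx'.1) (hd 1 _ hx'.2), halfPlaneSource]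
  linear_combination helmholtz_source h hx'.1 + helmholtz_source h hx'.2

lemma norm_sub_sq_eq (x : Plane) (s b : ℝ) :
    ‖x - !₂[s, b]‖ ^ 2 = (x 0 - s) ^ 2 + (x 1 - b) ^ 2 := by
  rw [norm_sq_eq]; simp

/-- On the line the pole and its image are equally far away, and their vertical offsets `-b` and `b`
cancel. -/
lemma partialD_one_halfPlaneSource_of_eq_zero (h : OutgoingProfile κ A γ γ₁) {x : Plane}
    (hx : x ∈ ({!₂[s, -b], !₂[s, b]}ᶜ : Set Plane)) (hx1 : x 1 = 0) :
    partialD 1 (halfPlaneSource γ s b) x = 0 := by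
  rw [partialD_halfPlaneSource h hx]
  simp only [Set.mem_compl_iff, Set.mem_insert_iff, Set.mem_singleton_iff, not_or] at hx
  rw [partialD_source h hx.1, partialD_source h hx.2, norm_sub_sq_eq, norm_sub_sq_eq, hx1]
  simp

lemma abs_sub_le_norm_sub (x : Plane) (s b : ℝ) : |x 1 - b| ≤ ‖x - !₂[s, b]‖ := by
  have := PiLp.norm_apply_le (x - !₂[s, b]) 1
  simpa using this

lemma abs_sub_le_norm_sub' (x : Plane) (s b : ℝ) : |x 0 - s| ≤ ‖x - !₂[s, b]‖ := by
  have := PiLp.norm_apply_le (x - !₂[s, b]) 0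
  simpa using this

/-- Localized wronskians are integrable. -/
lemma integrableOn_mul_wronskian {ε : ℝ} {c : ℂ} {w : Plane → ℂ} (hw : ApertureField κ ε c w)
    {Ψ : Plane → ℂ} {U : Set Plane} (hU : IsOpen U) (hΨ : ContDiffOn ℝ 1 Ψ U)
    {ψ : Plane → ℝ} (hψ : Continuous ψ) (hc : HasCompactSupport ψ) (hs : tsupport ψ ⊆ U)
    (q : Plane) :
    IntegrableOn (fun x => (ψ x : ℂ) * wronskian Ψ w q x) upperHalf := by
  have hcC : HasCompactSupport fun x => (ψ x : ℂ) := hc.comp_left (g := Complex.ofReal) rfl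
  have hsC : tsupport (fun x => (ψ x : ℂ)) ⊆ U :=
    (closure_mono fun x hx => by simpa using hx).trans hs
  have hψC : ContDiff ℝ 0 fun x => (ψ x : ℂ) :=
    contDiff_zero.2 (Complex.continuous_ofReal.comp hψ)
  have hco : ∀ i : Fin 2, ContDiffOn ℝ 0 (fun x : Plane => Ψ x * ((x i - q i : ℝ) : ℂ)) U :=
    fun i => contDiffOn_zero.2 (hΨ.continuousOn.mul (by fun_prop))
  have hcf : ContDiffOn ℝ 0 (fun x : Plane => fderiv ℝ Ψ x (x - q)) U :=
    (hΨ.fderiv_of_isOpen hU (m := 0) le_rfl).clm_apply (contDiffOn_id.sub contDiffOn_const)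
  have h0 := fun i => integrableOn_upperHalf_mul (hw.integrableOn_partialD i)
    (contDiff_mul_of_tsupport_subset hU hψC (hco i) hsC).continuous hcC.mul_right
  have h1 := integrableOn_upperHalf_mul hw.integrableOn
    (contDiff_mul_of_tsupport_subset hU hψC hcf hsC).continuous hcC.mul_right
  refine (((h0 0).add (h0 1)).sub h1).congr_fun (fun x _ => ?_) measurableSet_upperHalf
  simp only [Pi.add_apply, Pi.sub_apply, wronskian]
  rw [fderiv_apply_eq_sum (f := w)]
  simp only [PiLp.sub_apply]
  ring

lemma tsupport_cutoffSlope_subset (p : Plane) {r : ℝ} (hr : 0 < r) :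
    tsupport (cutoffSlope p r) ⊆ {x | r ≤ ‖x - p‖ ∧ ‖x - p‖ ≤ 2 * r} := by
  refine closure_minimal (fun x hx => ?_) ?_
  · constructor
    · by_contra h; exact hx (cutoffSlope_eq_zero_of_lt hr (not_le.1 h))
    · by_contra h; exact hx (cutoffSlope_eq_zero_of_gt hr (not_le.1 h))
  · have hc : Continuous fun x : Plane => ‖x - p‖ := by fun_prop
    exact (isClosed_le continuous_const hc).inter (isClosed_le hc continuous_const)

/-- The representation formula before the cutoff around the pole is removed. -/
lemma ApertureField.integral_cutoffSlope_wronskian {ε : ℝ} {c : ℂ} {w : Plane → ℂ}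
    (hw : ApertureField κ ε c w) (h : OutgoingProfile κ A γ γ₁) (hκ : 0 < κ) (hA : 0 < A)
    (hε : 0 ≤ ε) {δ : ℝ} (hδ : 0 < δ) (hδb : 2 * δ < b) :
    IntegrableOn (fun x => (cutoffSlope !₂[s, b] δ x : ℂ)
        * wronskian (halfPlaneSource γ s b) w !₂[s, b] x) upperHalf ∧
    ∫ x in upperHalf, (cutoffSlope !₂[s, b] δ x : ℂ)
        * wronskian (halfPlaneSource γ s b) w !₂[s, b] x
      = -∫ t in (0 : ℝ)..ε, c * halfPlaneSource γ s b !₂[t, 0] := by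
  set p : Plane := !₂[s, b] with hp
  set p' : Plane := !₂[s, -b] with hp'
  set Ψ := halfPlaneSource γ s b with hΨdef
  have hU := isOpen_compl_poles s b
  rw [← hp, ← hp'] at hU
  have hΨ : ContDiffOn ℝ ∞ Ψ {p', p}ᶜ := contDiffOn_halfPlaneSource h
  have hΨ1 : ContDiffOn ℝ 1 Ψ {p', p}ᶜ := hΨ.of_le (by exact_mod_cast le_top)
  have hb : 0 < b := by linarith
  have hpp : 2 * b ≤ ‖p - p'‖ := by
    have := abs_sub_le_norm_sub p s (-b)
    simp only [hp, PiLp.toLp_apply, Matrix.cons_val_one, Matrix.cons_val_fin_one] at this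
    rw [abs_of_pos (by linarith)] at this
    linarith
  have hpp' : 2 * b ≤ ‖p' - p‖ := by rwa [norm_sub_rev]
  have hup : ∀ x : Plane, 0 ≤ x 1 → 2 * δ < ‖x - p'‖ := fun x hx => by
    have := (le_abs_self _).trans (abs_sub_le_norm_sub x s (-b))
    linarith
  have hi : IntegrableOn (fun x => (cutoffSlope p δ x : ℂ) * wronskian Ψ w p x) upperHalf := by
    refine integrableOn_mul_wronskian hw hU hΨ1 (continuous_cutoffSlope p δ)
      (hasCompactSupport_cutoffSlope p hδ) (fun x hx => ?_) p
    have hx := tsupport_cutoffSlope_subset p hδ hx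
    rintro (rfl | hxp)
    · linarith [hx.2]
    · rw [Set.mem_singleton_iff.1 hxp] at hx
      have := hx.1
      simp at this
      linarith
  refine ⟨hi, ?_⟩
  have key : ∀ R : ℝ, ‖p‖ + ‖p'‖ + 2 * δ + ε < R →
      (∫ x in upperHalf, (cutoffSlope p δ x : ℂ) * wronskian Ψ w p x)
        - ∫ x in upperHalf, (cutoffSlope 0 R x : ℂ) * wronskian Ψ w 0 x
      = -∫ t in (0 : ℝ)..ε, c * Ψ !₂[t, 0] := by
    intro R hR
    have hn := norm_nonneg p
    have hn' := norm_nonneg p'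
    have hR0 : 0 < R := by linarith
    -- The large disc truncates at infinity, the small ones remove the poles. The image pole lies
    -- below the half-plane, but the test function `ξΨ` must be smooth on the whole plane; on the
    -- half-plane the third cutoff is zero.
    set ξ : Plane → ℂ := fun x => discCutoff 0 R x - discCutoff p δ x - discCutoff p' δ x with hξd
    have hξ : ContDiff ℝ ∞ ξ := ((contDiff_discCutoff 0 R).sub (contDiff_discCutoff p δ)).sub
      (contDiff_discCutoff p' δ)
    have hξc : HasCompactSupport ξ :=
      ((hasCompactSupport_discCutoff 0 hR0).sub (hasCompactSupport_discCutoff p hδ)).sub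
        (hasCompactSupport_discCutoff p' hδ)
    have hξs : tsupport ξ ⊆ {p', p}ᶜ := by
      have hz : ∀ q q' : Plane, ‖q‖ + δ < R → 2 * b ≤ ‖q - q'‖ → ∀ᶠ x in 𝓝 q,
          discCutoff 0 R x = 1 ∧ discCutoff q δ x = 1 ∧ discCutoff q' δ x = 0 := by
        intro q q' hq hqq
        filter_upwards [Metric.ball_mem_nhds q hδ] with x hx
        rw [Metric.mem_ball, dist_eq_norm] at hx
        have e1 : ‖x‖ ≤ ‖q‖ + ‖x - q‖ := norm_le_insert' _ _
        have e2 : ‖q - q'‖ ≤ ‖x - q‖ + ‖x - q'‖ := by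
          calc ‖q - q'‖ = ‖(x - q') - (x - q)‖ := by congr 1; abel
            _ ≤ _ := by rw [add_comm]; exact norm_sub_le _ _
        exact ⟨discCutoff_eq_one hR0 (by rw [sub_zero]; linarith), discCutoff_eq_one hδ hx.le,
          discCutoff_eq_zero hδ (by linarith)⟩
      intro x hx hxq
      refine notMem_tsupport_iff_eventuallyEq.2 ?_ hx
      rcases hxq with rfl | hxq
      · filter_upwards [hz _ p (by linarith) hpp'] with y hy
        simp [hξd, hy.1, hy.2.1, hy.2.2]
      · rw [Set.mem_singleton_iff.1 hxq]
        filter_upwards [hz p p' (by linarith) hpp] with y hy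
        simp [hξd, hy.1, hy.2.1, hy.2.2]
    have hg := hw.green_cutoff hU hΨ (fun x hx => helmholtz_halfPlaneSource h hx)
      (fun x hx hx1 => partialD_one_halfPlaneSource_of_eq_zero h hx hx1) hξ hξc hξs
    have hiR : IntegrableOn (fun x => (cutoffSlope 0 R x : ℂ) * wronskian Ψ w 0 x) upperHalf := by
      refine integrableOn_mul_wronskian hw hU hΨ1 (continuous_cutoffSlope 0 R)
        (hasCompactSupport_cutoffSlope 0 hR0) (fun x hx => ?_) 0
      have hx := (tsupport_cutoffSlope_subset 0 hR0 hx).1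
      rw [sub_zero] at hx
      rintro (rfl | hxp)
      · linarith
      · rw [Set.mem_singleton_iff.1 hxp] at hx
        linarith
    rw [← integral_sub hi hiR]
    calc _ = ∫ x in upperHalf, (Ψ x * (partialD 0 w x * partialD 0 ξ x
            + partialD 1 w x * partialD 1 ξ x)
          - w x * (partialD 0 Ψ x * partialD 0 ξ x + partialD 1 Ψ x * partialD 1 ξ x)) := by
          refine setIntegral_congr_fun measurableSet_upperHalf fun x hx => ?_
          have hx0 : cutoffSlope p' δ x = 0 :=
            cutoffSlope_eq_zero_of_gt hδ (hup x (le_of_lt hx))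
          have hd : ∀ q r, DifferentiableAt ℝ (discCutoff q r) x := fun q r =>
            (contDiff_discCutoff q r).differentiable (by simp) x
          have hξi : ∀ i, partialD i ξ x = (cutoffSlope p δ x : ℂ) * ((x i - p i : ℝ) : ℂ)
              - (cutoffSlope 0 R x : ℂ) * ((x i - (0 : Plane) i : ℝ) : ℂ) := by
            intro i
            rw [hξd, partialD_sub ((hd _ _).fun_sub (hd _ _)) (hd _ _),
              partialD_sub (hd _ _) (hd _ _), partialD_discCutoff, partialD_discCutoff,
              partialD_discCutoff, hx0]
            push_cast; ring
          simp only [wronskian, fderiv_apply_eq_sum (f := w), fderiv_apply_eq_sum (f := Ψ), hξi,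
            PiLp.sub_apply]
          ring
      _ = _ := by
          rw [hg]
          congr 1
          refine intervalIntegral.integral_congr fun t ht => ?_
          rw [Set.uIcc_of_le hε] at ht
          have hξ1 : ξ !₂[t, 0] = 1 := by
            have e1 : ‖(!₂[t, 0] : Plane) - 0‖ ≤ R := by
              have : ‖(!₂[t, 0] : Plane)‖ ^ 2 = t ^ 2 := by rw [norm_sq_eq]; simp
              rw [sub_zero, (pow_left_inj₀ (norm_nonneg _) ht.1 two_ne_zero).1 this]
              linarith [ht.2]
            have e2 : 2 * δ ≤ ‖(!₂[t, 0] : Plane) - p‖ := by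
              have := abs_sub_le_norm_sub (!₂[t, 0] : Plane) s b
              simp only [Matrix.cons_val_one, Matrix.cons_val_fin_one, zero_sub, abs_neg,
                abs_of_pos hb] at this
              linarith
            rw [hξd]
            simp only
            rw [discCutoff_eq_one hR0 e1, discCutoff_eq_zero hδ e2,
              discCutoff_eq_zero hδ (hup _ (by simp)).le]
            ring
          rw [hξ1, one_mul]
  obtain ⟨C, hC, hfar⟩ := exists_farField_source h hκ hA p
  obtain ⟨C', hC', hfar'⟩ := exists_farField_source h hκ hA p'
  -- The sum of the two sources radiates, so the outer flux vanishes as `R → ∞`, while the other two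
  -- terms of `key` do not depend on `R`.
  have hinf := tendsto_integral_wronskian_atTop (C := C' + C)
    (R₀ := 2 * ‖p‖ + 2 * ‖p'‖ + 1) (Ψ := Ψ) hw.contDiffOn
    hw.integrableOn hw.radiation (by positivity)
    (fun x hx => by
      have e := (hfar x (by linarith [norm_nonneg p'])).1
      have e' := (hfar' x (by linarith [norm_nonneg p])).1
      rw [add_div]
      exact (norm_add_le _ _).trans (add_le_add e' e))
    (fun x hx => by
      have e := (hfar x (by linarith [norm_nonneg p'])).2
      have e' := (hfar' x (by linarith [norm_nonneg p])).2
      have hxp : x ≠ p := by rintro rfl; linarith [norm_nonneg p', norm_nonneg p]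
      have hxp' : x ≠ p' := by rintro rfl; linarith [norm_nonneg p', norm_nonneg p]
      have : radialD Ψ x = radialD (source γ p') x + radialD (source γ p) x := by
        have := fderiv_fun_add (hasFDerivAt_source h hxp').differentiableAt
          (hasFDerivAt_source h hxp).differentiableAt
        simp only [radialD]
        rw [← add_apply, ← this]
        rfl
      rw [add_div, this, show radialD (source γ p') x + radialD (source γ p) x
          - Complex.I * κ * Ψ x = (radialD (source γ p') x - Complex.I * κ * source γ p' x)
          + (radialD (source γ p) x - Complex.I * κ * source γ p x) by
        rw [hΨdef, halfPlaneSource]; ring]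
      exact (norm_add_le _ _).trans (add_le_add e' e))
  have hlim := hinf.const_sub
    (∫ x in upperHalf, (cutoffSlope p δ x : ℂ) * wronskian Ψ w p x)
  rw [sub_zero] at hlim
  refine tendsto_nhds_unique hlim (tendsto_const_nhds.congr' ?_)
  filter_upwards [eventually_gt_atTop (‖p‖ + ‖p'‖ + 2 * δ + ε)] with R hR
  exact (key R hR).symm

/-- The field above the aperture in terms of its normal derivative on the aperture. -/
theorem ApertureField.representation {ε : ℝ} {c : ℂ} {w : Plane → ℂ}
    (hw : ApertureField κ ε c w) (h : OutgoingProfile κ A γ γ₁) (hκ : 0 < κ) (hA : 0 < A)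
    (hε : 0 ≤ ε) (hb : 0 < b) :
    cutoffMass * w !₂[s, b] = -∫ t in (0 : ℝ)..ε, c * halfPlaneSource γ s b !₂[t, 0] := by
  have hp : (!₂[s, b] : Plane) ∈ upperHalf := by simpa [upperHalf] using hb
  have hpp : (!₂[s, b] : Plane) ≠ !₂[s, -b] := fun he => by
    have := congrFun (congrArg WithLp.ofLp he) 1
    simp at this
    linarith
  have hF := tendsto_wronskian_pole h hκ (w := w) (Φ := source γ !₂[s, -b])
    (hw.contDiffOn.contDiffAt (isOpen_upperHalf.mem_nhds hp))
    (((contDiffOn_source h _).contDiffAt (isOpen_compl_singleton.mem_nhds hpp)).of_le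
      (by exact_mod_cast le_top))
  set K := -∫ t in (0 : ℝ)..ε, c * halfPlaneSource γ s b !₂[t, 0] with hK
  -- The aperture integral `K` does not depend on `δ`, so for each tolerance a single small `δ`
  -- suffices.
  have hle : ∀ e : ℝ, 0 < e → ‖K - cutoffMass * w !₂[s, b]‖ ≤ e := by
    intro e he
    have h1 := tendsto_integral_cutoffSlope hp hF (e / cutoffMass) (div_pos he cutoffMass_pos)
    have hsmall : ∀ᶠ δ in 𝓝[>] (0 : ℝ), 2 * δ < b := by
      refine eventually_nhdsWithin_of_eventually_nhds ?_
      have : ContinuousAt (fun δ : ℝ => 2 * δ) 0 := by fun_prop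
      exact this.eventually (gt_mem_nhds (by simpa using hb))
    obtain ⟨δ, ⟨h2, h3⟩, h4⟩ := ((h1.and hsmall).and self_mem_nhdsWithin).exists
    obtain ⟨h5, h6⟩ := hw.integral_cutoffSlope_wronskian (s := s) h hκ hA hε h4 h3
    have h7 := h2 h5
    rw [div_mul_cancel₀ _ cutoffMass_pos.ne'] at h7
    rw [hK, ← h6]
    exact h7
  have : ‖K - cutoffMass * w !₂[s, b]‖ ≤ 0 := le_of_forall_pos_le_add fun e he => by
    rw [zero_add]; exact hle e he
  exact (sub_eq_zero.1 (norm_le_zero_iff.1 this)).symm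

/-- Split at the singularity: on either side `∫₀ᵃ u^(-1/2) du = 2√a ≤ 2√ε`. -/
lemma norm_integral_le_of_inv_sqrt {f : ℝ → ℂ} {s ε B : ℝ} (hs : s ∈ Set.Ioo 0 ε) (hB : 0 ≤ B)
    (hf : Continuous f) (hle : ∀ t, t ≠ s → ‖f t‖ ≤ B * |t - s| ^ (-(1 / 2) : ℝ)) :
    ‖∫ t in (0 : ℝ)..ε, f t‖ ≤ 4 * B * √ε := by
  have hi : ∀ a b : ℝ, IntervalIntegrable (fun u : ℝ => B * u ^ (-(1 / 2) : ℝ)) volume a b :=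
    fun a b => (intervalIntegral.intervalIntegrable_rpow' (by norm_num)).const_mul B
  have hval : ∀ a : ℝ, 0 < a → a ≤ ε → ∫ u in (0 : ℝ)..a, B * u ^ (-(1 / 2) : ℝ) ≤ 2 * B * √ε := by
    intro a ha haε
    rw [intervalIntegral.integral_const_mul, integral_rpow (Or.inl (by norm_num))]
    norm_num
    rw [← Real.sqrt_eq_rpow]
    have := Real.sqrt_le_sqrt haε
    nlinarith
  rw [← intervalIntegral.integral_add_adjacent_intervals (b := s) (hf.intervalIntegrable _ _)
    (hf.intervalIntegrable _ _)]
  have hne : ∀ᵐ t : ℝ, t ≠ s := (Set.countable_singleton s).ae_notMem volume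
  have h1 : ‖∫ t in (0 : ℝ)..s, f t‖ ≤ 2 * B * √ε := by
    have hg : IntervalIntegrable (fun t : ℝ => B * (s - t) ^ (-(1 / 2) : ℝ)) volume 0 s := by
      simpa using (hi s 0).comp_sub_left s
    refine (intervalIntegral.norm_integral_le_of_norm_le hs.1.le ?_ hg).trans ?_
    · filter_upwards [hne] with t hts ht
      have := hle t hts
      rwa [abs_sub_comm, abs_of_nonneg (by linarith [ht.2])] at this
    · rw [intervalIntegral.integral_comp_sub_left (fun u => B * u ^ (-(1 / 2) : ℝ)) s]
      simpa using hval s hs.1 hs.2.le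
  have h2 : ‖∫ t in s..ε, f t‖ ≤ 2 * B * √ε := by
    have hg : IntervalIntegrable (fun t : ℝ => B * (t - s) ^ (-(1 / 2) : ℝ)) volume s ε := by
      simpa using (hi 0 (ε - s)).comp_sub_right s
    refine (intervalIntegral.norm_integral_le_of_norm_le hs.2.le ?_ hg).trans ?_
    · filter_upwards [hne] with t hts ht
      have := hle t hts
      rwa [abs_of_nonneg (by linarith [ht.1])] at this
    · rw [intervalIntegral.integral_comp_sub_right (fun u => B * u ^ (-(1 / 2) : ℝ)) s]
      simpa using hval (ε - s) (by linarith [hs.2]) (by linarith [hs.1])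
  calc _ ≤ _ := norm_add_le _ _
    _ ≤ _ := by linarith

/-- The trace on the aperture is controlled by the normal derivative there. -/
theorem ApertureField.norm_le {ε : ℝ} {c : ℂ} {w : Plane → ℂ}
    (hw : ApertureField κ ε c w) (h : OutgoingProfile κ A γ γ₁) (hκ : 0 < κ) (hA : 0 < A)
    (hs : s ∈ Set.Ioo 0 ε) (hb : 0 < b) :
    ‖w !₂[s, b]‖ ≤ 8 * A / cutoffMass * ‖c‖ * √ε / √κ := by
  have hM := cutoffMass_pos
  have hrep := hw.representation (s := s) h hκ hA (hs.1.trans hs.2).le hb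
  have hU : ∀ t : ℝ, (!₂[t, 0] : Plane) ∈ ({!₂[s, -b], !₂[s, b]}ᶜ : Set Plane) := by
    intro t ht
    rcases ht with he | he
    · have := congrFun (congrArg WithLp.ofLp he) 1
      simp at this; linarith
    · have := congrFun (congrArg WithLp.ofLp he) 1
      simp at this; linarith
  have hcont : Continuous fun t : ℝ => c * halfPlaneSource γ s b !₂[t, 0] :=
    continuous_const.mul ((contDiffOn_halfPlaneSource h).continuousOn.comp_continuous
      (by fun_prop) hU)
  have hsκ : 0 < √κ := Real.sqrt_pos.2 hκ
  have hbound : ∀ t, t ≠ s → ‖c * halfPlaneSource γ s b !₂[t, 0]‖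
      ≤ (2 * A * ‖c‖ / √κ) * |t - s| ^ (-(1 / 2) : ℝ) := by
    intro t ht
    have hts : 0 < |t - s| := abs_pos.2 (sub_ne_zero.2 ht)
    -- The horizontal distance bounds the distance to either pole from below. The estimate is thus
    -- uniform in the height `b` and survives the passage to the trace.
    have hone : ∀ b : ℝ, ‖source γ !₂[s, b] !₂[t, 0]‖ ≤ A / (√κ * √|t - s|) := by
      intro b
      have hle : |t - s| ≤ ‖(!₂[t, 0] : Plane) - !₂[s, b]‖ := by
        simpa using abs_sub_le_norm_sub' !₂[t, 0] s b
      have hne : (!₂[t, 0] : Plane) ≠ !₂[s, b] := fun he => by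
        rw [he, sub_self, norm_zero] at hle
        linarith
      refine (norm_source_le h hκ hne).trans ?_
      rw [← Real.sqrt_mul hκ.le]
      gcongr
    rw [norm_mul, Real.rpow_neg hts.le, ← Real.sqrt_eq_rpow]
    calc _ ≤ ‖c‖ * (A / (√κ * √|t - s|) + A / (√κ * √|t - s|)) := by
          gcongr
          exact (norm_add_le _ _).trans (add_le_add (hone _) (hone _))
      _ = _ := by field_simp; ring
  have hint := norm_integral_le_of_inv_sqrt hs (by positivity) hcont hbound
  have hn := congrArg norm hrep
  rw [norm_mul, norm_neg, Complex.norm_real, Real.norm_of_nonneg hM.le] at hn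
  calc ‖w !₂[s, b]‖ = (cutoffMass * ‖w !₂[s, b]‖) / cutoffMass := by field_simp
    _ ≤ 4 * (2 * A * ‖c‖ / √κ) * √ε / cutoffMass := by rw [hn]; gcongr
    _ = _ := by field_simp; ring

end halfPlaneSource

/-! ### The coefficient of the zeroth mode -/

lemma half_le_cos {x : ℝ} (h0 : 0 ≤ x) (h1 : x ≤ 1) : 1 / 2 ≤ Real.cos x := by
  have := Real.one_sub_sq_div_two_le_cos (x := x)
  nlinarith

lemma exp_I_mul_mul (κ d : ℝ) :
    Complex.exp (Complex.I * κ * d) = Complex.exp (((κ * d : ℝ) : ℂ) * Complex.I) := by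
  congr 1; push_cast; ring

lemma exp_add_exp_neg (κ d : ℝ) :
    Complex.exp (Complex.I * κ * d) + Complex.exp (-(Complex.I * κ * d))
      = ((2 * Real.cos (κ * d) : ℝ) : ℂ) := by
  push_cast
  rw [Complex.two_cos]
  congr 2 <;> ring_nf

lemma norm_exp_sub_exp_neg_le (κ d : ℝ) :
    ‖Complex.exp (Complex.I * κ * d) - Complex.exp (-(Complex.I * κ * d))‖ ≤ 2 := by
  refine (norm_sub_le _ _).trans (le_of_eq ?_)
  have h : -(Complex.I * κ * d) = Complex.I * κ * ((-d : ℝ) : ℂ) := by push_cast; ring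
  rw [h, exp_I_mul_mul, exp_I_mul_mul, Complex.norm_exp_ofReal_mul_I,
    Complex.norm_exp_ofReal_mul_I]
  norm_num

/-- The quotient of exponentials is `i tan κd`. Its smallness for small `κd` is not needed: bounding
the numerator by 2 and the cosine below by 1/2 is enough. -/
lemma norm_dtn0_le {κ ε d : ℝ} (hκ : 0 < κ) (hd : 0 < d) (hκd : κ * d ≤ 1) (v : Plane → ℂ) :
    ‖dtn0 κ ε d v 0‖ ≤ 2 * κ * ‖v0plus ε v‖ / √ε := by
  have hc := half_le_cos (mul_nonneg hκ.le hd.le) hκd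
  rw [dtn0, exp_add_exp_neg, phi0]
  simp only [norm_mul, norm_div, Complex.norm_I, Complex.norm_real, one_mul,
    Real.norm_of_nonneg hκ.le]
  rw [norm_one, Real.norm_of_nonneg (Real.sqrt_nonneg ε),
    Real.norm_of_nonneg (by positivity : (0 : ℝ) ≤ 2),
    Real.norm_of_nonneg (by linarith : 0 ≤ Real.cos (κ * d))]
  calc _ ≤ κ * (2 / (2 * (1 / 2))) * ‖v0plus ε v‖ * (1 / √ε) := by
        gcongr
        exact norm_exp_sub_exp_neg_le κ d
    _ = _ := by ring

/-- On the line both waves equal `e^{iκt sin θ}`, and `|e^{ix} - 1| ≤ |x|`. -/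
lemma norm_background_sub_two_le {κ θ : ℝ} (hκ : 0 < κ) {t ε : ℝ} (ht : t ∈ Set.Ioo 0 ε) :
    ‖background κ θ !₂[t, 0] - 2‖ ≤ 2 * (κ * ε) := by
  have h : background κ θ !₂[t, 0] - 2
      = 2 * (Complex.exp (Complex.I * ((κ * t * Real.sin θ : ℝ) : ℂ)) - 1) := by
    rw [background, uInc, uRef]
    simp only [Matrix.cons_val_zero, Matrix.cons_val_one, Matrix.cons_val_fin_one, zero_mul,
      sub_zero, add_zero]
    have : Complex.I * κ * ((t * Real.sin θ : ℝ) : ℂ)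
        = Complex.I * ((κ * t * Real.sin θ : ℝ) : ℂ) := by push_cast; ring
    rw [this]; ring
  rw [h, norm_mul, Complex.norm_ofNat]
  gcongr
  refine (Real.norm_exp_I_mul_ofReal_sub_one_le).trans ?_
  rw [Real.norm_eq_abs, abs_mul, abs_mul, abs_of_pos hκ, abs_of_pos ht.1]
  calc κ * t * |Real.sin θ| ≤ κ * ε * 1 := by
        have := ht.2.le
        have := ht.1.le
        have := this.trans ht.2.le
        gcongr
        exact Real.abs_sin_le_one θ
    _ = _ := mul_one _

/-- The trace of the field on the aperture is close to two. -/
lemma IsApproxSolution.norm_trace_sub_two_le {κ A θ ε d : ℝ} {γ γ₁ : ℝ → ℂ} {v : Plane → ℂ}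
    (hv : IsApproxSolution κ θ ε d v) (h : OutgoingProfile κ A γ γ₁) (hκ : 0 < κ) (hA : 0 < A)
    (hε : 0 < ε) (hd : 0 < d) (hκd : κ * d ≤ 1) :
    ∀ᵐ t ∂(volume.restrict (Set.Ioo 0 ε)),
      ‖v !₂[t, 0] - 2‖ ≤ 2 * (κ * ε) + 16 * A / cutoffMass * √κ * ‖v0plus ε v‖ := by
  filter_upwards [hv.trace, ae_restrict_mem measurableSet_Ioo] with t ht hmem
  have hM := cutoffMass_pos
  have hsκ := Real.sqrt_pos.2 hκ
  have hsε := Real.sqrt_pos.2 hε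
  have hw : ∀ s : ℝ, 0 < s →
      ‖scattered κ θ v !₂[t, s]‖ ≤ 16 * A / cutoffMass * √κ * ‖v0plus ε v‖ := by
    intro s hs
    refine (hv.apertureField.norm_le h hκ hA hmem hs).trans ?_
    calc _ ≤ 8 * A / cutoffMass * (2 * κ * ‖v0plus ε v‖ / √ε) * √ε / √κ := by
          gcongr
          exact norm_dtn0_le hκ hd hκd v
      _ = 16 * A / cutoffMass * (κ / √κ) * ‖v0plus ε v‖ := by field_simp; ring
      _ = _ := by rw [Real.div_sqrt]
  have hu : Tendsto (fun s : ℝ => background κ θ !₂[t, s]) (𝓝[>] 0)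
      (𝓝 (background κ θ !₂[t, 0])) := by
    have hc : Continuous fun s : ℝ => background κ θ !₂[t, s] :=
      (contDiff_background κ θ (n := 0)).continuous.comp (by fun_prop)
    exact (hc.tendsto 0).mono_left nhdsWithin_le_nhds
  have hlim : Tendsto (fun s : ℝ => scattered κ θ v !₂[t, s]) (𝓝[>] 0)
      (𝓝 (v !₂[t, 0] - background κ θ !₂[t, 0])) := ht.sub hu
  have hle := le_of_tendsto hlim.norm (by
    filter_upwards [self_mem_nhdsWithin] with s hs
    exact hw s hs)
  calc ‖v !₂[t, 0] - 2‖
      = ‖(background κ θ !₂[t, 0] - 2) + (v !₂[t, 0] - background κ θ !₂[t, 0])‖ := by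
        congr 1; ring
    _ ≤ _ := (norm_add_le _ _).trans (add_le_add (norm_background_sub_two_le hκ hmem) hle)

/-- The trace is almost everywhere the limit of the continuous functions `t ↦ v (t, 1/(n+1))`.
Without measurability the integral in `coeff0` could be the default value 0. -/
lemma IsApproxSolution.aestronglyMeasurable_trace {κ θ ε d : ℝ} {v : Plane → ℂ}
    (hv : IsApproxSolution κ θ ε d v) :
    AEStronglyMeasurable (fun t : ℝ => v !₂[t, 0]) (volume.restrict (Set.Ioo 0 ε)) := by
  refine aestronglyMeasurable_of_tendsto_ae (atTop : Filter ℕ)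
    (f := fun n t => v !₂[t, 1 / ((n : ℝ) + 1)]) (fun n => ?_) ?_
  · refine Continuous.aestronglyMeasurable
      (hv.smooth.continuousOn.comp_continuous (by fun_prop) fun t => ?_)
    simp only [upperHalf, Set.mem_ofPred_eq, Matrix.cons_val_one, Matrix.cons_val_fin_one]
    positivity
  · filter_upwards [hv.trace] with t ht
    exact ht.comp (tendsto_nhdsWithin_iff.2 ⟨tendsto_one_div_add_atTop_nhds_zero_nat,
      Eventually.of_forall fun n => by simp only [Set.mem_Ioi]; positivity⟩)

/-- The constant 2 has coefficient `2√ε`, and a deviation of at most `m` on the aperture changes the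
coefficient by at most `m√ε`. The right side still contains `v₀⁺`, to be absorbed when `κε` is
small. -/
lemma IsApproxSolution.norm_v0plus_sub_le {κ A θ ε d : ℝ} {γ γ₁ : ℝ → ℂ} {v : Plane → ℂ}
    (hv : IsApproxSolution κ θ ε d v) (h : OutgoingProfile κ A γ γ₁) (hκ : 0 < κ) (hA : 0 < A)
    (hε : 0 < ε) (hd : 0 < d) (hκd : κ * d ≤ 1) :
    ‖v0plus ε v - 2 * √ε‖
      ≤ (2 * (κ * ε) + 16 * A / cutoffMass * √κ * ‖v0plus ε v‖) * √ε := by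
  set m := 2 * (κ * ε) + 16 * A / cutoffMass * √κ * ‖v0plus ε v‖ with hm
  have hsε := Real.sqrt_pos.2 hε
  have hb := hv.norm_trace_sub_two_le h hκ hA hε hd hκd
  have hconst : IntegrableOn (fun _ : ℝ => m) (Set.Ioo 0 ε) :=
    integrableOn_const measure_Ioo_lt_top.ne
  have hi2 : IntegrableOn (fun t : ℝ => v !₂[t, 0] - 2) (Set.Ioo 0 ε) :=
    hconst.mono' (hv.aestronglyMeasurable_trace.sub aestronglyMeasurable_const) hb
  have hi1 : IntegrableOn (fun _ : ℝ => (2 : ℂ)) (Set.Ioo 0 ε) :=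
    integrableOn_const measure_Ioo_lt_top.ne
  have hsum : v0plus ε v = (∫ t in Set.Ioo 0 ε, (v !₂[t, 0] - 2)) * ((1 / √ε : ℝ) : ℂ)
      + 2 * √ε := by
    have e1 : v0plus ε v = (∫ t in Set.Ioo 0 ε, v !₂[t, 0]) * ((1 / √ε : ℝ) : ℂ) := by
      rw [v0plus, coeff0]
      simp only [phi0, Complex.conj_ofReal]
      rw [intervalIntegral.integral_mul_const, intervalIntegral.integral_of_le hε.le,
        integral_Ioc_eq_integral_Ioo]
    have e2 : ∫ t in Set.Ioo 0 ε, v !₂[t, 0]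
        = (∫ t in Set.Ioo 0 ε, (v !₂[t, 0] - 2)) + ∫ _t in Set.Ioo 0 ε, (2 : ℂ) := by
      rw [← integral_add hi2 hi1]
      simp
    rw [e1, e2, setIntegral_const, measureReal_def, Real.volume_Ioo, sub_zero,
      ENNReal.toReal_ofReal hε.le, add_mul, Complex.real_smul]
    congr 1
    have h3 : (√ε : ℂ) ≠ 0 := by exact_mod_cast hsε.ne'
    have h4 : (√ε : ℂ) ^ 2 = ε := by exact_mod_cast Real.sq_sqrt hε.le
    rw [← h4]
    push_cast
    field_simp
  rw [hsum, add_sub_cancel_right, norm_mul, Complex.norm_real,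
    Real.norm_of_nonneg (by positivity)]
  have hn : ‖∫ t in Set.Ioo 0 ε, (v !₂[t, 0] - 2)‖ ≤ m * ε := by
    refine (norm_integral_le_of_norm_le hconst hb).trans (le_of_eq ?_)
    rw [setIntegral_const, measureReal_def, Real.volume_Ioo, sub_zero,
      ENNReal.toReal_ofReal hε.le, smul_eq_mul, mul_comm]
  calc _ ≤ m * ε * (1 / √ε) := by gcongr
    _ = m * (ε / √ε) := by ring
    _ = m * √ε := by rw [Real.div_sqrt]

/-! ### The field in the cavity -/

/-- The two exponentials combine to the standing wave with zero normal derivative at the bottom. The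
sine condition keeps `e^{2iκd} - 1` away from zero in the amplitudes, the cosine condition does the
same for the denominator of `v₀⁻`. -/
lemma cavityField_eq {κ ε d : ℝ} (hs : Real.sin (κ * d) ≠ 0) (hc : Real.cos (κ * d) ≠ 0)
    (v : Plane → ℂ) (x : Plane) :
    cavityField κ ε d v x
      = v0plus ε v * ((Real.cos (κ * (x 1 + d)) / Real.cos (κ * d) / √ε : ℝ) : ℂ) := by
  have hsum := exp_add_exp_neg κ d
  have hsum' := exp_add_exp_neg κ (x 1 + d)
  have hdiff : Complex.exp (Complex.I * κ * d) - Complex.exp (-(Complex.I * κ * d))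
      = 2 * Complex.I * (Real.sin (κ * d) : ℂ) := by
    have := Complex.two_sin ((κ * d : ℝ) : ℂ)
    rw [Complex.ofReal_sin]
    have e1 : Complex.I * κ * d = ((κ * d : ℝ) : ℂ) * Complex.I := by push_cast; ring
    rw [e1, ← neg_mul]
    linear_combination (-Complex.I) * this - (Complex.exp (-((κ * d : ℝ) : ℂ) * Complex.I)
      - Complex.exp (((κ * d : ℝ) : ℂ) * Complex.I)) * Complex.I_sq
  have e2 : Complex.exp (2 * (Complex.I * κ * d)) = Complex.exp (Complex.I * κ * d) ^ 2 := by
    rw [← Complex.exp_nat_mul]; norm_num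
  have e3 : Complex.exp (Complex.I * κ * ((x 1 : ℂ) + d))
      = Complex.exp (Complex.I * κ * (x 1 : ℂ)) * Complex.exp (Complex.I * κ * d) := by
    rw [← Complex.exp_add]; ring_nf
  rw [Complex.exp_neg] at hsum hdiff hsum'
  rw [Complex.ofReal_add, e3] at hsum'
  rw [cavityField, alphaPlus, alphaMinus, v0minus, phi0, e2, e3, Complex.exp_neg, Complex.exp_neg]
  set a := Complex.exp (Complex.I * κ * d) with ha
  set b := Complex.exp (Complex.I * κ * (x 1 : ℂ)) with hb
  have ha0 : a ≠ 0 := Complex.exp_ne_zero _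
  have hb0 : b ≠ 0 := Complex.exp_ne_zero _
  have h1 : a ^ 2 + 1 ≠ 0 := by
    intro h0
    have : a + a⁻¹ = 0 := by field_simp; rw [h0, mul_zero]
    rw [this] at hsum
    have : (2 * Real.cos (κ * d) : ℝ) = 0 := by exact_mod_cast hsum.symm
    exact hc (by linarith)
  have h2 : a ^ 2 - 1 ≠ 0 := by
    intro h0
    have : a - a⁻¹ = 0 := by field_simp; rw [h0, mul_zero]
    rw [this] at hdiff
    have h3 : (Real.sin (κ * d) : ℂ) ≠ 0 := by exact_mod_cast hs
    exact mul_ne_zero (mul_ne_zero two_ne_zero Complex.I_ne_zero) h3 hdiff.symm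
  have h3 : ((Real.cos (κ * (x 1 + d)) / Real.cos (κ * d) / √ε : ℝ) : ℂ)
      = (b * a + (b * a)⁻¹) / (a + a⁻¹) * ((1 / √ε : ℝ) : ℂ) := by
    rw [hsum, hsum']
    have : (Real.cos (κ * d) : ℂ) ≠ 0 := by exact_mod_cast hc
    push_cast at this ⊢
    field_simp
  rw [h3]
  have h4 : a + a⁻¹ = (a ^ 2 + 1) / a := by field_simp
  rw [h4]
  field_simp
  ring

lemma volume_cavity {ε d : ℝ} (hε : 0 < ε) : volume (cavity ε d) = ENNReal.ofReal (ε * d) := by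
  have h := (EuclideanSpace.volume_preserving_symm_measurableEquiv_toLp
    (Fin 2)).measure_preimage_equiv (Set.univ.pi fun i => Set.Ioo ((![0, -d] : Fin 2 → ℝ) i) ((![ε, 0] : Fin 2 → ℝ) i))
  rw [Real.volume_pi_Ioo, Fin.prod_univ_two] at h
  simp only [Matrix.cons_val_zero, Matrix.cons_val_one, Matrix.cons_val_fin_one, sub_zero,
    zero_sub, neg_neg] at h
  rw [ENNReal.ofReal_mul hε.le, ← h]
  congr 1
  ext x
  simp [cavity, Set.mem_pi, Fin.forall_fin_two, and_assoc]

lemma measurableSet_cavity (ε d : ℝ) : MeasurableSet (cavity ε d) := by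
  have hm : ∀ i : Fin 2, Measurable fun x : Plane => x i := fun i =>
    (EuclideanSpace.proj i : Plane →L[ℝ] ℝ).continuous.measurable
  exact (measurableSet_lt measurable_const (hm 0)).inter
    ((measurableSet_lt (hm 0) measurable_const).inter
      ((measurableSet_lt measurable_const (hm 1)).inter
        (measurableSet_lt (hm 1) measurable_const)))

lemma eLpNorm_const_cavity {ε d c : ℝ} (hε : 0 < ε) (hd : 0 < d) (hc : 0 ≤ c) :
    eLpNorm (fun _ : Plane => c) 2 (volume.restrict (cavity ε d))
      = ENNReal.ofReal (c * √(ε * d)) := by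
  rw [eLpNorm_const' c two_ne_zero ENNReal.ofNat_ne_top, Measure.restrict_apply_univ,
    volume_cavity hε, Real.enorm_of_nonneg hc, ENNReal.ofReal_mul hc, Real.sqrt_eq_rpow,
    ENNReal.ofReal_rpow_of_pos (by positivity)]
  simp

end OpenCavity

end

/-! ### Choice of constants and the two-sided bound -/

theorem theorem4p3 :
    ∃ C₃ C₄ δ : ℝ, 0 < C₃ ∧ 0 < C₄ ∧ 0 < δ ∧
      ∀ lam ε d θ : ℝ, 0 < lam → 0 < ε → 0 < d → ε ≤ δ * d → d ≤ δ * lam →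
        -(Real.pi / 2) < θ → θ < Real.pi / 2 →
        ∀ v : OpenCavity.Plane → ℂ,
          OpenCavity.IsApproxSolution (OpenCavity.wavenumber lam) θ ε d v →
          ENNReal.ofReal (C₃ * Real.sqrt (ε * d))
              ≤ eLpNorm v 2 (volume.restrict (OpenCavity.cavity ε d)) ∧
            eLpNorm v 2 (volume.restrict (OpenCavity.cavity ε d))
              ≤ ENNReal.ofReal (C₄ * Real.sqrt (ε * d)) := by
  obtain ⟨A, hA, hprof⟩ := OpenCavity.exists_outgoingProfile
  have hM := OpenCavity.cutoffMass_pos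
  set B := 16 * A / OpenCavity.cutoffMass with hB
  have hB0 : 0 < B := by positivity
  have hpi := Real.pi_pos
  -- The three bounds on `δ` give `κd ≤ 1`, then `2κε ≤ 1/2`, then `B√(κε) ≤ 1/2`, the last one
  -- being what absorption requires.
  refine ⟨1 / 2, 10, min (1 / (2 * Real.pi)) (min (1 / 4) (1 / (4 * B ^ 2))), by norm_num,
    by norm_num, by positivity, ?_⟩
  intro lam ε d θ hlam hε hd hεd hdl _ _ v hv
  set δ := min (1 / (2 * Real.pi)) (min (1 / 4) (1 / (4 * B ^ 2))) with hδ
  have hδ1 : δ ≤ 1 / (2 * Real.pi) := min_le_left _ _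
  have hδ2 : δ ≤ 1 / 4 := (min_le_right _ _).trans (min_le_left _ _)
  have hδ3 : δ ≤ 1 / (4 * B ^ 2) := (min_le_right _ _).trans (min_le_right _ _)
  have hδ0 : 0 < δ := by positivity
  set κ := OpenCavity.wavenumber lam with hκdef
  have hκ : 0 < κ := by rw [hκdef, OpenCavity.wavenumber]; positivity
  have hκd0 : 0 < κ * d := mul_pos hκ hd
  have hκd : κ * d ≤ 1 := by
    calc κ * d ≤ κ * (1 / (2 * Real.pi) * lam) := by
          gcongr
          exact hdl.trans (by gcongr)
      _ = 1 := by rw [hκdef, OpenCavity.wavenumber]; field_simp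
  have hκε : κ * ε ≤ δ := by
    calc κ * ε ≤ κ * (δ * d) := by gcongr
      _ = δ * (κ * d) := by ring
      _ ≤ δ * 1 := by gcongr
      _ = δ := mul_one _
  obtain ⟨γ, γ₁, h⟩ := hprof κ hκ
  have hmain := hv.norm_v0plus_sub_le h hκ hA hε hd hκd
  rw [← hB] at hmain
  set N := ‖OpenCavity.v0plus ε v‖ with hN
  have hN0 : 0 ≤ N := norm_nonneg _
  have hsε := Real.sqrt_pos.2 hε
  have hsmall : B * (√κ * √ε) ≤ 1 / 2 := by
    rw [← Real.sqrt_mul hκ.le]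
    calc B * √(κ * ε) ≤ B * √((1 / (2 * B)) ^ 2) := by
          gcongr
          refine (hκε.trans hδ3).trans (le_of_eq ?_)
          field_simp; norm_num
      _ = 1 / 2 := by rw [Real.sqrt_sq (by positivity)]; field_simp
  -- With only `N / 2` on the right, the triangle inequality in both directions yields `√ε ≤ N ≤
  -- 5√ε`.
  have hdist : ‖OpenCavity.v0plus ε v - 2 * √ε‖ ≤ √ε / 2 + N / 2 := by
    calc _ ≤ _ := hmain
      _ = 2 * (κ * ε) * √ε + (B * (√κ * √ε)) * N := by ring
      _ ≤ 2 * (1 / 4) * √ε + 1 / 2 * N := by gcongr; exact hκε.trans hδ2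
      _ = _ := by ring
  have h2 : ‖(2 * √ε : ℂ)‖ = 2 * √ε := by
    rw [norm_mul, Complex.norm_ofNat, Complex.norm_real, Real.norm_of_nonneg hsε.le]
  have hlow : √ε ≤ N := by
    have := norm_sub_norm_le (2 * √ε : ℂ) (OpenCavity.v0plus ε v)
    rw [norm_sub_rev, h2] at this
    linarith
  have hup : N ≤ 5 * √ε := by
    have := norm_sub_norm_le (OpenCavity.v0plus ε v) (2 * √ε : ℂ)
    rw [h2] at this
    linarith
  have hcos := OpenCavity.half_le_cos hκd0.le hκd
  have hsin : 0 < Real.sin (κ * d) :=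
    Real.sin_pos_of_pos_of_lt_pi hκd0 (by linarith [Real.pi_gt_three])
  -- Both cosines lie in `[1/2, 1]`, so their quotient lies in `[1/2, 2]`; it is multiplied by
  -- `N/√ε`, which lies in `[1, 5]`.
  have hval : ∀ x ∈ OpenCavity.cavity ε d, 1 / 2 ≤ ‖v x‖ ∧ ‖v x‖ ≤ 10 := by
    intro x hx
    have hy0 : 0 ≤ κ * (x 1 + d) := mul_nonneg hκ.le (by linarith [hx.2.2.1])
    have hy1 : κ * (x 1 + d) ≤ 1 := by
      refine le_trans ?_ hκd
      gcongr
      linarith [hx.2.2.2]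
    have hc1 := OpenCavity.half_le_cos hy0 hy1
    have hc2 := Real.cos_le_one (κ * (x 1 + d))
    have hc3 := Real.cos_le_one (κ * d)
    have hcp : 0 < Real.cos (κ * d) := by linarith
    rw [hv.inside x hx, OpenCavity.cavityField_eq hsin.ne' hcp.ne', norm_mul, Complex.norm_real,
      Real.norm_of_nonneg (by positivity), ← hN]
    have hq1 : 1 / 2 ≤ Real.cos (κ * (x 1 + d)) / Real.cos (κ * d) := by
      rw [le_div_iff₀ hcp]; nlinarith
    have hq2 : Real.cos (κ * (x 1 + d)) / Real.cos (κ * d) ≤ 2 := by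
      rw [div_le_iff₀ hcp]; linarith
    constructor
    · calc (1 / 2 : ℝ) = √ε * (1 / 2 / √ε) := by field_simp
        _ ≤ _ := by gcongr
    · calc _ ≤ 5 * √ε * (2 / √ε) := by gcongr
        _ = 10 := by field_simp; norm_num
  have hae := ae_restrict_mem (μ := volume) (OpenCavity.measurableSet_cavity ε d)
  constructor
  · rw [← OpenCavity.eLpNorm_const_cavity hε hd (by norm_num)]
    refine eLpNorm_mono_ae ?_
    filter_upwards [hae] with x hx
    rw [Real.norm_of_nonneg (by norm_num)]
    exact (hval x hx).1
  · rw [← OpenCavity.eLpNorm_const_cavity hε hd (by norm_num)]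
    refine eLpNorm_mono_ae ?_
    filter_upwards [hae] with x hx
    rw [Real.norm_of_nonneg (by norm_num)]
    exact (hval x hx).2
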